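/- **Setting.** Let $N\ge 0$, $\hbar>0$, and let $z=(p,x)$ denote the points of the phase space $\mathbb R^{2N}$, $\langle f\rangle=\int f\,d^{2N}z$. Fix widths $w_{p_n},w_{x_n}>0$ with $w_{p_n}w_{x_n}=\hbar/2$, and let $\mathcal K$ be the convolution with $\prod_n\frac{1}{2\pi w_{p_n}w_{x_n}}\exp\bigl(-\frac{p_n^2}{2w_{p_n}^2}-\frac{x_n^2}{2w_{x_n}^2}\bigr)$ (the Husimi transform). Arrows indicate the factor on which a derivative acts, and $$\Lambda=\overleftarrow{\partial_x}\cdot\overrightarrow{\partial_p}-\overleftarrow{\partial_p}\cdot\overrightarrow{\partial_x},\qquad \circledast=\exp\Bigl(\sum_n\bigl(w_{x_n}^2\overleftarrow{\partial_{x_n}}\overrightarrow{\partial_{x_n}}+w_{p_n}^2\overleftarrow{\partial_{p_n}}\overrightarrow{\partial_{p_n}}\bigr)\Bigr),\qquad \star=e^{i\hbar\Lambda/2},\qquad \star_H=\star\circledast .$$ Exponentials and $\operatorname{sinc}(u)=\sin(u)/u$ of such operators mean the power series. Let $H$ be a real smooth function on phase space of temperate growth (the Weyl symbol of the quantum Hamiltonian,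 or the classical Hamiltonian function), $h=\mathcal KH$ its Husimi symbol, and let the Hamilton generator be $\mathcal H=h\,\operatorname{sinc}(\tfrac\hbar2\Lambda)$ in quantum mechanics and $\mathcal H=h$ in classical mechanics; $\partial\mathcal H/\partial z_a$ is the same operator with $\partial h/\partial z_a$ in place of $h$. Let $t_i<t_f$ and let $Q(z,t)$, $t\in[t_i,t_f]$, be a real state function: $C^1$ in $(z,t)$, smooth in $z$ with all $z$-derivatives continuous in $(z,t)$, with zero set of measure zero at each time, and such that the series of bidifferential operators applied to $h$ and $Q$ converge normally on bounded sets of pairs of points, uniformly in $t$, together with all $z$-derivatives. A *velocity field* $v=(\dot p,\dot x)$ of the fluid of density $Q$ is given on $\{Q\ne0\}$, is continuous there, $C^1$ in $z$, and satisfies $\partial_tQ=-\partial_x\cdot(\dot xQ)-\partial_p\cdot(\dot pQ)$ there. A *Lagrangian labeling* is a function $L(z,t)$ with values in a given nonzero finite-dimensional real normed space $E$, which is $C^1$ on $\{Q\neq 0\}$ and satisfies $\partial_tL=-\dot x\cdot\partial_xL-\dot p\cdot\partial_pL$ there, and for which $QL$ and $QvL$ extend to the zeros of $Q$ (the first as a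 $C^1$ function, the second continuously and $C^1$ in $z$) and the phase space integrals in the action and in its first variation are dominated by integrable functions, uniformly in $t$ and under small translations of the argument of $h$ (for the first spatial derivatives of $QvL$, weighted by $1+|z|$: integrable at each $t$). The action is $$S=\int_{t_i}^{t_f}dt\,\bigl(\langle L\,(p\cdot\dot x)\,Q\rangle-\langle L\,(\mathcal H\circledast Q)\rangle\bigr).$$ An *admissible variation* translates all parcels, $z\to z+\varepsilon\,\delta z(t)$, with $\delta z=(\delta p,\delta x)\in C^1$ and $\delta z(t_i)=\delta z(t_f)=0$: $Q$ and $L$ are carried along and $v$ is carried along and gains $\varepsilon\,\tfrac{d}{dt}\delta z$. The *variation principle* $\delta S=0$ says that for all $E$-valued labelings and all admissible variations the action is differentiable in $\varepsilon$ at $0$ with derivative $0$. **Theorem (joint Hamilton variation principle).** In quantum and in classical mechanics alike: 1. Let $v$ be a velocity field of $Q$, and consider the generalized Hamilton equations $$\dot p\,Q=-\frac{\partial\mathcal H}{\partial x}\circledast Q,\qquad \dot x\,Q=\frac{\partial\mathcal H}{\partial p}\circledast Q\qquad(\text{where } Q\ne0).$$ (a) If they hold, then $\delta S=0$. (b) If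 the parcels have well-defined trajectories (there is a flow of $v$ on all of $[t_i,t_f]$, avoiding the zeros of $Q$, continuous, with open filled region of space-time and a $C^1$ inverse map to initial positions, defined for an open set of initial positions whose image is dense in the phase space at each time) and $\delta S=0$, then they hold. (c) If they hold, then $Q$ satisfies everywhere the Husimi form of the Liouville equation, $$\partial_tQ=-\tfrac i\hbar\,(h\star_HQ-Q\star_Hh)\ \text{(quantum)},\qquad \partial_tQ=h\,\Lambda\circledast Q\ \text{(classical)}.$$ 2. Conversely, if $Q$ satisfies the Husimi form of the Liouville equation, then there is a velocity field of $Q$ that satisfies the generalized Hamilton equations, and $\delta S=0$ for it. 3. Let $Q=\mathcal KP$, where $P(z,t)$ is $C^1$ in $(z,t)$, smooth and rapidly decreasing in $z$ with all $z$-derivatives (uniformly in $t$), with $\partial_tP$ of polynomial growth uniformly in $t$, and, in quantum mechanics, with Moyal series of all $z$-derivatives of $H$ and $P$ that converge normally up to a polynomial factor, uniformly in $t$. Then the Husimi form of the Liouville equation for $Q$ is equivalent to $$\partial_tP=-\tfrac i\hbar\,(H\star P-P\star H)\ \text{(quantum Moyal–Liouville)},\qquad \partial_tP=H\,\Lambda\,P\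 \text{(classical Liouville)}.$$ 4. In classical mechanics, let $Q=\mathcal K\mu$, where $\mu_t$ are probability measures (point particles $\mu_t=\delta_{z(t)}$ included), weakly continuous in $t$, with moments of all orders bounded in $t$. Then the Husimi form of the Liouville equation for $Q$ is equivalent to the classical Liouville equation in the sense of distributions: $\frac{d}{dt}\int\varphi\,d\mu_t=-\int (H\Lambda\varphi)\,d\mu_t$ for all $\varphi\in C_c^\infty$. -/

import Mathlib

open MeasureTheory Set Function

noncomputable section

/-- The classical phase space with `N` momenta and `N` positions. The coordinate `Sum.inl i` is the
momentum `p_i`, the coordinate `Sum.inr i` is the position `x_i`. -/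
abbrev Phase (N : ℕ) : Type := EuclideanSpace ℝ (Fin N ⊕ Fin N)

/-- The two mechanics that are treated jointly. -/
inductive Mechanics where
  | quantum : Mechanics
  | classical : Mechanics

/-- Partial derivative along a phase space coordinate. -/
def pd {N : ℕ} {E : Type*} [NormedAddCommGroup E] [NormedSpace ℝ E]
    (a : Fin N ⊕ Fin N) (f : Phase N → E) (z : Phase N) : E :=
  fderiv ℝ f z (EuclideanSpace.single a (1 : ℝ))

/-- Mixed partial derivative along a list of phase space coordinates. -/
def pds {N : ℕ} (α : List (Fin N ⊕ Fin N)) (f : Phase N → ℝ) : Phase N → ℝ :=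
  α.foldr (fun a u => pd a u) f

/-! ### Husimi transform -/

/-- The Gaussian kernel with the widths `w`. -/
def husimiKernel {N : ℕ} (w : Fin N ⊕ Fin N → ℝ) (d : Phase N) : ℝ :=
  ∏ i : Fin N, 1 / (2 * Real.pi * w (Sum.inl i) * w (Sum.inr i)) *
    Real.exp (- (d (Sum.inl i)) ^ 2 / (2 * w (Sum.inl i) ^ 2)
      - (d (Sum.inr i)) ^ 2 / (2 * w (Sum.inr i) ^ 2))

/-- The Husimi transform: Gaussian convolution. -/
def husimi {N : ℕ} (w : Fin N ⊕ Fin N → ℝ) (f : Phase N → ℝ) (z : Phase N) : ℝ :=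
  ∫ y, f y * husimiKernel w (z - y)

/-! ### Bidifferential operators

A bidifferential operator sends `f, g` to a function of two phase space points `y` (seen by the
left factor) and `z` (seen by the right factor); the product of symbols is its restriction to
`y = z`. -/

/-- Bidifferential operators before the restriction to the diagonal. -/
abbrev Bidiff (N : ℕ) : Type :=
  (Phase N → ℝ) → (Phase N → ℝ) → Phase N → Phase N → ℝ

/-- The identity bidifferential operator, `f(y) g(z)`. -/
def bidiffOne {N : ℕ} : Bidiff N := fun f g y z => f y * g z

/-- Composition with `Λ = ∂ₓ(left)·∂ₚ(right) - ∂ₚ(left)·∂ₓ(right)`. -/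
def lamStep {N : ℕ} (B : Bidiff N) : Bidiff N := fun f g y z =>
  ∑ i : Fin N, (B (pd (Sum.inr i) f) (pd (Sum.inl i) g) y z
    - B (pd (Sum.inl i) f) (pd (Sum.inr i) g) y z)

/-- Composition with `G = ∑ₐ wₐ² ∂ₐ(left) ∂ₐ(right)`, the sum running over all coordinates. -/
def gaussStep {N : ℕ} (w : Fin N ⊕ Fin N → ℝ) (B : Bidiff N) : Bidiff N := fun f g y z =>
  ∑ a : Fin N ⊕ Fin N, w a ^ 2 * B (pd a f) (pd a g) y z

/-- `Λⁿ Gᵏ`. -/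
def lamGauss {N : ℕ} (w : Fin N ⊕ Fin N → ℝ) (n k : ℕ) : Bidiff N :=
  lamStep^[n] ((gaussStep w)^[k] bidiffOne)

/-- `Λⁿ exp(G)`. -/
def lamExpGauss {N : ℕ} (w : Fin N ⊕ Fin N → ℝ) (n : ℕ) : Bidiff N := fun f g y z =>
  ∑' k : ℕ, 1 / (k.factorial : ℝ) * lamGauss w n k f g y z

/-- The Poisson bracket `f Λ g`. -/
def poisson {N : ℕ} (f g : Phase N → ℝ) (z : Phase N) : ℝ := lamStep bidiffOne f g z z

/-- The Moyal product `f exp(iħΛ/2) g`. -/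
def moyal {N : ℕ} (ħ : ℝ) (f g : Phase N → ℝ) (z : Phase N) : ℂ :=
  ∑' n : ℕ, (Complex.I * (ħ : ℂ) / 2) ^ n / (n.factorial : ℂ) *
    ((lamStep^[n] bidiffOne f g z z : ℝ) : ℂ)

/-- The product of Husimi symbols, `f exp(iħΛ/2) exp(G) g`. -/
def husimiStar {N : ℕ} (ħ : ℝ) (w : Fin N ⊕ Fin N → ℝ) (f g : Phase N → ℝ) (z : Phase N) : ℂ :=
  ∑' n : ℕ, (Complex.I * (ħ : ℂ) / 2) ^ n / (n.factorial : ℂ) *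
    ((lamExpGauss w n f g z z : ℝ) : ℂ)

/-- The Hamilton generator applied through the Husimi scalar product: for quantum mechanics
`f sinc(ħΛ/2) exp(G) g`, for classical mechanics `f exp(G) g`. With `f` the Husimi symbol of the
Hamiltonian this is the Hamilton generator itself; with `f` a partial derivative of that symbol
it is the corresponding partial derivative of the generator. -/
def genApply {N : ℕ} (m : Mechanics) (ħ : ℝ) (w : Fin N ⊕ Fin N → ℝ) : Bidiff N :=
  match m with
  | .quantum => fun f g y z =>
      ∑' j : ℕ, (-1) ^ j * (ħ / 2) ^ (2 * j) / ((2 * j + 1).factorial : ℝ) *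
        lamExpGauss w (2 * j) f g y z
  | .classical => lamExpGauss w 0

/-- Size of the coefficient of `Λⁿ` in the operators used: `exp(iħΛ/2)` for quantum mechanics
(it dominates the coefficients of `sinc`), `1` for classical mechanics. -/
def lamCoeff (m : Mechanics) (ħ : ℝ) (n : ℕ) : ℝ :=
  match m with
  | .quantum => (ħ / 2) ^ n / (n.factorial : ℝ)
  | .classical => if n = 0 then 1 else 0

/-- The series of bidifferential operators applied to `f` and to the family `g t`, `t ∈ I`, converge
normally on bounded sets, together with all partial derivatives. -/
def NormallyConvergent {N : ℕ} (m : Mechanics) (ħ : ℝ) (w : Fin N ⊕ Fin N → ℝ) (I : Set ℝ)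
    (f : Phase N → ℝ) (g : ℝ → Phase N → ℝ) : Prop :=
  ∀ (α β : List (Fin N ⊕ Fin N)) (R : ℝ), ∃ b : ℕ × ℕ → ℝ, Summable b ∧
    ∀ t ∈ I, ∀ y z : Phase N, ‖y‖ ≤ R → ‖z‖ ≤ R → ∀ n k : ℕ,
      lamCoeff m ħ n / (k.factorial : ℝ) * |lamGauss w n k (pds α f) (pds β (g t)) y z| ≤ b (n, k)

/-! ### The fluid -/

/-- A regular family of state functions `Q t`, `t ∈ I`, relative to the Husimi symbol `h` of
the Hamiltonian. -/
structure IsRegularState {N : ℕ} (m : Mechanics) (ħ : ℝ) (w : Fin N ⊕ Fin N → ℝ) (I : Set ℝ)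
    (h : Phase N → ℝ) (Q : ℝ → Phase N → ℝ) : Prop where
  contDiffOn : ContDiffOn ℝ 1 (uncurry Q) (I ×ˢ univ)
  smooth : ∀ t ∈ I, ContDiff ℝ (⊤ : ℕ∞) (Q t)
  continuousOn_pds : ∀ β : List (Fin N ⊕ Fin N),
    ContinuousOn (fun q : ℝ × Phase N => pds β (Q q.1) q.2) (I ×ˢ univ)
  null_zeros : ∀ t ∈ I, volume {z : Phase N | Q t z = 0} = 0
  convergent : NormallyConvergent m ħ w I h Q

/-- The part of space-time filled by the fluid of density `Q`. -/
def fluidRegion {N : ℕ} (I : Set ℝ) (Q : ℝ → Phase N → ℝ) : Set (ℝ × Phase N) :=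
  {q | q.1 ∈ I ∧ Q q.1 q.2 ≠ 0}

/-- `v` is a velocity field of the fluid of density `Q`: `v t z (Sum.inl i)` is the velocity of `p_i`,
`v t z (Sum.inr i)` the velocity of `x_i`. It satisfies the continuity equation. The values of `v`
at the zeros of `Q` are irrelevant. -/
structure IsFluidVelocity {N : ℕ} (I : Set ℝ) (Q : ℝ → Phase N → ℝ)
    (v : ℝ → Phase N → Phase N) : Prop where
  continuousOn : ContinuousOn (uncurry v) (fluidRegion I Q)
  contDiffOn : ∀ t ∈ I, ContDiffOn ℝ 1 (v t) {z | Q t z ≠ 0}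
  continuity : ∀ t ∈ I, ∀ z, Q t z ≠ 0 →
    HasDerivWithinAt (fun τ => Q τ z) (- ∑ a, pd a (fun y => v t y a * Q t y) z) I t

/-- `L` is a Lagrangian labeling of the parcels of the fluid with density `Q` and velocity `v`, with
values in `E`: it is carried by the fluid, and it is such that the action and its variation
make sense (`Q L` and `Q v L` are regular also at the zeros of `Q`, and all integrals
over the phase space are dominated). -/
structure IsLabel {N : ℕ} {E : Type*} [NormedAddCommGroup E] [NormedSpace ℝ E]
    (m : Mechanics) (ħ : ℝ) (w : Fin N ⊕ Fin N → ℝ) (I : Set ℝ)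
    (h : Phase N → ℝ) (Q : ℝ → Phase N → ℝ) (v : ℝ → Phase N → Phase N)
    (L : ℝ → Phase N → E) : Prop where
  contDiffOn : ContDiffOn ℝ 1 (uncurry L) (fluidRegion I Q)
  transport : ∀ t ∈ I, ∀ z, Q t z ≠ 0 →
    HasDerivWithinAt (fun τ => L τ z) (- ∑ a, v t z a • pd a (L t) z) I t
  admissible : ∃ (M : ℝ → Phase N → E) (F : Fin N ⊕ Fin N → ℝ → Phase N → E)
      (g : Phase N → ℝ) (r : ℝ), 0 < r ∧ Integrable g ∧
    ContDiffOn ℝ 1 (uncurry M) (I ×ˢ univ) ∧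
    (∀ a, ContinuousOn (uncurry (F a)) (I ×ˢ univ)) ∧
    (∀ t ∈ I, ∀ a, ContDiff ℝ 1 (F a t) ∧
      Integrable (fun z => (1 + ‖z‖) * ‖pd a (F a t) z‖)) ∧
    (∀ t ∈ I, ∀ z, (1 + ‖z‖) * ‖M t z‖ ≤ g z ∧
      (1 + ‖z‖) * ‖derivWithin (fun τ => M τ z) I t‖ ≤ g z ∧
      ∀ a, (1 + ‖z‖) * ‖F a t z‖ ≤ g z) ∧
    (∀ t ∈ I, ∀ z, Q t z ≠ 0 → M t z = Q t z • L t z ∧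
      (∀ a, F a t z = (v t z a * Q t z) • L t z) ∧
      ∀ s : Phase N, ‖s‖ ≤ r →
        ‖L t z‖ * |genApply m ħ w h (Q t) (z + s) z| ≤ g z ∧
        ∀ a, ‖L t z‖ * |genApply m ħ w (pd a h) (Q t) (z + s) z| ≤ g z)

/-- The action of the fluid with density `Q`, velocity `v` and labeling `L`. -/
def action {N : ℕ} {E : Type*} [NormedAddCommGroup E] [NormedSpace ℝ E]
    (m : Mechanics) (ħ : ℝ) (w : Fin N ⊕ Fin N → ℝ) (ti tf : ℝ)
    (h : Phase N → ℝ) (Q : ℝ → Phase N → ℝ) (v : ℝ → Phase N → Phase N)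
    (L : ℝ → Phase N → E) : E :=
  ∫ t in ti..tf,
    ((∫ z, ((∑ i : Fin N, z (Sum.inl i) * v t z (Sum.inr i)) * Q t z) • L t z)
      - ∫ z, genApply m ħ w h (Q t) z z • L t z)

/-- The action after all fluid parcels have been translated by `ε δ(t)`: the density and the labels
are carried along, and the velocities gain `ε δ'(t)`. -/
def variedAction {N : ℕ} {E : Type*} [NormedAddCommGroup E] [NormedSpace ℝ E]
    (m : Mechanics) (ħ : ℝ) (w : Fin N ⊕ Fin N → ℝ) (ti tf : ℝ)
    (h : Phase N → ℝ) (Q : ℝ → Phase N → ℝ) (v : ℝ → Phase N → Phase N)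
    (L : ℝ → Phase N → E) (δ : ℝ → Phase N) (ε : ℝ) : E :=
  action m ħ w ti tf h
    (fun t z => Q t (z - ε • δ t))
    (fun t z => v t (z - ε • δ t) + ε • deriv δ t)
    (fun t z => L t (z - ε • δ t))

/-- The Hamilton variation principle: for every labeling, the first variation of the action vanishes
for all admissible variations that vanish at the initial and final times. -/
def VariationPrinciple {N : ℕ} (E : Type*) [NormedAddCommGroup E] [NormedSpace ℝ E]
    (m : Mechanics) (ħ : ℝ) (w : Fin N ⊕ Fin N → ℝ) (ti tf : ℝ)
    (h : Phase N → ℝ) (Q : ℝ → Phase N → ℝ) (v : ℝ → Phase N → Phase N) : Prop :=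
  ∀ L : ℝ → Phase N → E, IsLabel m ħ w (Icc ti tf) h Q v L →
    ∀ δ : ℝ → Phase N, ContDiff ℝ 1 δ → δ ti = 0 → δ tf = 0 →
      HasDerivAt (variedAction m ħ w ti tf h Q v L δ) 0 0

/-- The generalized Hamilton equations. -/
def HamiltonEquations {N : ℕ} (m : Mechanics) (ħ : ℝ) (w : Fin N ⊕ Fin N → ℝ) (I : Set ℝ)
    (h : Phase N → ℝ) (Q : ℝ → Phase N → ℝ) (v : ℝ → Phase N → Phase N) : Prop :=
  ∀ t ∈ I, ∀ z, Q t z ≠ 0 → ∀ i : Fin N,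
    v t z (Sum.inl i) * Q t z = - genApply m ħ w (pd (Sum.inr i) h) (Q t) z z ∧
    v t z (Sum.inr i) * Q t z = genApply m ħ w (pd (Sum.inl i) h) (Q t) z z

/-- The motion of the parcels of a fluid with density `Q` and velocity `v` over the time interval
`[ti, tf]`: `Φ t a` is the position at the time `t` of the parcel that starts at `a`, and `A t z`
is the initial position of the parcel found at `z` at the time `t`. The parcels that start in the
open set `D` have trajectories over the whole time interval, and fill a dense part of the phase
space at all times. -/
structure IsParcelFlow {N : ℕ} (ti tf : ℝ) (Q : ℝ → Phase N → ℝ) (v : ℝ → Phase N → Phase N)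
    (D : Set (Phase N)) (Φ A : ℝ → Phase N → Phase N) : Prop where
  isOpen_start : IsOpen D
  initial : ∀ a ∈ D, Φ ti a = a
  continuousOn : ContinuousOn (uncurry Φ) (Icc ti tf ×ˢ D)
  trajectory : ∀ a ∈ D, ∀ t ∈ Icc ti tf,
    HasDerivWithinAt (fun τ => Φ τ a) (v t (Φ t a)) (Icc ti tf) t
  density_ne_zero : ∀ a ∈ D, ∀ t ∈ Icc ti tf, Q t (Φ t a) ≠ 0
  left_inv : ∀ a ∈ D, ∀ t ∈ Icc ti tf, A t (Φ t a) = a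
  isOpen_filled : ∃ O : Set (ℝ × Phase N), IsOpen O ∧
    {q : ℝ × Phase N | q.1 ∈ Icc ti tf ∧ q.2 ∈ Φ q.1 '' D} = O ∩ (Icc ti tf ×ˢ univ)
  contDiffOn : ContDiffOn ℝ 1 (uncurry A) {q | q.1 ∈ Icc ti tf ∧ q.2 ∈ Φ q.1 '' D}
  dense_filled : ∀ t ∈ Icc ti tf, Dense (Φ t '' D)

/-! ### Liouville equations -/

/-- The Liouville equation in the Husimi representation. -/
def HusimiLiouville {N : ℕ} (m : Mechanics) (ħ : ℝ) (w : Fin N ⊕ Fin N → ℝ) (I : Set ℝ)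
    (h : Phase N → ℝ) (Q : ℝ → Phase N → ℝ) : Prop :=
  match m with
  | .quantum => ∀ t ∈ I, ∀ z, HasDerivWithinAt (fun τ => ((Q τ z : ℝ) : ℂ))
      (-(Complex.I / (ħ : ℂ)) * (husimiStar ħ w h (Q t) z - husimiStar ħ w (Q t) h z)) I t
  | .classical => ∀ t ∈ I, ∀ z, HasDerivWithinAt (fun τ => Q τ z) (lamExpGauss w 1 h (Q t) z z) I t

/-- The Liouville equation: the Moyal form for Wigner functions in quantum mechanics, the classical
one for phase space densities in classical mechanics. -/
def LiouvilleEq {N : ℕ} (m : Mechanics) (ħ : ℝ) (I : Set ℝ)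
    (H : Phase N → ℝ) (P : ℝ → Phase N → ℝ) : Prop :=
  match m with
  | .quantum => ∀ t ∈ I, ∀ z, HasDerivWithinAt (fun τ => ((P τ z : ℝ) : ℂ))
      (-(Complex.I / (ħ : ℂ)) * (moyal ħ H (P t) z - moyal ħ (P t) H z)) I t
  | .classical => ∀ t ∈ I, ∀ z, HasDerivWithinAt (fun τ => P τ z) (poisson H (P t) z) I t

/-- A regular family of Wigner functions or densities: rapidly decreasing with all derivatives,
continuously differentiable in time, and, in quantum mechanics, with Moyal series
for `H` and `P t` that converge normally up to polynomial growth. -/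
structure IsRegularDistribution {N : ℕ} (m : Mechanics) (ħ : ℝ) (I : Set ℝ)
    (H : Phase N → ℝ) (P : ℝ → Phase N → ℝ) : Prop where
  contDiffOn : ContDiffOn ℝ 1 (uncurry P) (I ×ˢ univ)
  smooth : ∀ t ∈ I, ContDiff ℝ (⊤ : ℕ∞) (P t)
  decay : ∀ (β : List (Fin N ⊕ Fin N)) (d : ℕ), ∃ C : ℝ, ∀ t ∈ I, ∀ z,
    (1 + ‖z‖) ^ d * |pds β (P t) z| ≤ C
  growth_deriv : ∃ (C : ℝ) (d : ℕ), ∀ t ∈ I, ∀ z,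
    |derivWithin (fun τ => P τ z) I t| ≤ C * (1 + ‖z‖) ^ d
  convergent : ∀ α β : List (Fin N ⊕ Fin N), ∃ (b : ℕ → ℝ) (d : ℕ), Summable b ∧
    ∀ t ∈ I, ∀ z, ∀ n : ℕ,
      lamCoeff m ħ n * |lamStep^[n] bidiffOne (pds α H) (pds β (P t)) z z| ≤ b n * (1 + ‖z‖) ^ d

/-- A family of classical states given by arbitrary probability distributions (point particles
included), weakly continuous in time and with bounded moments of all orders. -/
structure IsRegularMeasureState {N : ℕ} (I : Set ℝ) (μ : ℝ → Measure (Phase N)) : Prop where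
  isProbabilityMeasure : ∀ t ∈ I, IsProbabilityMeasure (μ t)
  moments : ∀ d : ℕ, ∃ C : ℝ, ∀ t ∈ I,
    Integrable (fun z => ‖z‖ ^ d) (μ t) ∧ ∫ z, ‖z‖ ^ d ∂(μ t) ≤ C
  continuousOn : ∀ φ : Phase N → ℝ, Continuous φ → HasCompactSupport φ →
    ContinuousOn (fun t => ∫ z, φ z ∂(μ t)) I

/-- The classical Liouville equation in the sense of distributions. -/
def WeakLiouville {N : ℕ} (I : Set ℝ) (H : Phase N → ℝ) (μ : ℝ → Measure (Phase N)) : Prop :=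
  ∀ φ : Phase N → ℝ, ContDiff ℝ (⊤ : ℕ∞) φ → HasCompactSupport φ → ∀ t ∈ I,
    HasDerivWithinAt (fun τ => ∫ z, φ z ∂(μ τ)) (- ∫ z, poisson H φ z ∂(μ t)) I t

end

/-! Hamilton equations and Liouville equation. All operators are constant-coefficient bidifferential
series evaluated at two independent points `y` and `z`. Normal convergence allows termwise
differentiation, so a derivative along the diagonal is the sum of one derivative on each factor
(`NormallyConvergent.hasFDerivAt_genApply`). In the divergence of the flux prescribed by the
Hamilton equations the mixed second derivatives of `h` cancel and the bracket `h Λ (generator) Q`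
remains. Since `Λ` is antisymmetric and `G` symmetric under exchange of the factors, the commutator
of the star product keeps only the odd powers of `Λ`, which is `Λ sinc(ħΛ/2)`: the same bracket
(`husimiLiouville_iff`). The continuity equation thus becomes the Liouville equation where `Q ≠ 0`,
and then everywhere by density. Conversely, flux divided by `Q` is the required velocity.

Variation principle. Translation invariance of Lebesgue measure moves the displacement onto the
momentum, the velocity and the argument of `h`. The first variation is then an integral linear in
`δ` and `δ'`. The continuity equation for `Q L`, integrated by parts against `p`, shows that the
moment of `p` has the total flux of `p` as its time derivative. The terms with `δx` therefore
combine into a total time derivative, which vanishes because `δ` does at both ends, and what is left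
is `δ` paired with the residuals of the Hamilton equations integrated against `L`
(`IsLabelBound.integral_variedIntegrandDeriv`). This gives one implication at once. For the
converse, the fundamental lemma in time makes each residual orthogonal to every label at every time.
A bump around one initial position, carried by the parcels, is a label
(`IsParcelFlow.isLabel_carried`) and detects a nonzero residual at that parcel. The parcels are
dense.

Inverse Husimi transform. Derivatives of the Husimi symbol of `f` at `z` are the Hermite
coefficients of `f(z - ·)` in the Gaussian `L²` space. Parseval's identity therefore says that the
product `exp(G)` of two Husimi symbols is the Husimi symbol of the pointwise product
(`hasSum_lamGauss_zero_husimi`), and induction on powers of `Λ` transfers the whole bracket.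
Injectivity (`ae_eq_zero_of_integral_mul_husimiKernel`) removes the transform: a translated Gaussian
is the centred one times an exponential, so a vanishing Husimi transform means vanishing exponential
moments, which determine finite measures by analytic continuation to the characteristic function.
Injectivity also supplies the totality needed for Parseval.

Measures. A point mass has no `L²` density, so the product formula is reached by Abel summation
(`lamExpGauss_zero_husimi_smear`). With `σ < 1` in front of `G`, part of the Gaussian width serves
to presmooth both factors, the formula for functions applies, and `σ → 1` is taken at the end. The
Husimi form then says that the weak Liouville equation holds for translates of the kernel. Weak
solutions are stable under superposition of test functions. Translates of the kernel superpose to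
cosines, which superpose to all test functions by Fourier inversion; conversely, cut-off pieces of
the kernel superpose to the kernel. -/

noncomputable section

/-! ### Partial derivatives -/

section PartialDerivatives

variable {N : ℕ} {E : Type*} [NormedAddCommGroup E] [NormedSpace ℝ E]

/-- The coordinates of the phase space. -/
abbrev Coord (N : ℕ) : Type := Fin N ⊕ Fin N

/-- The coordinate functionals of the phase space. -/
abbrev coordCLM (a : Coord N) : Phase N →L[ℝ] ℝ := EuclideanSpace.proj a

lemma phase_eq_sum_single (v : Phase N) :
    v = ∑ a, v a • (EuclideanSpace.single a (1 : ℝ) : Phase N) := by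
  have := (EuclideanSpace.basisFun (Coord N) ℝ).sum_repr v
  simpa using this.symm

lemma clm_apply_eq_sum (T : Phase N →L[ℝ] E) (v : Phase N) :
    T v = ∑ a, v a • T (EuclideanSpace.single a (1 : ℝ)) := by
  conv_lhs => rw [phase_eq_sum_single v]
  simp

lemma fderiv_eq_sum_pd (f : Phase N → E) (z v : Phase N) :
    fderiv ℝ f z v = ∑ a, v a • pd a f z :=
  clm_apply_eq_sum _ _

lemma norm_coord_le (z : Phase N) (a : Coord N) : ‖z a‖ ≤ ‖z‖ := by
  exact PiLp.norm_apply_le z a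

lemma HasFDerivAt.pd_eq {f : Phase N → E} {f' : Phase N →L[ℝ] E} {z : Phase N}
    (h : HasFDerivAt f f' z) (a : Coord N) : pd a f z = f' (EuclideanSpace.single a 1) := by
  rw [pd, h.fderiv]

lemma ContDiff.pd {f : Phase N → E} (hf : ContDiff ℝ (⊤ : ℕ∞) f) (a : Coord N) :
    ContDiff ℝ (⊤ : ℕ∞) (pd a f) :=
  (hf.fderiv_right (m := (⊤ : ℕ∞)) (by norm_cast)).clm_apply contDiff_const

lemma continuous_pd {f : Phase N → E} (hf : ContDiff ℝ 1 f) (a : Coord N) :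
    Continuous (pd a f) :=
  (hf.continuous_fderiv one_ne_zero).clm_apply continuous_const

lemma ContDiff.pds {f : Phase N → ℝ} (hf : ContDiff ℝ (⊤ : ℕ∞) f) (α : List (Coord N)) :
    ContDiff ℝ (⊤ : ℕ∞) (pds α f) := by
  induction α with
  | nil => exact hf
  | cons a α ih => exact ih.pd a

lemma pds_cons (a : Coord N) (α : List (Coord N)) (f : Phase N → ℝ) :
    pds (a :: α) f = pd a (pds α f) := rfl

lemma pds_append (α β : List (Coord N)) (f : Phase N → ℝ) :
    pds (α ++ β) f = pds α (pds β f) := by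
  simp [pds, List.foldr_append]

lemma pds_pd (a : Coord N) (α : List (Coord N)) (f : Phase N → ℝ) :
    pds α (pd a f) = pds (α ++ [a]) f := by
  rw [pds_append]; rfl

lemma pd_comm {f : Phase N → ℝ} (hf : ContDiff ℝ (⊤ : ℕ∞) f) (a b : Coord N) :
    pd a (pd b f) = pd b (pd a f) := by
  have hd : Differentiable ℝ (fderiv ℝ f) :=
    (hf.fderiv_right (m := (⊤ : ℕ∞)) (by norm_cast)).differentiable (by simp)
  have key (a b : Coord N) (z) : pd a (pd b f) z
      = fderiv ℝ (fderiv ℝ f) z (EuclideanSpace.single a 1) (EuclideanSpace.single b 1) := by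
    have := ((hd z).hasFDerivAt.clm_apply (hasFDerivAt_const (EuclideanSpace.single b (1:ℝ)) z))
    change fderiv ℝ (fun y => fderiv ℝ f y (EuclideanSpace.single b (1:ℝ))) z _ = _
    rw [this.fderiv]; simp
  funext z
  rw [key, key]
  exact second_derivative_symmetric (fun y => (hf.differentiable (by simp) y).hasFDerivAt)
    (hd z).hasFDerivAt _ _

lemma pd_comp_sub (a : Coord N) (f : Phase N → E) (s : Phase N) :
    pd a (fun z => f (z - s)) = fun z => pd a f (z - s) := by
  funext z
  simp only [pd]
  rw [fderiv_comp_sub]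

lemma pd_mul {f g : Phase N → ℝ} (a : Coord N) {z : Phase N} (hf : DifferentiableAt ℝ f z)
    (hg : DifferentiableAt ℝ g z) :
    pd a (fun y => f y * g y) z = f z * pd a g z + pd a f z * g z := by
  rw [(hf.hasFDerivAt.fun_mul hg.hasFDerivAt).pd_eq]
  simp [pd, mul_comm]

lemma pd_congr_of_eventuallyEq {f g : Phase N → E} {z : Phase N} (a : Coord N)
    (h : f =ᶠ[nhds z] g) : pd a f z = pd a g z := by
  simp only [pd, h.fderiv_eq]

/-- A function whose derivative has continuous coordinates is continuously differentiable. -/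
lemma contDiff_one_of_hasFDerivAt {f : Phase N → E} {f' : Phase N → Phase N →L[ℝ] E}
    (h : ∀ z, HasFDerivAt f (f' z) z)
    (hc : ∀ a, Continuous fun z => f' z (EuclideanSpace.single a 1)) : ContDiff ℝ 1 f := by
  rw [contDiff_one_iff_hasFDerivAt]
  refine ⟨f', ?_, h⟩
  have : f' = fun z => ∑ a, (coordCLM a).smulRight (f' z (EuclideanSpace.single a 1)) := by
    funext z; ext v; rw [clm_apply_eq_sum]; simp
  rw [this]
  refine continuous_finsetSum _ fun a _ => ?_
  exact (ContinuousLinearMap.smulRightL ℝ (Phase N) E (coordCLM a)).continuous.comp (hc a)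

end PartialDerivatives

/-! ### Bidifferential operators with constant coefficients -/

section BidifferentialOperators

variable {N : ℕ}

/-- The bidifferential operators of finite order with constant coefficients. -/
inductive IsBidiff : Bidiff N → Prop
  | one : IsBidiff bidiffOne
  | zero : IsBidiff fun _ _ _ _ => 0
  | add {B C : Bidiff N} : IsBidiff B → IsBidiff C →
      IsBidiff fun f g y z => B f g y z + C f g y z
  | smul {B : Bidiff N} (c : ℝ) : IsBidiff B → IsBidiff fun f g y z => c * B f g y z
  | comp {B : Bidiff N} (a b : Coord N) : IsBidiff B →
      IsBidiff fun f g y z => B (pd a f) (pd b g) y z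

namespace IsBidiff

lemma sum {J : Type*} (s : Finset J) {B : J → Bidiff N} (h : ∀ j, IsBidiff (B j)) :
    IsBidiff fun f g y z => ∑ j ∈ s, B j f g y z := by
  classical
  induction s using Finset.induction_on with
  | empty => simpa using IsBidiff.zero
  | insert j s hj ih => simpa [Finset.sum_insert hj] using (h j).add ih

lemma lamStep {B : Bidiff N} (h : IsBidiff B) : IsBidiff (lamStep B) := by
  refine IsBidiff.sum Finset.univ fun i => ?_
  simpa [sub_eq_add_neg] using (h.comp (Sum.inr i) (Sum.inl i)).add
    ((h.comp (Sum.inl i) (Sum.inr i)).smul (-1))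

lemma gaussStep {B : Bidiff N} (w : Coord N → ℝ) (h : IsBidiff B) :
    IsBidiff (gaussStep w B) :=
  IsBidiff.sum Finset.univ fun a => (h.comp a a).smul (w a ^ 2)

lemma lamGauss (w : Coord N → ℝ) (n k : ℕ) : IsBidiff (lamGauss w n k) := by
  have hk : IsBidiff ((_root_.gaussStep w)^[k] (bidiffOne (N := N))) := by
    induction k with
    | zero => exact IsBidiff.one
    | succ k ih => rw [iterate_succ_apply']; exact ih.gaussStep w
  induction n with
  | zero => exact hk
  | succ n ih =>
    unfold _root_.lamGauss at ih ⊢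
    rw [iterate_succ_apply']; exact ih.lamStep

variable {B : Bidiff N}

lemma contDiff (h : IsBidiff B) {f g : Phase N → ℝ} (hf : ContDiff ℝ (⊤ : ℕ∞) f)
    (hg : ContDiff ℝ (⊤ : ℕ∞) g) :
    ContDiff ℝ (⊤ : ℕ∞) fun q : Phase N × Phase N => B f g q.1 q.2 := by
  induction h generalizing f g with
  | one => exact (hf.comp contDiff_fst).mul (hg.comp contDiff_snd)
  | zero => exact contDiff_const
  | add _ _ ih₁ ih₂ => exact (ih₁ hf hg).add (ih₂ hf hg)
  | smul c _ ih => exact contDiff_const.mul (ih hf hg)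
  | comp a b _ ih => exact ih (hf.pd a) (hg.pd b)

/-- Constant coefficients make `B` commute with differentiation in either point; in the case of
`comp` this is the symmetry of second derivatives. -/
lemma fderiv_apply (h : IsBidiff B) {f g : Phase N → ℝ} (hf : ContDiff ℝ (⊤ : ℕ∞) f)
    (hg : ContDiff ℝ (⊤ : ℕ∞) g) (q d : Phase N × Phase N) :
    fderiv ℝ (fun q : Phase N × Phase N => B f g q.1 q.2) q d
      = ∑ a, (d.1 a * B (pd a f) g q.1 q.2 + d.2 a * B f (pd a g) q.1 q.2) := by
  induction h generalizing f g with
  | one =>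
    have h1 : HasFDerivAt (fun q : Phase N × Phase N => f q.1)
        ((fderiv ℝ f q.1).comp (ContinuousLinearMap.fst ℝ _ _)) q :=
      (hf.differentiable (by simp) q.1).hasFDerivAt.comp q hasFDerivAt_fst
    have h2 : HasFDerivAt (fun q : Phase N × Phase N => g q.2)
        ((fderiv ℝ g q.2).comp (ContinuousLinearMap.snd ℝ _ _)) q :=
      (hg.differentiable (by simp) q.2).hasFDerivAt.comp q hasFDerivAt_snd
    simp only [bidiffOne]
    rw [(h1.fun_mul h2).fderiv]
    simp only [add_apply, smul_apply,
      ContinuousLinearMap.comp_apply, ContinuousLinearMap.coe_fst', ContinuousLinearMap.coe_snd',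
      fderiv_eq_sum_pd, smul_eq_mul, Finset.mul_sum, Finset.sum_add_distrib]
    rw [add_comm]
    congr 1 <;> exact Finset.sum_congr rfl fun a _ => by ring
  | zero => simp
  | add hB hC ih₁ ih₂ =>
    have h1 := ((hB.contDiff hf hg).differentiable (by simp) q).hasFDerivAt
    have h2 := ((hC.contDiff hf hg).differentiable (by simp) q).hasFDerivAt
    rw [(h1.fun_add h2).fderiv, add_apply, ih₁ hf hg, ih₂ hf hg,
      ← Finset.sum_add_distrib]
    exact Finset.sum_congr rfl fun a _ => by ring
  | smul c hB ih =>
    have h1 := ((hB.contDiff hf hg).differentiable (by simp) q).hasFDerivAt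
    rw [(h1.const_mul c).fderiv, smul_apply, ih hf hg, smul_eq_mul,
      Finset.mul_sum]
    exact Finset.sum_congr rfl fun a _ => by ring
  | comp a b _ ih =>
    rw [ih (hf.pd a) (hg.pd b)]
    exact Finset.sum_congr rfl fun c _ => by rw [pd_comm hf c a, pd_comm hg c b]

/-- Constant coefficients give translation invariance, so a displacement of the density becomes a
displacement of the right evaluation point. -/
lemma comp_sub_right (h : IsBidiff B) (f g : Phase N → ℝ) (s y z : Phase N) :
    B f (fun x => g (x - s)) y z = B f g y (z - s) := by
  induction h generalizing f g with
  | one => rfl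
  | zero => rfl
  | add _ _ ih₁ ih₂ => simp only [ih₁, ih₂]
  | smul c _ ih => simp only [ih]
  | comp a b _ ih => simp only [pd_comp_sub, ih]

lemma continuousOn_family (h : IsBidiff B) {I : Set ℝ} {f : Phase N → ℝ} {g : ℝ → Phase N → ℝ}
    (hf : ContDiff ℝ (⊤ : ℕ∞) f) (hg : ∀ β : List (Coord N),
      ContinuousOn (fun q : ℝ × Phase N => pds β (g q.1) q.2) (I ×ˢ univ)) :
    ContinuousOn (fun q : ℝ × Phase N × Phase N => B f (g q.1) q.2.1 q.2.2) (I ×ˢ univ) := by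
  induction h generalizing f g with
  | one =>
    refine (hf.continuous.comp (by fun_prop)).continuousOn.mul ?_
    exact (hg []).comp (f := fun q : ℝ × Phase N × Phase N => (q.1, q.2.2))
      (by fun_prop) fun q hq => ⟨hq.1, mem_univ _⟩
  | zero => exact continuousOn_const
  | add _ _ ih₁ ih₂ => exact (ih₁ hf hg).add (ih₂ hf hg)
  | smul c _ ih => exact continuousOn_const.mul (ih hf hg)
  | comp a b _ ih =>
    refine ih (hf.pd a) (g := fun t => pd b (g t)) fun β => ?_
    simp only [pds_pd]
    exact hg _

end IsBidiff

lemma lamGauss_succ (w : Coord N → ℝ) (n k : ℕ) (f g : Phase N → ℝ) (y z : Phase N) :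
    lamGauss w (n + 1) k f g y z =
      ∑ i : Fin N, (lamGauss w n k (pd (Sum.inr i) f) (pd (Sum.inl i) g) y z
        - lamGauss w n k (pd (Sum.inl i) f) (pd (Sum.inr i) g) y z) := by
  unfold lamGauss
  rw [iterate_succ_apply']; rfl

lemma lamGauss_zero_succ (w : Coord N → ℝ) (k : ℕ) (f g : Phase N → ℝ) (y z : Phase N) :
    lamGauss w 0 (k + 1) f g y z =
      ∑ a, w a ^ 2 * lamGauss w 0 k (pd a f) (pd a g) y z := by
  unfold lamGauss
  simp only [iterate_zero, id_eq, iterate_succ_apply']; rfl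

/-- Each `Λ` changes sign when the factors are exchanged and each `G` does not. This parity is what
turns a commutator into an odd series. -/
lemma lamGauss_swap (w : Coord N → ℝ) (n k : ℕ) (f g : Phase N → ℝ) (y z : Phase N) :
    lamGauss w n k g f z y = (-1) ^ n * lamGauss w n k f g y z := by
  induction n generalizing f g with
  | zero =>
    induction k generalizing f g with
    | zero => simp [lamGauss, bidiffOne, mul_comm]
    | succ k ih => simp only [lamGauss_zero_succ, ih]; simp
  | succ n ih =>
    simp only [lamGauss_succ, ih, Finset.mul_sum]
    exact Finset.sum_congr rfl fun i _ => by ring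

end BidifferentialOperators

/-! ### The Hamilton generator as a double series -/

section Generator

variable {N : ℕ}

/-- The Taylor coefficients of `sinc` for quantum mechanics, of `1` for classical mechanics. -/
def sincCoeff (m : Mechanics) (ħ : ℝ) (j : ℕ) : ℝ :=
  match m with
  | .quantum => (-1) ^ j * (ħ / 2) ^ (2 * j) / ((2 * j + 1).factorial : ℝ)
  | .classical => if j = 0 then 1 else 0

lemma lamCoeff_nonneg (m : Mechanics) {ħ : ℝ} (hħ : 0 < ħ) (n : ℕ) : 0 ≤ lamCoeff m ħ n := by
  cases m
  · simp only [lamCoeff]; positivity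
  · simp only [lamCoeff]; split_ifs <;> norm_num

/-- In the quantum case `(2j)! ≤ (2j+1)!`, so the majorants assumed for the exponential also serve
the series of `sinc`. -/
lemma abs_sincCoeff_le (m : Mechanics) {ħ : ℝ} (hħ : 0 < ħ) (j : ℕ) :
    |sincCoeff m ħ j| ≤ lamCoeff m ħ (2 * j) := by
  cases m
  · simp only [sincCoeff, lamCoeff, abs_div, abs_mul, abs_pow, abs_neg, abs_one, one_pow, one_mul,
      Nat.abs_cast]
    rw [abs_of_pos hħ, abs_two]
    gcongr
    omega
  · simp only [sincCoeff, lamCoeff]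
    by_cases h : j = 0 <;> simp [h]

/-- The terms of the double series of the Hamilton generator. -/
def genTerm (m : Mechanics) (ħ : ℝ) (w : Coord N → ℝ) (q : ℕ × ℕ) : Bidiff N := fun f g y z =>
  sincCoeff m ħ q.1 / (q.2.factorial : ℝ) * lamGauss w (2 * q.1) q.2 f g y z

lemma isBidiff_genTerm (m : Mechanics) (ħ : ℝ) (w : Coord N → ℝ) (q : ℕ × ℕ) :
    IsBidiff (genTerm m ħ w q) :=
  (IsBidiff.lamGauss w _ _).smul _

lemma genApply_eq_tsum_lamExpGauss (m : Mechanics) (ħ : ℝ) (w : Coord N → ℝ)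
    (f g : Phase N → ℝ) (y z : Phase N) :
    genApply m ħ w f g y z = ∑' j, sincCoeff m ħ j * lamExpGauss w (2 * j) f g y z := by
  cases m
  · rfl
  · rw [tsum_eq_single 0]
    · simp [sincCoeff, genApply]
    · intro j hj; simp [sincCoeff, hj]

lemma genApply_eq_tsum {m : Mechanics} {ħ : ℝ} {w : Coord N → ℝ}
    {f g : Phase N → ℝ} {y z : Phase N} (h : Summable fun q => genTerm m ħ w q f g y z) :
    genApply m ħ w f g y z = ∑' q, genTerm m ħ w q f g y z := by
  rw [h.tsum_prod, genApply_eq_tsum_lamExpGauss]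
  refine tsum_congr fun j => ?_
  rw [lamExpGauss, ← tsum_mul_left]
  refine tsum_congr fun k => ?_
  simp only [genTerm]; ring

lemma genApply_comp_sub_right (m : Mechanics) (ħ : ℝ) (w : Coord N → ℝ)
    (f g : Phase N → ℝ) (s y z : Phase N) :
    genApply m ħ w f (fun x => g (x - s)) y z = genApply m ħ w f g y (z - s) := by
  simp only [genApply_eq_tsum_lamExpGauss, lamExpGauss,
    (IsBidiff.lamGauss w _ _).comp_sub_right]

namespace NormallyConvergent

variable {m : Mechanics} {ħ : ℝ} {w : Coord N → ℝ} {I : Set ℝ} {f : Phase N → ℝ}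
  {g : ℝ → Phase N → ℝ}

lemma pd_left (h : NormallyConvergent m ħ w I f g) (a : Coord N) :
    NormallyConvergent m ħ w I (pd a f) g := by
  intro α β R
  simp only [pds_pd]
  exact h _ _ R

lemma pd_right (h : NormallyConvergent m ħ w I f g) (a : Coord N) :
    NormallyConvergent m ħ w I f fun t => pd a (g t) := by
  intro α β R
  simp only [pds_pd]
  exact h _ _ R

lemma exists_bound_genTerm (h : NormallyConvergent m ħ w I f g) (hħ : 0 < ħ) (R : ℝ) :
    ∃ b : ℕ × ℕ → ℝ, Summable b ∧ ∀ t ∈ I, ∀ y z : Phase N, ‖y‖ ≤ R → ‖z‖ ≤ R → ∀ q,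
      |genTerm m ħ w q f (g t) y z| ≤ b q := by
  obtain ⟨b, hb, hle⟩ := h [] [] R
  -- Only even powers of `Λ` occur: the given majorant is restricted along the injection `(j, k) ↦
  -- (2j, k)`.
  refine ⟨fun q => b (2 * q.1, q.2), hb.comp_injective (i := fun q : ℕ × ℕ => (2 * q.1, q.2)) ?_,
    fun t ht y z hy hz q => ?_⟩
  · intro p q hpq
    simp only [Prod.mk.injEq] at hpq
    exact Prod.ext (by omega) hpq.2
  · refine le_trans ?_ (hle t ht y z hy hz _ _)
    simp only [genTerm, abs_mul, abs_div, Nat.abs_cast]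
    exact mul_le_mul_of_nonneg_right
      (div_le_div_of_nonneg_right (abs_sincCoeff_le m hħ _) (Nat.cast_nonneg _)) (abs_nonneg _)

lemma summable_genTerm (h : NormallyConvergent m ħ w I f g) (hħ : 0 < ħ) {t : ℝ} (ht : t ∈ I)
    (y z : Phase N) : Summable fun q => genTerm m ħ w q f (g t) y z := by
  obtain ⟨b, hb, hle⟩ := h.exists_bound_genTerm hħ (max ‖y‖ ‖z‖)
  exact Summable.of_norm_bounded hb fun q => hle t ht y z (le_max_left _ _) (le_max_right _ _) q

lemma genApply_eq (h : NormallyConvergent m ħ w I f g) (hħ : 0 < ħ) {t : ℝ} (ht : t ∈ I)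
    (y z : Phase N) : genApply m ħ w f (g t) y z = ∑' q, genTerm m ħ w q f (g t) y z :=
  genApply_eq_tsum (h.summable_genTerm hħ ht y z)

lemma exists_bound_genApply (h : NormallyConvergent m ħ w I f g) (hħ : 0 < ħ) (R : ℝ) :
    ∃ C : ℝ, 0 ≤ C ∧ ∀ t ∈ I, ∀ y z : Phase N, ‖y‖ ≤ R → ‖z‖ ≤ R →
      |genApply m ħ w f (g t) y z| ≤ C := by
  obtain ⟨b, hb, hle⟩ := h.exists_bound_genTerm hħ R
  refine ⟨|∑' q, b q|, abs_nonneg _, fun t ht y z hy hz => ?_⟩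
  rw [h.genApply_eq hħ ht, ← Real.norm_eq_abs]
  exact (tsum_of_norm_bounded hb.hasSum fun q => hle t ht y z hy hz q).trans (le_abs_self _)

/-- The majorant says something about the `n`-th series only if its weight is nonzero: for every `n`
in quantum mechanics, for `n = 0` alone in classical mechanics. -/
lemma summable_lamExpGauss (h : NormallyConvergent m ħ w I f g) (hħ : 0 < ħ) {t : ℝ} (ht : t ∈ I)
    (y z : Phase N) {n : ℕ} (hn : lamCoeff m ħ n ≠ 0) :
    Summable fun k : ℕ => 1 / (k.factorial : ℝ) * lamGauss w n k f (g t) y z := by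
  obtain ⟨b, hb, hle⟩ := h [] [] (max ‖y‖ ‖z‖)
  have hs : Summable fun k : ℕ => b (n, k) / lamCoeff m ħ n :=
    (hb.comp_injective (i := fun k : ℕ => (n, k)) fun _ _ h => by simpa using h).div_const _
  refine Summable.of_norm_bounded hs fun k => ?_
  have hpos : 0 < lamCoeff m ħ n := lt_of_le_of_ne (lamCoeff_nonneg m hħ n) hn.symm
  rw [le_div_iff₀ hpos, Real.norm_eq_abs, abs_mul, abs_div, Nat.abs_cast, abs_one]
  refine le_trans (le_of_eq ?_) (hle t ht y z (le_max_left _ _) (le_max_right _ _) n k)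
  simp only [pds, List.foldr_nil]
  ring

/-- The finite sum in `Λ` is exchanged with the series in `k`. Convergence is used for the `n`-th
series of first derivatives only, so that in classical mechanics `n = 0` already reaches `Λ exp(G)`.
-/
lemma lamExpGauss_succ (h : NormallyConvergent m ħ w I f g) (hħ : 0 < ħ) {t : ℝ} (ht : t ∈ I)
    (y z : Phase N) {n : ℕ} (hn : lamCoeff m ħ n ≠ 0) :
    lamExpGauss w (n + 1) f (g t) y z = lamStep (lamExpGauss w n) f (g t) y z := by
  have hs (a b : Coord N) := ((h.pd_left a).pd_right b).summable_lamExpGauss hħ ht y z hn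
  simp only [lamExpGauss, lamStep, lamGauss_succ, Finset.mul_sum, mul_sub]
  rw [Summable.tsum_finsetSum fun i _ => (hs _ _).sub (hs _ _)]
  exact Finset.sum_congr rfl fun i _ => (hs _ _).tsum_sub (hs _ _)

lemma summable_lamCoeff_mul_lamExpGauss (h : NormallyConvergent m ħ w I f g) (hħ : 0 < ħ) {t : ℝ}
    (ht : t ∈ I) (y z : Phase N) :
    Summable fun n : ℕ => lamCoeff m ħ n * |lamExpGauss w n f (g t) y z| := by
  obtain ⟨b, hb, hle⟩ := h [] [] (max ‖y‖ ‖z‖)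
  refine Summable.of_nonneg_of_le (fun n => mul_nonneg (lamCoeff_nonneg m hħ n) (abs_nonneg _))
    (fun n => ?_) hb.prod
  -- With weight zero the inner series need not converge, but its contribution is zero anyway.
  by_cases hn : lamCoeff m ħ n = 0
  · rw [hn, zero_mul]
    refine tsum_nonneg fun k => le_trans ?_ (hle t ht y z (le_max_left _ _) (le_max_right _ _) n k)
    exact mul_nonneg (div_nonneg (lamCoeff_nonneg m hħ n) (Nat.cast_nonneg _)) (abs_nonneg _)
  · rw [lamExpGauss, ← abs_of_nonneg (lamCoeff_nonneg m hħ n), ← abs_mul, ← tsum_mul_left,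
      ← Real.norm_eq_abs]
    refine tsum_of_norm_bounded
      (hb.comp_injective (i := fun k : ℕ => (n, k)) fun _ _ h => by simpa using h).hasSum
      fun k => ?_
    rw [Real.norm_eq_abs, abs_mul, abs_mul, abs_div, Nat.abs_cast, abs_one,
      abs_of_nonneg (lamCoeff_nonneg m hħ n)]
    refine le_trans (le_of_eq ?_) (hle t ht y z (le_max_left _ _) (le_max_right _ _) n k)
    simp only [pds, List.foldr_nil]
    ring

lemma continuousOn_genApply (h : NormallyConvergent m ħ w I f g) (hħ : 0 < ħ)
    (hf : ContDiff ℝ (⊤ : ℕ∞) f) (hg : ∀ β : List (Coord N),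
      ContinuousOn (fun q : ℝ × Phase N => pds β (g q.1) q.2) (I ×ˢ univ)) :
    ContinuousOn (fun q : ℝ × Phase N × Phase N => genApply m ħ w f (g q.1) q.2.1 q.2.2)
      (I ×ˢ univ) := by
  rintro ⟨t, y, z⟩ ⟨ht, -⟩
  -- The additional 1 makes the ball of radius `R` a neighbourhood of both points, and uniform
  -- convergence there is enough.
  set R := max ‖y‖ ‖z‖ + 1
  obtain ⟨b, hb, hle⟩ := h.exists_bound_genTerm hħ R
  set U : Set (ℝ × Phase N × Phase N) := univ ×ˢ (Metric.ball 0 R ×ˢ Metric.ball 0 R)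
  have hU : U ∈ nhds (t, y, z) := by
    refine prod_mem_nhds Filter.univ_mem (prod_mem_nhds ?_ ?_) <;>
      refine Metric.isOpen_ball.mem_nhds ?_ <;> rw [mem_ball_zero_iff]
    · exact lt_of_le_of_lt (le_max_left _ _) (lt_add_one _)
    · exact lt_of_le_of_lt (le_max_right _ _) (lt_add_one _)
  have hc : ContinuousOn (fun q : ℝ × Phase N × Phase N =>
      ∑' p, genTerm m ħ w p f (g q.1) q.2.1 q.2.2) ((I ×ˢ univ) ∩ U) := by
    refine continuousOn_tsum
      (fun p => ((isBidiff_genTerm m ħ w p).continuousOn_family hf hg).mono inter_subset_left) hb ?_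
    rintro p ⟨s, y', z'⟩ ⟨⟨hs, -⟩, -, hy', hz'⟩
    exact hle s hs _ _ (mem_ball_zero_iff.1 hy').le (mem_ball_zero_iff.1 hz').le p
  have hmem : ((t, y, z) : ℝ × Phase N × Phase N) ∈ (I ×ˢ (univ : Set (Phase N × Phase N))) ∩ U :=
    ⟨⟨ht, mem_univ _⟩, mem_of_mem_nhds hU⟩
  have hnhds : (I ×ˢ (univ : Set (Phase N × Phase N))) ∩ U ∈
      nhdsWithin (t, y, z) (I ×ˢ (univ : Set (Phase N × Phase N))) :=
    Filter.inter_mem self_mem_nhdsWithin (mem_nhdsWithin_of_mem_nhds hU)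
  have h2 := (hc _ hmem).mono_of_mem_nhdsWithin hnhds
  exact h2.congr (fun q hq => h.genApply_eq hħ hq.1 _ _) (h.genApply_eq hħ ht _ _)

/-- The derivative of the Hamilton generator in both arguments. -/
lemma hasFDerivAt_genApply (h : NormallyConvergent m ħ w I f g) (hħ : 0 < ħ)
    (hf : ContDiff ℝ (⊤ : ℕ∞) f) {t : ℝ} (ht : t ∈ I) (hg : ContDiff ℝ (⊤ : ℕ∞) (g t))
    (q : Phase N × Phase N) :
    HasFDerivAt (fun q : Phase N × Phase N => genApply m ħ w f (g t) q.1 q.2)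
      (∑ a, (genApply m ħ w (pd a f) (g t) q.1 q.2 •
          (coordCLM a).comp (ContinuousLinearMap.fst ℝ (Phase N) (Phase N))
        + genApply m ħ w f (pd a (g t)) q.1 q.2 •
          (coordCLM a).comp (ContinuousLinearMap.snd ℝ (Phase N) (Phase N)))) q := by
  obtain ⟨b₀, hb₀, hle₀⟩ := h.exists_bound_genTerm hħ (‖q‖ + 1)
  choose b₁ hb₁ hle₁ using fun a => (h.pd_left a).exists_bound_genTerm hħ (‖q‖ + 1)
  choose b₂ hb₂ hle₂ using fun a => (h.pd_right a).exists_bound_genTerm hħ (‖q‖ + 1)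
  -- The derivative of a term is a sum of terms with one more derivative on `f` or on `g`; the
  -- majorants of those series dominate it.
  set u : ℕ × ℕ → ℝ := fun p => ∑ a, (b₁ a p + b₂ a p)
  have hu : Summable u := summable_sum fun a _ => (hb₁ a).add (hb₂ a)
  set s : Set (Phase N × Phase N) := Metric.ball 0 (‖q‖ + 1)
  have hq : q ∈ s := by simp [s]
  have hs1 {x : Phase N × Phase N} (hx : x ∈ s) : ‖x.1‖ ≤ ‖q‖ + 1 :=
    (norm_fst_le x).trans (mem_ball_zero_iff.1 hx).le
  have hs2 {x : Phase N × Phase N} (hx : x ∈ s) : ‖x.2‖ ≤ ‖q‖ + 1 :=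
    (norm_snd_le x).trans (mem_ball_zero_iff.1 hx).le
  have hbound : ∀ p, ∀ x ∈ s, ‖fderiv ℝ (fun q : Phase N × Phase N =>
      genTerm m ħ w p f (g t) q.1 q.2) x‖ ≤ u p := by
    intro p x hx
    have h0 : 0 ≤ u p := Finset.sum_nonneg fun a _ => add_nonneg
      ((abs_nonneg _).trans (hle₁ a t ht _ _ (hs1 hx) (hs2 hx) p))
      ((abs_nonneg _).trans (hle₂ a t ht _ _ (hs1 hx) (hs2 hx) p))
    refine ContinuousLinearMap.opNorm_le_bound _ h0 fun d => ?_
    rw [(isBidiff_genTerm m ħ w p).fderiv_apply hf hg, Finset.sum_mul]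
    refine (norm_sum_le _ _).trans (Finset.sum_le_sum fun a _ => ?_)
    refine (norm_add_le _ _).trans ?_
    rw [add_mul, norm_mul, norm_mul]
    refine add_le_add ?_ ?_
    · rw [mul_comm]
      exact mul_le_mul (hle₁ a t ht _ _ (hs1 hx) (hs2 hx) p)
        ((norm_coord_le _ _).trans (norm_fst_le d)) (norm_nonneg _)
        ((abs_nonneg _).trans (hle₁ a t ht _ _ (hs1 hx) (hs2 hx) p))
    · rw [mul_comm]
      exact mul_le_mul (hle₂ a t ht _ _ (hs1 hx) (hs2 hx) p)
        ((norm_coord_le _ _).trans (norm_snd_le d)) (norm_nonneg _)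
        ((abs_nonneg _).trans (hle₂ a t ht _ _ (hs1 hx) (hs2 hx) p))
  have hmain := hasFDerivAt_tsum_of_isPreconnected (x₀ := q) (x := q) hu Metric.isOpen_ball
    (convex_ball (0 : Phase N × Phase N) (‖q‖ + 1)).isPreconnected
    (fun p x _ => (((isBidiff_genTerm m ħ w p).contDiff hf hg).differentiable
      (by simp) x).hasFDerivAt) hbound hq (h.summable_genTerm hħ ht _ _) hq
  have heq : (fun q : Phase N × Phase N => genApply m ħ w f (g t) q.1 q.2)
      = fun q => ∑' p, genTerm m ħ w p f (g t) q.1 q.2 :=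
    funext fun q => h.genApply_eq hħ ht _ _
  rw [heq]
  refine hmain.congr_fderiv ?_
  have hsum : Summable fun p => fderiv ℝ (fun q : Phase N × Phase N =>
      genTerm m ħ w p f (g t) q.1 q.2) q :=
    Summable.of_norm_bounded hu fun p => hbound p q hq
  refine ContinuousLinearMap.ext fun d => ?_
  have h1 (a) := (h.pd_left a).summable_genTerm hħ ht q.1 q.2
  have h2 (a) := (h.pd_right a).summable_genTerm hħ ht q.1 q.2
  have : (∑' p, fderiv ℝ (fun q : Phase N × Phase N => genTerm m ħ w p f (g t) q.1 q.2) q) d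
      = ∑' p, fderiv ℝ (fun q : Phase N × Phase N => genTerm m ħ w p f (g t) q.1 q.2) q d :=
    (ContinuousLinearMap.apply ℝ ℝ d).map_tsum hsum
  rw [this]
  simp only [(isBidiff_genTerm m ħ w _).fderiv_apply hf hg]
  rw [Summable.tsum_finsetSum fun a _ => ((h1 a).mul_left _).add ((h2 a).mul_left _)]
  rw [sum_apply]
  refine Finset.sum_congr rfl fun a _ => ?_
  rw [((h1 a).mul_left _).tsum_add ((h2 a).mul_left _), tsum_mul_left, tsum_mul_left,
    (h.pd_left a).genApply_eq hħ ht, (h.pd_right a).genApply_eq hħ ht]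
  simp [mul_comm]

/-- Moving along the diagonal moves both points at once, and the chain rule gives one derivative for
each factor. -/
lemma hasFDerivAt_genApply_diag (h : NormallyConvergent m ħ w I f g) (hħ : 0 < ħ)
    (hf : ContDiff ℝ (⊤ : ℕ∞) f) {t : ℝ} (ht : t ∈ I) (hg : ContDiff ℝ (⊤ : ℕ∞) (g t))
    (z : Phase N) :
    HasFDerivAt (fun z => genApply m ħ w f (g t) z z)
      (∑ a, (genApply m ħ w (pd a f) (g t) z z + genApply m ħ w f (pd a (g t)) z z) •
        coordCLM a) z := by
  have h1 : HasFDerivAt (fun z : Phase N => (z, z))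
      ((ContinuousLinearMap.id ℝ (Phase N)).prod (ContinuousLinearMap.id ℝ (Phase N))) z :=
    (hasFDerivAt_id z).prodMk (hasFDerivAt_id z)
  refine (HasFDerivAt.comp (f := fun z : Phase N => (z, z)) z
    (h.hasFDerivAt_genApply hħ hf ht hg (z, z)) h1).congr_fderiv ?_
  ext d
  simp [sum_apply, add_mul]

lemma pd_genApply_diag (h : NormallyConvergent m ħ w I f g) (hħ : 0 < ħ)
    (hf : ContDiff ℝ (⊤ : ℕ∞) f) {t : ℝ} (ht : t ∈ I) (hg : ContDiff ℝ (⊤ : ℕ∞) (g t))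
    (a : Coord N) (z : Phase N) :
    pd a (fun z => genApply m ħ w f (g t) z z) z
      = genApply m ħ w (pd a f) (g t) z z + genApply m ħ w f (pd a (g t)) z z := by
  rw [(h.hasFDerivAt_genApply_diag hħ hf ht hg z).pd_eq]
  simp [sum_apply, -Fintype.sum_sum_type]

lemma continuous_genApply_diag (h : NormallyConvergent m ħ w I f g) (hħ : 0 < ħ)
    (hf : ContDiff ℝ (⊤ : ℕ∞) f) {t : ℝ} (ht : t ∈ I) (hg : ContDiff ℝ (⊤ : ℕ∞) (g t)) :
    Continuous fun z => genApply m ħ w f (g t) z z :=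
  continuous_iff_continuousAt.2 fun z =>
    (h.hasFDerivAt_genApply_diag hħ hf ht hg z).continuousAt

lemma contDiff_genApply_diag (h : NormallyConvergent m ħ w I f g) (hħ : 0 < ħ)
    (hf : ContDiff ℝ (⊤ : ℕ∞) f) {t : ℝ} (ht : t ∈ I) (hg : ContDiff ℝ (⊤ : ℕ∞) (g t)) :
    ContDiff ℝ 1 fun z => genApply m ħ w f (g t) z z := by
  refine contDiff_one_of_hasFDerivAt (h.hasFDerivAt_genApply_diag hħ hf ht hg) fun a => ?_
  simp only [sum_apply, smul_apply, smul_eq_mul]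
  refine continuous_finsetSum _ fun b _ => Continuous.mul ?_ continuous_const
  exact ((h.pd_left b).continuous_genApply_diag hħ (hf.pd b) ht hg).add
    ((h.pd_right b).continuous_genApply_diag hħ hf ht (hg.pd b))

/-- Seen from the moving parcels, a translation shifts only the point at which `h` is evaluated.
This is how the derivatives of `h` enter the first variation. -/
lemma hasDerivAt_genApply_shift (h : NormallyConvergent m ħ w I f g) (hħ : 0 < ħ)
    (hf : ContDiff ℝ (⊤ : ℕ∞) f) {t : ℝ} (ht : t ∈ I) (hg : ContDiff ℝ (⊤ : ℕ∞) (g t))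
    (z d : Phase N) (ε : ℝ) :
    HasDerivAt (fun ε : ℝ => genApply m ħ w f (g t) (z + ε • d) z)
      (∑ a, d a * genApply m ħ w (pd a f) (g t) (z + ε • d) z) ε := by
  have h1 : HasDerivAt (fun ε : ℝ => (z + ε • d, z)) (d, (0 : Phase N)) ε := by
    refine HasDerivAt.prodMk ?_ (hasDerivAt_const _ _)
    simpa using ((hasDerivAt_id ε).smul_const d).const_add z
  have h2 := (h.hasFDerivAt_genApply hħ hf ht hg (z + ε • d, z)).comp_hasDerivAt ε h1
  refine h2.congr_deriv ?_
  simp [-Fintype.sum_sum_type, sum_apply, mul_comm]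

end NormallyConvergent

/-! ### The bracket of the Liouville equation -/

/-- The commutator of exponential series reduces to the series of `sinc`. -/
lemma commutator_exp_series {ħ : ℝ} (hħ : 0 < ħ) (A : ℕ → ℝ)
    (hA : Summable fun n : ℕ => (ħ / 2) ^ n / (n.factorial : ℝ) * |A n|) :
    -(Complex.I / (ħ : ℂ)) *
      ((∑' n : ℕ, (Complex.I * (ħ : ℂ) / 2) ^ n / (n.factorial : ℂ) * ((A n : ℝ) : ℂ)) -
        ∑' n : ℕ, (Complex.I * (ħ : ℂ) / 2) ^ n / (n.factorial : ℂ) *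
          (((-1) ^ n * A n : ℝ) : ℂ))
      = ((∑' j : ℕ, (-1) ^ j * (ħ / 2) ^ (2 * j) / ((2 * j + 1).factorial : ℝ) * A (2 * j + 1) : ℝ)
          : ℂ) := by
  have hn (n : ℕ) : ‖(Complex.I * (ħ : ℂ) / 2) ^ n / (n.factorial : ℂ)‖
      = (ħ / 2) ^ n / (n.factorial : ℝ) := by
    simp [abs_of_pos hħ]
  have h1 : Summable fun n : ℕ =>
      (Complex.I * (ħ : ℂ) / 2) ^ n / (n.factorial : ℂ) * ((A n : ℝ) : ℂ) := by
    refine Summable.of_norm_bounded hA fun n => ?_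
    rw [norm_mul, hn, Complex.norm_real, Real.norm_eq_abs]
  have h2 : Summable fun n : ℕ =>
      (Complex.I * (ħ : ℂ) / 2) ^ n / (n.factorial : ℂ) * (((-1) ^ n * A n : ℝ) : ℂ) := by
    refine Summable.of_norm_bounded hA fun n => ?_
    rw [norm_mul, hn, Complex.norm_real, Real.norm_eq_abs, abs_mul]
    simp
  rw [← h1.tsum_sub h2, ← tsum_mul_left, Complex.ofReal_tsum]
  -- The sign `(-1)ⁿ` from exchanging the factors cancels the even terms and doubles the odd ones.
  have split {F : ℕ → ℂ} (hF : Summable F) (h0 : ∀ j, F (2 * j) = 0) :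
      ∑' n, F n = ∑' j, F (2 * j + 1) := by
    have he : Injective fun j : ℕ => 2 * j := fun a b h => by simpa using h
    have ho : Injective fun j : ℕ => 2 * j + 1 := fun a b h => by simpa using h
    rw [← tsum_even_add_odd (hF.comp_injective he) (hF.comp_injective ho)]
    simp [h0]
  have hħ' : (ħ : ℂ) ≠ 0 := by exact_mod_cast hħ.ne'
  have h0 (j : ℕ) : -(Complex.I / (ħ : ℂ)) *
      ((Complex.I * (ħ : ℂ) / 2) ^ (2 * j) / ((2 * j).factorial : ℂ) * ((A (2 * j) : ℝ) : ℂ) -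
        (Complex.I * (ħ : ℂ) / 2) ^ (2 * j) / ((2 * j).factorial : ℂ) *
          (((-1) ^ (2 * j) * A (2 * j) : ℝ) : ℂ)) = 0 := by
    rw [pow_mul (-1 : ℝ), neg_one_sq, one_pow, one_mul, sub_self, mul_zero]
  rw [split ((h1.sub h2).mul_left (-(Complex.I / (ħ : ℂ)))) h0]
  refine tsum_congr fun j => ?_
  -- The powers of `i` reduce to `i (-1)ʲ`. The factor `ħ/2` split off here cancels the prefactor
  -- `-i/ħ` together with the doubling, which leaves the coefficients of `sinc`.
  have hp : (Complex.I * (ħ : ℂ) / 2) ^ (2 * j + 1)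
      = Complex.I * (-1) ^ j * ((ħ : ℂ) / 2) ^ (2 * j) * (ħ / 2) := by
    rw [mul_div_assoc, mul_pow, pow_succ Complex.I, pow_mul, Complex.I_sq, pow_succ]; ring
  have hm : ((-1 : ℝ) ^ (2 * j + 1) * A (2 * j + 1)) = -A (2 * j + 1) := by
    rw [pow_succ, pow_mul, neg_one_sq, one_pow]; ring
  have hI : Complex.I / (ħ : ℂ) * (Complex.I * (ħ / 2)) = -(1 / 2) := by
    rw [div_mul_eq_mul_div, ← mul_assoc, Complex.I_mul_I]; field_simp
  rw [hp, hm]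
  push_cast
  linear_combination (-2 * (-1 : ℂ) ^ j * ((ħ : ℂ) / 2) ^ (2 * j)
    / ((2 * j + 1).factorial : ℂ) * (A (2 * j + 1) : ℂ)) * hI

/-- One more `Λ` raises every even power in the generator by one; these are exactly the odd terms
that survive in the commutator. -/
lemma NormallyConvergent.lamStep_genApply {m : Mechanics} {ħ : ℝ} {w : Coord N → ℝ} {I : Set ℝ}
    {f : Phase N → ℝ} {g : ℝ → Phase N → ℝ} (h : NormallyConvergent m ħ w I f g) (hħ : 0 < ħ)
    {t : ℝ} (ht : t ∈ I) (y z : Phase N) :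
    lamStep (genApply m ħ w) f (g t) y z
      = ∑' j, sincCoeff m ħ j * lamExpGauss w (2 * j + 1) f (g t) y z := by
  have hs (a b : Coord N) : Summable fun j =>
      sincCoeff m ħ j * lamExpGauss w (2 * j) (pd a f) (pd b (g t)) y z := by
    have h1 := (((h.pd_left a).pd_right b).summable_lamCoeff_mul_lamExpGauss hħ ht y
      z).comp_injective (i := fun j : ℕ => 2 * j) fun a b h => by simpa using h
    refine Summable.of_norm_bounded h1 fun j => ?_
    rw [Real.norm_eq_abs, abs_mul]
    exact mul_le_mul_of_nonneg_right (abs_sincCoeff_le m hħ j) (abs_nonneg _)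
  simp only [lamStep, genApply_eq_tsum_lamExpGauss]
  rw [Finset.sum_congr rfl fun i _ => ((hs _ _).tsum_sub (hs _ _)).symm,
    ← Summable.tsum_finsetSum fun i _ => (hs _ _).sub (hs _ _)]
  refine tsum_congr fun j => ?_
  -- A zero coefficient asks for no convergence; a nonzero one forces a nonzero weight at `2j`, so
  -- that one `Λ` may be pulled out of the series.
  by_cases hj : sincCoeff m ħ j = 0
  · simp [hj]
  · rw [h.lamExpGauss_succ hħ ht]
    · simp only [lamStep, Finset.mul_sum, mul_sub]
    · intro h0
      exact hj (abs_nonpos_iff.1 ((abs_sincCoeff_le m hħ j).trans h0.le))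

/-- The real form of a complex time derivative. -/
lemma hasDerivWithinAt_ofReal_iff {F : ℝ → ℝ} {F' t : ℝ} {I : Set ℝ} :
    HasDerivWithinAt (fun τ => ((F τ : ℝ) : ℂ)) (F' : ℂ) I t ↔ HasDerivWithinAt F F' I t := by
  refine ⟨fun h => ?_, fun h => h.ofReal_comp⟩
  have := Complex.reCLM.hasFDerivAt.comp_hasDerivWithinAt t h
  simpa [Function.comp_def] using this

/-- Both mechanics share one real evolution equation, with right-hand side `Λ` composed with the
generator. The quantum case is `commutator_exp_series` combined with the parity of `Λⁿ exp(G)`. -/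
lemma husimiLiouville_iff {m : Mechanics} {ħ : ℝ} {w : Coord N → ℝ} {I : Set ℝ}
    {h : Phase N → ℝ} {Q : ℝ → Phase N → ℝ} (hc : NormallyConvergent m ħ w I h Q) (hħ : 0 < ħ) :
    HusimiLiouville m ħ w I h Q ↔ ∀ t ∈ I, ∀ z, HasDerivWithinAt (fun τ => Q τ z)
      (lamStep (genApply m ħ w) h (Q t) z z) I t := by
  cases m
  · refine forall₂_congr fun t ht => forall_congr' fun z => ?_
    rw [← hasDerivWithinAt_ofReal_iff, hc.lamStep_genApply hħ ht]
    have hsw (n : ℕ) : lamExpGauss w n (Q t) h z z = (-1) ^ n * lamExpGauss w n h (Q t) z z := by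
      simp only [lamExpGauss, ← tsum_mul_left]
      exact tsum_congr fun k => by rw [lamGauss_swap w n k h (Q t)]; ring
    have := commutator_exp_series hħ (fun n => lamExpGauss w n h (Q t) z z)
      (hc.summable_lamCoeff_mul_lamExpGauss hħ ht z z)
    simp only [husimiStar, hsw]
    rw [this]
    rfl
  · refine forall₂_congr fun t ht => forall_congr' fun z => ?_
    rw [hc.lamExpGauss_succ hħ ht z z (by simp [lamCoeff])]
    rfl

end Generator

/-! ### The fluid of the generalized Hamilton equations -/

section Fluid

variable {N : ℕ} {E : Type*} [NormedAddCommGroup E] [NormedSpace ℝ E]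

lemma uniqueDiffOn_Icc_prod_univ {ti tf : ℝ} (htt : ti < tf) :
    UniqueDiffOn ℝ (Icc ti tf ×ˢ (univ : Set (Phase N))) :=
  (uniqueDiffOn_Icc htt).prod uniqueDiffOn_univ

lemma hasDerivWithinAt_time {I : Set ℝ} {f : ℝ → Phase N → E}
    {t : ℝ} {z : Phase N} {f' : ℝ × Phase N →L[ℝ] E}
    (hf : HasFDerivWithinAt (uncurry f) f' (I ×ˢ univ) (t, z)) :
    HasDerivWithinAt (fun τ => f τ z) (f' (1, 0)) I t := by
  have h1 : HasDerivWithinAt (fun τ : ℝ => (τ, z)) ((1 : ℝ), (0 : Phase N)) I t :=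
    (hasDerivWithinAt_id t I).prodMk (hasDerivWithinAt_const _ _ _)
  have hm : MapsTo (fun τ : ℝ => (τ, z)) I (I ×ˢ univ) := fun τ hτ => ⟨hτ, mem_univ _⟩
  exact hf.comp_hasDerivWithinAt t h1 hm

lemma derivWithin_time_hasDerivWithinAt {ti tf : ℝ} {f : ℝ → Phase N → E}
    (hf : ContDiffOn ℝ 1 (uncurry f) (Icc ti tf ×ˢ univ)) {t : ℝ} (ht : t ∈ Icc ti tf)
    (z : Phase N) :
    HasDerivWithinAt (fun τ => f τ z) (derivWithin (fun τ => f τ z) (Icc ti tf) t)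
      (Icc ti tf) t :=
  (hasDerivWithinAt_time ((hf.differentiableOn one_ne_zero (t, z)
    ⟨ht, mem_univ _⟩).hasFDerivWithinAt)).differentiableWithinAt.hasDerivWithinAt

lemma continuousOn_derivWithin_time {ti tf : ℝ} (htt : ti < tf) {f : ℝ → Phase N → E}
    (hf : ContDiffOn ℝ 1 (uncurry f) (Icc ti tf ×ˢ univ)) :
    ContinuousOn (fun q : ℝ × Phase N => derivWithin (fun τ => f τ q.2) (Icc ti tf) q.1)
      (Icc ti tf ×ˢ univ) := by
  have hc := (hf.continuousOn_fderivWithin (uniqueDiffOn_Icc_prod_univ htt) le_rfl).clm_apply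
    (continuousOn_const (c := ((1 : ℝ), (0 : Phase N))))
  refine hc.congr fun q hq => ?_
  exact (hasDerivWithinAt_time ((hf.differentiableOn one_ne_zero q
    hq).hasFDerivWithinAt)).derivWithin (uniqueDiffOn_Icc htt q.1 hq.1)

lemma ContinuousOn.slice {X : Type*} [TopologicalSpace X] {I : Set ℝ} {f : ℝ × Phase N → X}
    (hf : ContinuousOn f (I ×ˢ univ)) {t : ℝ} (ht : t ∈ I) : Continuous fun z => f (t, z) := by
  rw [← continuousOn_univ]
  exact hf.comp (by fun_prop) fun z _ => ⟨ht, mem_univ _⟩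

lemma ContinuousOn.slice_time {X : Type*} [TopologicalSpace X] {I : Set ℝ}
    {f : ℝ × Phase N → X} (hf : ContinuousOn f (I ×ˢ univ)) (z : Phase N) :
    ContinuousOn (fun t => f (t, z)) I :=
  hf.comp (by fun_prop) fun _ ht => ⟨ht, mem_univ _⟩

/-- A null set has empty interior. Identities between continuous functions thereby pass from the
fluid to the zeros of the density. -/
lemma dense_ne_zero {Q : Phase N → ℝ} (hQ : volume {z : Phase N | Q z = 0} = 0) :
    Dense {z : Phase N | Q z ≠ 0} := by
  have : {z : Phase N | Q z ≠ 0} = {z : Phase N | Q z = 0}ᶜ := rfl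
  rw [this, ← interior_eq_empty_iff_dense_compl]
  by_contra hne
  have h1 := isOpen_interior.measure_pos volume (Set.nonempty_iff_ne_empty.2 hne)
  exact absurd (measure_mono_null interior_subset hQ) h1.ne'

/-- The flux `v Q` prescribed by the generalized Hamilton equations. -/
def hamiltonFlux (m : Mechanics) (ħ : ℝ) (w : Coord N → ℝ) (h g : Phase N → ℝ) :
    Coord N → Phase N → ℝ
  | Sum.inl i, z => - genApply m ħ w (pd (Sum.inr i) h) g z z
  | Sum.inr i, z => genApply m ħ w (pd (Sum.inl i) h) g z z

lemma hamiltonEquations_iff {m : Mechanics} {ħ : ℝ} {w : Coord N → ℝ} {I : Set ℝ}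
    {h : Phase N → ℝ} {Q : ℝ → Phase N → ℝ} {v : ℝ → Phase N → Phase N} :
    HamiltonEquations m ħ w I h Q v ↔ ∀ t ∈ I, ∀ z, Q t z ≠ 0 → ∀ a,
      v t z a * Q t z = hamiltonFlux m ħ w h (Q t) a z := by
  refine forall₄_congr fun t _ z _ => ?_
  rw [Sum.forall]
  exact forall_and

variable {m : Mechanics} {ħ : ℝ} {w : Coord N → ℝ} {I : Set ℝ} {h : Phase N → ℝ}
  {Q : ℝ → Phase N → ℝ}

lemma IsRegularState.contDiff_hamiltonFlux (hQ : IsRegularState m ħ w I h Q) (hħ : 0 < ħ)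
    (hh : ContDiff ℝ (⊤ : ℕ∞) h) {t : ℝ} (ht : t ∈ I) (a : Coord N) :
    ContDiff ℝ 1 (hamiltonFlux m ħ w h (Q t) a) := by
  cases a with
  | inl i =>
    exact ((hQ.convergent.pd_left _).contDiff_genApply_diag hħ (hh.pd _) ht (hQ.smooth t ht)).neg
  | inr i =>
    exact (hQ.convergent.pd_left _).contDiff_genApply_diag hħ (hh.pd _) ht (hQ.smooth t ht)

lemma IsRegularState.continuousOn_hamiltonFlux (hQ : IsRegularState m ħ w I h Q) (hħ : 0 < ħ)
    (hh : ContDiff ℝ (⊤ : ℕ∞) h) (a : Coord N) :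
    ContinuousOn (fun q : ℝ × Phase N => hamiltonFlux m ħ w h (Q q.1) a q.2) (I ×ˢ univ) := by
  have key (b : Coord N) : ContinuousOn (fun q : ℝ × Phase N =>
      genApply m ħ w (pd b h) (Q q.1) q.2 q.2) (I ×ˢ univ) :=
    ((hQ.convergent.pd_left b).continuousOn_genApply hħ (hh.pd b) hQ.continuousOn_pds).comp
      (f := fun q : ℝ × Phase N => (q.1, q.2, q.2)) (by fun_prop) fun q hq => ⟨hq.1, mem_univ _⟩
  cases a with
  | inl i => exact (key _).neg
  | inr i => exact key _

/-- The divergence of the Hamilton flux is the bracket of the Liouville equation. -/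
lemma IsRegularState.neg_sum_pd_hamiltonFlux (hQ : IsRegularState m ħ w I h Q) (hħ : 0 < ħ)
    (hh : ContDiff ℝ (⊤ : ℕ∞) h) {t : ℝ} (ht : t ∈ I) (z : Phase N) :
    - ∑ a, pd a (hamiltonFlux m ħ w h (Q t) a) z = lamStep (genApply m ħ w) h (Q t) z z := by
  have key (a b : Coord N) := (hQ.convergent.pd_left a).pd_genApply_diag hħ (hh.pd a) ht
    (hQ.smooth t ht) b z
  have hneg (a b : Coord N) : pd b (fun z => - genApply m ħ w (pd a h) (Q t) z z) z
      = - pd b (fun z => genApply m ħ w (pd a h) (Q t) z z) z := by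
    simp only [pd]; rw [fderiv_fun_neg]; rfl
  have e1 (i : Fin N) : pd (Sum.inl i) (hamiltonFlux m ħ w h (Q t) (Sum.inl i)) z
      = - pd (Sum.inl i) (fun z => genApply m ħ w (pd (Sum.inr i) h) (Q t) z z) z := hneg _ _
  have e2 (i : Fin N) : pd (Sum.inr i) (hamiltonFlux m ħ w h (Q t) (Sum.inr i)) z
      = pd (Sum.inr i) (fun z => genApply m ħ w (pd (Sum.inl i) h) (Q t) z z) z := rfl
  rw [Fintype.sum_sum_type, ← Finset.sum_add_distrib, ← Finset.sum_neg_distrib, lamStep]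
  refine Finset.sum_congr rfl fun i _ => ?_
  -- Each pair of coordinates contributes the mixed second derivative of `h` twice with opposite
  -- signs; only the terms with one derivative on `Q` remain.
  rw [e1, e2, key, key, pd_comm hh (Sum.inl i) (Sum.inr i)]
  ring

/-- The generalized Hamilton equations imply the Liouville equation. -/
lemma IsRegularState.husimiLiouville_of_hamiltonEquations {ti tf : ℝ} (htt : ti < tf)
    (hQ : IsRegularState m ħ w (Icc ti tf) h Q) (hħ : 0 < ħ) (hh : ContDiff ℝ (⊤ : ℕ∞) h)
    {v : ℝ → Phase N → Phase N} (hv : IsFluidVelocity (Icc ti tf) Q v)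
    (hH : HamiltonEquations m ħ w (Icc ti tf) h Q v) :
    HusimiLiouville m ħ w (Icc ti tf) h Q := by
  rw [husimiLiouville_iff hQ.convergent hħ]
  rw [hamiltonEquations_iff] at hH
  intro t ht z
  have hd := derivWithin_time_hasDerivWithinAt hQ.contDiffOn ht
  -- Both sides are continuous in `z`, so agreement on the dense set `Q ≠ 0` suffices.
  suffices heq : (fun z => derivWithin (fun τ => Q τ z) (Icc ti tf) t)
      = fun z => - ∑ a, pd a (hamiltonFlux m ħ w h (Q t) a) z by
    rw [← hQ.neg_sum_pd_hamiltonFlux hħ hh ht z, ← congrFun heq z]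
    exact hd z
  refine Continuous.ext_on (dense_ne_zero (hQ.null_zeros t ht))
    ((continuousOn_derivWithin_time htt hQ.contDiffOn).slice ht) ?_ fun z hz => ?_
  · exact (continuous_finsetSum _ fun a _ =>
      continuous_pd (hQ.contDiff_hamiltonFlux hħ hh ht a) a).neg
  · rw [(hv.continuity t ht z hz).derivWithin (uniqueDiffOn_Icc htt t ht)]
    congr 1
    refine Finset.sum_congr rfl fun a _ => pd_congr_of_eventuallyEq a ?_
    filter_upwards [((hQ.smooth t ht).continuous.isOpen_preimage _ isOpen_ne).mem_nhds hz]
      with y hy using hH t ht y hy a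

/-- The velocity field that solves the generalized Hamilton equations. -/
def hamiltonVelocity (m : Mechanics) (ħ : ℝ) (w : Coord N → ℝ) (h : Phase N → ℝ)
    (Q : ℝ → Phase N → ℝ) (t : ℝ) (z : Phase N) : Phase N :=
  WithLp.toLp 2 fun a => hamiltonFlux m ħ w h (Q t) a z / Q t z

lemma hamiltonEquations_hamiltonVelocity :
    HamiltonEquations m ħ w I h Q (hamiltonVelocity m ħ w h Q) := by
  rw [hamiltonEquations_iff]
  intro t _ z hz a
  simp [hamiltonVelocity, div_mul_cancel₀ _ hz]

/-- Division by `Q` is regular off its zeros, and there `v Q` is the Hamilton flux, whose divergence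
turns the Liouville equation into the continuity equation. -/
lemma IsRegularState.isFluidVelocity_hamiltonVelocity
    (hQ : IsRegularState m ħ w I h Q) (hħ : 0 < ħ) (hh : ContDiff ℝ (⊤ : ℕ∞) h)
    (hL : HusimiLiouville m ħ w I h Q) :
    IsFluidVelocity I Q (hamiltonVelocity m ħ w h Q) where
  continuousOn := by
    refine (PiLp.continuous_toLp 2 _).comp_continuousOn (continuousOn_pi.2 fun a => ?_)
    refine ((hQ.continuousOn_hamiltonFlux hħ hh a).mono ?_).div
      (hQ.contDiffOn.continuousOn.mono ?_) fun q hq => hq.2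
    all_goals exact fun q hq => ⟨hq.1, mem_univ _⟩
  contDiffOn := by
    intro t ht
    rw [contDiffOn_euclidean]
    intro a
    exact (hQ.contDiff_hamiltonFlux hħ hh ht a).contDiffOn.div
      ((hQ.smooth t ht).of_le (by norm_cast)).contDiffOn fun z hz => hz
  continuity := by
    intro t ht z hz
    convert (husimiLiouville_iff hQ.convergent hħ).1 hL t ht z using 1
    rw [← hQ.neg_sum_pd_hamiltonFlux hħ hh ht z]
    congr 1
    refine Finset.sum_congr rfl fun a _ => pd_congr_of_eventuallyEq a ?_
    filter_upwards [((hQ.smooth t ht).continuous.isOpen_preimage _ isOpen_ne).mem_nhds hz]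
      with y hy
    exact hamiltonEquations_iff.1 hamiltonEquations_hamiltonVelocity t ht y hy a

end Fluid

/-! ### Derivatives of integrals on an interval -/

/-- Differentiation under the integral sign, one-sided at the ends of the parameter interval. -/
lemma hasDerivWithinAt_integral_of_dominated {α G : Type*} [MeasurableSpace α] {μ : Measure α}
    [NormedAddCommGroup G] [NormedSpace ℝ G] {I : Set ℝ} (hI : Convex ℝ I)
    {F F' : ℝ → α → G} {bound : α → ℝ} {t : ℝ} (ht : t ∈ I)
    (hmeas : ∀ τ ∈ I, AEStronglyMeasurable (F τ) μ) (hint : Integrable (F t) μ)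
    (hbound : ∀ᵐ x ∂μ, ∀ τ ∈ I, ‖F' τ x‖ ≤ bound x) (hb : Integrable bound μ)
    (hderiv : ∀ᵐ x ∂μ, ∀ τ ∈ I, HasDerivWithinAt (fun τ => F τ x) (F' τ x) I τ) :
    HasDerivWithinAt (fun τ => ∫ x, F τ x ∂μ) (∫ x, F' t x ∂μ) I t := by
  -- The mean value inequality on the convex parameter set bounds all difference quotients by
  -- `bound`, also at the end points; dominated convergence does the rest.
  have hlip : ∀ᵐ x ∂μ, ∀ τ ∈ I, ‖F τ x - F t x‖ ≤ bound x * ‖τ - t‖ := by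
    filter_upwards [hbound, hderiv] with x hx hx' τ hτ
    exact hI.norm_image_sub_le_of_norm_hasDerivWithin_le (f := fun τ => F τ x)
      (fun s hs => hx' s hs) (fun s hs => hx s hs) ht hτ
  have hint' : ∀ τ ∈ I, Integrable (F τ) μ := by
    intro τ hτ
    have : Integrable (fun x => F τ x - F t x) μ := by
      refine Integrable.mono' (hb.mul_const ‖τ - t‖) ((hmeas τ hτ).sub hint.1) ?_
      filter_upwards [hlip] with x hx using hx τ hτ
    exact (this.add hint).congr (Filter.Eventually.of_forall fun x => by simp)
  rw [hasDerivWithinAt_iff_tendsto_slope]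
  have hev : ∀ᶠ τ in nhdsWithin t (I \ {t}), τ ∈ I ∧ τ ≠ t := by
    filter_upwards [self_mem_nhdsWithin] with τ hτ using ⟨hτ.1, hτ.2⟩
  have hlim : Filter.Tendsto (fun τ => ∫ x, slope (fun τ => F τ x) t τ ∂μ)
      (nhdsWithin t (I \ {t})) (nhds (∫ x, F' t x ∂μ)) := by
    refine tendsto_integral_filter_of_dominated_convergence bound ?_ ?_ hb ?_
    · filter_upwards [hev] with τ hτ
      simp only [slope, vsub_eq_sub]
      exact ((hmeas τ hτ.1).sub hint.1).const_smul _
    · filter_upwards [hev] with τ hτ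
      filter_upwards [hlip] with x hx
      have hpos : 0 < ‖τ - t‖ := norm_pos_iff.2 (sub_ne_zero.2 hτ.2)
      rw [slope, vsub_eq_sub, norm_smul, norm_inv, inv_mul_le_iff₀ hpos, mul_comm]
      exact hx τ hτ.1
    · filter_upwards [hderiv] with x hx
      exact hasDerivWithinAt_iff_tendsto_slope.1 (hx t ht)
  refine hlim.congr' ?_
  filter_upwards [hev] with τ hτ
  simp only [slope, vsub_eq_sub]
  rw [integral_smul, integral_sub (hint' τ hτ.1) hint]

/-! ### Integrals of functions that are regular off the zeros of the density -/

section FluidRegion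

variable {N : ℕ} {E : Type*} [NormedAddCommGroup E] [NormedSpace ℝ E]
  {m : Mechanics} {ħ : ℝ} {w : Coord N → ℝ} {I : Set ℝ} {h : Phase N → ℝ}
  {Q : ℝ → Phase N → ℝ}

lemma IsRegularState.ae_ne_zero (hQ : IsRegularState m ħ w I h Q) {t : ℝ} (ht : t ∈ I) :
    ∀ᵐ z : Phase N, Q t z ≠ 0 := by
  rw [ae_iff]
  simpa using hQ.null_zeros t ht

lemma IsRegularState.fluidRegion_mem_nhdsWithin (hQ : IsRegularState m ħ w I h Q) {t : ℝ}
    {z : Phase N} (hz : (t, z) ∈ fluidRegion I Q) :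
    fluidRegion I Q ∈ nhdsWithin (t, z) (I ×ˢ univ) := by
  have hc := hQ.contDiffOn.continuousOn (t, z) ⟨hz.1, mem_univ _⟩
  filter_upwards [self_mem_nhdsWithin, hc.eventually_ne hz.2] with q hq hq' using ⟨hq.1, hq'⟩

omit [NormedSpace ℝ E] in
lemma continuousOn_slice_fluidRegion {t : ℝ} (ht : t ∈ I) {K : ℝ → Phase N → E}
    (hK : ContinuousOn (uncurry K) (fluidRegion I Q)) :
    ContinuousOn (K t) {z | Q t z ≠ 0} :=
  hK.comp (f := fun z => (t, z)) (by fun_prop) fun z hz => ⟨ht, hz⟩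

lemma IsRegularState.isOpen_ne_zero (hQ : IsRegularState m ħ w I h Q) {t : ℝ} (ht : t ∈ I) :
    IsOpen {z | Q t z ≠ 0} :=
  (hQ.smooth t ht).continuous.isOpen_preimage _ isOpen_ne

omit [NormedSpace ℝ E] in
lemma IsRegularState.aestronglyMeasurable (hQ : IsRegularState m ħ w I h Q) {t : ℝ} (ht : t ∈ I)
    {K : ℝ → Phase N → E}
    (hK : ContinuousOn (uncurry K) (fluidRegion I Q)) :
    AEStronglyMeasurable (K t) volume := by
  have h1 := (continuousOn_slice_fluidRegion ht hK).aestronglyMeasurable (μ := volume)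
    (hQ.isOpen_ne_zero ht).measurableSet
  rwa [Measure.restrict_eq_self_of_ae_mem (s := {z | Q t z ≠ 0}) (hQ.ae_ne_zero ht)] at h1

omit [NormedSpace ℝ E] in
lemma IsRegularState.integrable (hQ : IsRegularState m ħ w I h Q) {t : ℝ} (ht : t ∈ I)
    {K : ℝ → Phase N → E}
    (hK : ContinuousOn (uncurry K) (fluidRegion I Q)) {g : Phase N → ℝ}
    (hg : Integrable g) (hb : ∀ z, Q t z ≠ 0 → ‖K t z‖ ≤ g z) : Integrable (K t) := by
  refine hg.mono' (hQ.aestronglyMeasurable ht hK) ?_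
  filter_upwards [hQ.ae_ne_zero ht] with z hz using hb z hz

/-- The zero set moves with time, but each of its time slices is null: the bound holds almost
everywhere at each time, and almost every point is a point of continuity at the given time.
Dominated convergence applies. -/
lemma IsRegularState.continuousOn_integral (hQ : IsRegularState m ħ w I h Q)
    {K : ℝ → Phase N → E}
    (hK : ContinuousOn (uncurry K) (fluidRegion I Q)) {g : Phase N → ℝ}
    (hg : Integrable g) (hb : ∀ t ∈ I, ∀ z, Q t z ≠ 0 → ‖K t z‖ ≤ g z) :
    ContinuousOn (fun t => ∫ z, K t z) I := by
  intro t ht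
  refine continuousWithinAt_of_dominated (bound := g) ?_ ?_ hg ?_
  · filter_upwards [self_mem_nhdsWithin] with s hs using hQ.aestronglyMeasurable hs hK
  · filter_upwards [self_mem_nhdsWithin] with s hs
    filter_upwards [hQ.ae_ne_zero hs] with z hz using hb s hs z hz
  · filter_upwards [hQ.ae_ne_zero ht] with z hz
    have h1 : ContinuousWithinAt (uncurry K) (I ×ˢ univ) (t, z) :=
      (hK (t, z) ⟨ht, hz⟩).mono_of_mem_nhdsWithin (hQ.fluidRegion_mem_nhdsWithin ⟨ht, hz⟩)
    have hm : MapsTo (fun τ : ℝ => (τ, z)) I (I ×ˢ univ) := fun τ hτ => ⟨hτ, mem_univ _⟩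
    exact h1.comp (f := fun τ : ℝ => (τ, z)) (by fun_prop) hm

end FluidRegion

/-! ### The first variation of the action -/

section FirstVariation

variable {N : ℕ} {E : Type*} [NormedAddCommGroup E] [NormedSpace ℝ E]
  {m : Mechanics} {ħ : ℝ} {w : Coord N → ℝ} {h : Phase N → ℝ}
  {Q : ℝ → Phase N → ℝ} {v : ℝ → Phase N → Phase N} {L : ℝ → Phase N → E}

/-- The integrand of the action of the translated fluid, in coordinates that move with it. -/
def variedIntegrand (m : Mechanics) (ħ : ℝ) (w : Coord N → ℝ) (h : Phase N → ℝ)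
    (Q : ℝ → Phase N → ℝ) (v : ℝ → Phase N → Phase N) (L : ℝ → Phase N → E) (δ : ℝ → Phase N)
    (ε t : ℝ) (z : Phase N) : E :=
  ((∑ i : Fin N, (z + ε • δ t) (Sum.inl i) * (v t z + ε • deriv δ t) (Sum.inr i)) * Q t z) • L t z
    - genApply m ħ w h (Q t) (z + ε • δ t) z • L t z

/-- The derivative of `variedIntegrand` with respect to `ε`. -/
def variedIntegrandDeriv (m : Mechanics) (ħ : ℝ) (w : Coord N → ℝ) (h : Phase N → ℝ)
    (Q : ℝ → Phase N → ℝ) (v : ℝ → Phase N → Phase N) (L : ℝ → Phase N → E) (δ : ℝ → Phase N)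
    (ε t : ℝ) (z : Phase N) : E :=
  ((∑ i : Fin N, (δ t (Sum.inl i) * (v t z + ε • deriv δ t) (Sum.inr i)
      + (z + ε • δ t) (Sum.inl i) * deriv δ t (Sum.inr i))) * Q t z) • L t z
    - (∑ a, δ t a * genApply m ħ w (pd a h) (Q t) (z + ε • δ t) z) • L t z

/-- The substitution `z ↦ z + ε δ(t)` undoes the translation of `Q`, `L` and `v`. The displacement
survives in `p`, in the added velocity and in the argument of `h`, where it is easy to
differentiate. -/
lemma variedAction_eq (ti tf : ℝ) (δ : ℝ → Phase N) (ε : ℝ) :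
    variedAction m ħ w ti tf h Q v L δ ε = ∫ t in ti..tf,
      ((∫ z, ((∑ i : Fin N, (z + ε • δ t) (Sum.inl i) * (v t z + ε • deriv δ t) (Sum.inr i))
        * Q t z) • L t z) - ∫ z, genApply m ħ w h (Q t) (z + ε • δ t) z • L t z) := by
  unfold variedAction action
  refine intervalIntegral.integral_congr fun t _ => ?_
  simp only [genApply_comp_sub_right]
  congr 1
  · rw [← integral_sub_right_eq_self (fun z => ((∑ i : Fin N, (z + ε • δ t) (Sum.inl i) *
      (v t z + ε • deriv δ t) (Sum.inr i)) * Q t z) • L t z) (ε • δ t)]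
    simp only [sub_add_cancel]
  · rw [← integral_sub_right_eq_self (fun z => genApply m ħ w h (Q t) (z + ε • δ t) z • L t z)
      (ε • δ t)]
    simp only [sub_add_cancel]

/-- The integrability conditions of a label, for given extensions `M` of `Q L` and `F` of `Q v L`,
bound `g` and radius `r`. -/
structure IsLabelBound (m : Mechanics) (ħ : ℝ) (w : Coord N → ℝ) (I : Set ℝ)
    (h : Phase N → ℝ) (Q : ℝ → Phase N → ℝ) (v : ℝ → Phase N → Phase N) (L : ℝ → Phase N → E)
    (M : ℝ → Phase N → E) (F : Coord N → ℝ → Phase N → E) (g : Phase N → ℝ) (r : ℝ) : Prop where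
  pos : 0 < r
  integrable : Integrable g
  contDiffOn : ContDiffOn ℝ 1 (uncurry M) (I ×ˢ univ)
  continuousOn : ∀ a, ContinuousOn (uncurry (F a)) (I ×ˢ univ)
  flux : ∀ t ∈ I, ∀ a, ContDiff ℝ 1 (F a t) ∧ Integrable (fun z => (1 + ‖z‖) * ‖pd a (F a t) z‖)
  bound : ∀ t ∈ I, ∀ z, (1 + ‖z‖) * ‖M t z‖ ≤ g z ∧
      (1 + ‖z‖) * ‖derivWithin (fun τ => M τ z) I t‖ ≤ g z ∧
      ∀ a, (1 + ‖z‖) * ‖F a t z‖ ≤ g z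
  eq : ∀ t ∈ I, ∀ z, Q t z ≠ 0 → M t z = Q t z • L t z ∧
      (∀ a, F a t z = (v t z a * Q t z) • L t z) ∧
      ∀ s : Phase N, ‖s‖ ≤ r →
        ‖L t z‖ * |genApply m ħ w h (Q t) (z + s) z| ≤ g z ∧
        ∀ a, ‖L t z‖ * |genApply m ħ w (pd a h) (Q t) (z + s) z| ≤ g z

lemma IsLabel.exists_bound {I : Set ℝ} (hL : IsLabel m ħ w I h Q v L) :
    ∃ M F g r, IsLabelBound m ħ w I h Q v L M F g r := by
  obtain ⟨M, F, g, r, h1, h2, h3, h4, h5, h6, h7⟩ := hL.admissible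
  exact ⟨M, F, g, r, h1, h2, h3, h4, h5, h6, h7⟩

variable {I : Set ℝ} {M : ℝ → Phase N → E} {F : Coord N → ℝ → Phase N → E} {g : Phase N → ℝ}
  {r : ℝ}

namespace IsLabelBound

/-- A factor of at most linear growth is absorbed by the weight `1 + ‖z‖` in the bound on the
extension of `Q L`. -/
lemma norm_M_le (hb : IsLabelBound m ħ w I h Q v L M F g r) {t : ℝ} (ht : t ∈ I) {z : Phase N}
    (hz : Q t z ≠ 0) {x C : ℝ} (hx : |x| ≤ C * (1 + ‖z‖)) : ‖(x * Q t z) • L t z‖ ≤ C * g z := by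
  have hC : 0 ≤ C := by
    by_contra hC
    have := (abs_nonneg x).trans hx
    nlinarith [norm_nonneg z]
  rw [mul_smul, ← (hb.eq t ht z hz).1, norm_smul, Real.norm_eq_abs]
  calc |x| * ‖M t z‖ ≤ C * (1 + ‖z‖) * ‖M t z‖ := by gcongr
    _ = C * ((1 + ‖z‖) * ‖M t z‖) := by ring
    _ ≤ C * g z := mul_le_mul_of_nonneg_left (hb.bound t ht z).1 hC

lemma norm_F_le (hb : IsLabelBound m ħ w I h Q v L M F g r) {t : ℝ} (ht : t ∈ I) {z : Phase N}
    (hz : Q t z ≠ 0) (a : Coord N) {x C : ℝ} (hx : |x| ≤ C * (1 + ‖z‖)) :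
    ‖(x * v t z a * Q t z) • L t z‖ ≤ C * g z := by
  have hC : 0 ≤ C := by
    by_contra hC
    have := (abs_nonneg x).trans hx
    nlinarith [norm_nonneg z]
  rw [mul_assoc, mul_smul, ← (hb.eq t ht z hz).2.1 a, norm_smul, Real.norm_eq_abs]
  calc |x| * ‖F a t z‖ ≤ C * (1 + ‖z‖) * ‖F a t z‖ := by gcongr
    _ = C * ((1 + ‖z‖) * ‖F a t z‖) := by ring
    _ ≤ C * g z := mul_le_mul_of_nonneg_left ((hb.bound t ht z).2.2 a) hC

lemma norm_variedIntegrand_le (hb : IsLabelBound m ħ w I h Q v L M F g r) {δ : ℝ → Phase N}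
    {t : ℝ} (ht : t ∈ I) {C ε : ℝ} (hC : 0 ≤ C) (h1 : ‖δ t‖ ≤ C) (h2 : ‖deriv δ t‖ ≤ C)
    (hε : |ε| ≤ 1) (hεr : |ε| * C ≤ r) {z : Phase N} (hz : Q t z ≠ 0) :
    ‖variedIntegrand m ħ w h Q v L δ ε t z‖ ≤ (N * ((1 + C) + (1 + C) * C) + 1) * g z := by
  have hz0 := norm_nonneg z
  have hs : ‖ε • δ t‖ ≤ r := by
    rw [norm_smul, Real.norm_eq_abs]; exact le_trans (by gcongr) hεr
  have hs' : ‖ε • δ t‖ ≤ C := by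
    rw [norm_smul, Real.norm_eq_abs]
    calc |ε| * ‖δ t‖ ≤ 1 * C := by gcongr
      _ = C := one_mul C
  have hx (a) : |(z + ε • δ t) a| ≤ (1 + C) * (1 + ‖z‖) := by
    have := (norm_coord_le (z + ε • δ t) a).trans (norm_add_le _ _)
    rw [Real.norm_eq_abs] at this
    nlinarith
  have hy (a) : |ε * deriv δ t a| ≤ C := by
    rw [abs_mul]
    calc |ε| * |deriv δ t a| ≤ 1 * C := by
          gcongr; exact (norm_coord_le _ _).trans h2
      _ = C := one_mul C
  unfold variedIntegrand
  refine (norm_sub_le _ _).trans ?_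
  rw [add_mul]
  refine add_le_add ?_ ?_
  · rw [Finset.sum_mul, Finset.sum_smul]
    refine (norm_sum_le _ _).trans ?_
    refine (Finset.sum_le_card_nsmul _ _ (((1 + C) + (1 + C) * C) * g z) fun i _ => ?_).trans
      (le_of_eq (by simp [mul_assoc]))
    -- The varied velocity splits into `v`, which goes with the flux `Q v L`, and `ε δ'`, which goes
    -- with `Q L`: the two quantities that a label dominates.
    have : ((z + ε • δ t) (Sum.inl i) * (v t z + ε • deriv δ t) (Sum.inr i) * Q t z) • L t z
        = ((z + ε • δ t) (Sum.inl i) * v t z (Sum.inr i) * Q t z) • L t z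
        + ((z + ε • δ t) (Sum.inl i) * (ε * deriv δ t (Sum.inr i)) * Q t z) • L t z := by
      rw [← add_smul]; congr 1; simp; ring
    rw [this, add_mul]
    refine (norm_add_le _ _).trans (add_le_add ?_ ?_)
    · exact hb.norm_F_le ht hz _ (hx _)
    · refine hb.norm_M_le ht hz ?_
      rw [abs_mul]
      calc _ ≤ ((1 + C) * (1 + ‖z‖)) * C := by
            gcongr; exacts [hx _, hy _]
        _ = _ := by ring
  · rw [norm_smul, Real.norm_eq_abs, mul_comm, one_mul]
    exact ((hb.eq t ht z hz).2.2 _ hs).1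

lemma norm_variedIntegrandDeriv_le (hb : IsLabelBound m ħ w I h Q v L M F g r) {δ : ℝ → Phase N}
    {t : ℝ} (ht : t ∈ I) {C ε : ℝ} (hC : 0 ≤ C) (h1 : ‖δ t‖ ≤ C) (h2 : ‖deriv δ t‖ ≤ C)
    (hε : |ε| ≤ 1) (hεr : |ε| * C ≤ r) {z : Phase N} (hz : Q t z ≠ 0) :
    ‖variedIntegrandDeriv m ħ w h Q v L δ ε t z‖
      ≤ (N * (C + C * C + (1 + C) * C) + Fintype.card (Coord N) * C) * g z := by
  have hz0 := norm_nonneg z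
  have hs : ‖ε • δ t‖ ≤ r := by
    rw [norm_smul, Real.norm_eq_abs]; exact le_trans (by gcongr) hεr
  have hs' : ‖ε • δ t‖ ≤ C := by
    rw [norm_smul, Real.norm_eq_abs]
    calc |ε| * ‖δ t‖ ≤ 1 * C := by gcongr
      _ = C := one_mul C
  have hx (a) : |(z + ε • δ t) a| ≤ (1 + C) * (1 + ‖z‖) := by
    have := (norm_coord_le (z + ε • δ t) a).trans (norm_add_le _ _)
    rw [Real.norm_eq_abs] at this
    nlinarith
  have hd (a) : |δ t a| ≤ C := (norm_coord_le _ _).trans h1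
  have hd' (a) : |deriv δ t a| ≤ C := (norm_coord_le _ _).trans h2
  have hy (a) : |ε * deriv δ t a| ≤ C := by
    rw [abs_mul]
    calc |ε| * |deriv δ t a| ≤ 1 * C := by
          gcongr; exact hd' a
      _ = C := one_mul C
  unfold variedIntegrandDeriv
  refine (norm_sub_le _ _).trans ?_
  rw [add_mul]
  refine add_le_add ?_ ?_
  · rw [Finset.sum_mul, Finset.sum_smul]
    refine (norm_sum_le _ _).trans ?_
    refine (Finset.sum_le_card_nsmul _ _ ((C + C * C + (1 + C) * C) * g z) fun i _ => ?_).trans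
      (le_of_eq (by simp [mul_assoc]))
    have : ((δ t (Sum.inl i) * (v t z + ε • deriv δ t) (Sum.inr i)
          + (z + ε • δ t) (Sum.inl i) * deriv δ t (Sum.inr i)) * Q t z) • L t z
        = (δ t (Sum.inl i) * v t z (Sum.inr i) * Q t z) • L t z
        + (δ t (Sum.inl i) * (ε * deriv δ t (Sum.inr i)) * Q t z) • L t z
        + ((z + ε • δ t) (Sum.inl i) * deriv δ t (Sum.inr i) * Q t z) • L t z := by
      rw [← add_smul, ← add_smul]; congr 1; simp; ring
    rw [this, add_mul, add_mul]
    refine (norm_add_le _ _).trans (add_le_add ((norm_add_le _ _).trans (add_le_add ?_ ?_)) ?_)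
    · exact hb.norm_F_le ht hz _ ((hd _).trans (by nlinarith))
    · refine hb.norm_M_le ht hz ?_
      rw [abs_mul]
      calc _ ≤ C * C := by gcongr; exacts [hd _, hy _]
        _ ≤ _ := by nlinarith [mul_nonneg hC hC]
    · refine hb.norm_M_le ht hz ?_
      rw [abs_mul]
      calc _ ≤ ((1 + C) * (1 + ‖z‖)) * C := by
            gcongr; exacts [hx _, hd' _]
        _ = _ := by ring
  · rw [Finset.sum_smul]
    refine (norm_sum_le _ _).trans ?_
    refine (Finset.sum_le_card_nsmul _ _ (C * g z) fun a _ => ?_).trans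
      (le_of_eq (by simp [mul_assoc]))
    rw [norm_smul, Real.norm_eq_abs, abs_mul, mul_assoc]
    refine mul_le_mul (hd a) ?_ (mul_nonneg (abs_nonneg _) (norm_nonneg _)) hC
    rw [mul_comm]
    exact ((hb.eq t ht z hz).2.2 _ hs).2 a

end IsLabelBound

end FirstVariation

/-! ### The first variation as a pairing with the residuals of the Hamilton equations -/

section FirstVariationFormula

variable {N : ℕ} {E : Type*} [NormedAddCommGroup E] [NormedSpace ℝ E]
  {m : Mechanics} {ħ : ℝ} {w : Coord N → ℝ} {h : Phase N → ℝ}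
  {Q : ℝ → Phase N → ℝ} {v : ℝ → Phase N → Phase N} {L : ℝ → Phase N → E}
  {I : Set ℝ} {M : ℝ → Phase N → E} {F : Coord N → ℝ → Phase N → E} {g : Phase N → ℝ}
  {r : ℝ}

lemma fluidRegion_subset (I : Set ℝ) (Q : ℝ → Phase N → ℝ) :
    fluidRegion I Q ⊆ I ×ˢ univ := fun _ hq => ⟨hq.1, mem_univ _⟩

lemma IsFluidVelocity.continuousOn_coord (hv : IsFluidVelocity I Q v) (a : Coord N) :
    ContinuousOn (fun q : ℝ × Phase N => v q.1 q.2 a) (fluidRegion I Q) :=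
  (coordCLM a).continuous.comp_continuousOn hv.continuousOn

lemma IsRegularState.continuousOn_genApply_shift (hQ : IsRegularState m ħ w I h Q) (hħ : 0 < ħ)
    (hh : ContDiff ℝ (⊤ : ℕ∞) h) {s : ℝ → Phase N} (hs : Continuous s) :
    ContinuousOn (fun q : ℝ × Phase N => genApply m ħ w h (Q q.1) (q.2 + s q.1) q.2)
      (fluidRegion I Q) :=
  (hQ.convergent.continuousOn_genApply hħ hh hQ.continuousOn_pds).comp
    (f := fun q : ℝ × Phase N => (q.1, q.2 + s q.1, q.2)) (by fun_prop)
    fun q hq => ⟨hq.1, mem_univ _⟩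

lemma IsRegularState.continuousOn_genApply_pd_shift (hQ : IsRegularState m ħ w I h Q)
    (hħ : 0 < ħ) (hh : ContDiff ℝ (⊤ : ℕ∞) h) {s : ℝ → Phase N} (hs : Continuous s)
    (a : Coord N) :
    ContinuousOn (fun q : ℝ × Phase N => genApply m ħ w (pd a h) (Q q.1) (q.2 + s q.1) q.2)
      (fluidRegion I Q) :=
  ((hQ.convergent.pd_left a).continuousOn_genApply hħ (hh.pd a) hQ.continuousOn_pds).comp
    (f := fun q : ℝ × Phase N => (q.1, q.2 + s q.1, q.2)) (by fun_prop)
    fun q hq => ⟨hq.1, mem_univ _⟩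

lemma IsRegularState.continuousOn_variedIntegrand (hQ : IsRegularState m ħ w I h Q) (hħ : 0 < ħ)
    (hh : ContDiff ℝ (⊤ : ℕ∞) h) (hv : IsFluidVelocity I Q v)
    (hL : ContinuousOn (uncurry L) (fluidRegion I Q)) {δ : ℝ → Phase N} (hδ : ContDiff ℝ 1 δ)
    (ε : ℝ) :
    ContinuousOn (uncurry (variedIntegrand m ħ w h Q v L δ ε)) (fluidRegion I Q) := by
  have hδc := hδ.continuous
  have hδ' := hδ.continuous_deriv le_rfl
  have hvc := hv.continuousOn_coord
  have hQc := hQ.contDiffOn.continuousOn.mono (fluidRegion_subset I Q)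
  have hgen := hQ.continuousOn_genApply_shift hħ hh (s := fun t => ε • δ t) (by fun_prop)
  refine ContinuousOn.sub (ContinuousOn.smul (ContinuousOn.mul ?_ hQc) hL) (hgen.smul hL)
  refine continuousOn_finsetSum _ fun i _ => ContinuousOn.mul (by fun_prop) ?_
  exact (hvc _).add (by fun_prop)

lemma IsRegularState.continuousOn_variedIntegrandDeriv (hQ : IsRegularState m ħ w I h Q)
    (hħ : 0 < ħ) (hh : ContDiff ℝ (⊤ : ℕ∞) h) (hv : IsFluidVelocity I Q v)
    (hL : ContinuousOn (uncurry L) (fluidRegion I Q)) {δ : ℝ → Phase N} (hδ : ContDiff ℝ 1 δ)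
    (ε : ℝ) :
    ContinuousOn (uncurry (variedIntegrandDeriv m ħ w h Q v L δ ε)) (fluidRegion I Q) := by
  have hδc := hδ.continuous
  have hδ' := hδ.continuous_deriv le_rfl
  have hvc := hv.continuousOn_coord
  have hQc := hQ.contDiffOn.continuousOn.mono (fluidRegion_subset I Q)
  have hgen := hQ.continuousOn_genApply_pd_shift hħ hh (s := fun t => ε • δ t) (by fun_prop)
  refine ContinuousOn.sub (ContinuousOn.smul (ContinuousOn.mul ?_ hQc) hL)
    (ContinuousOn.smul ?_ hL)
  · refine continuousOn_finsetSum _ fun i _ => ContinuousOn.add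
      (ContinuousOn.mul (by fun_prop) ?_) (by fun_prop)
    exact (hvc _).add (by fun_prop)
  · exact continuousOn_finsetSum _ fun a _ => ContinuousOn.mul (by fun_prop) (hgen a)

lemma IsRegularState.hasDerivAt_variedIntegrand (hQ : IsRegularState m ħ w I h Q) (hħ : 0 < ħ)
    (hh : ContDiff ℝ (⊤ : ℕ∞) h) (δ : ℝ → Phase N) {t : ℝ} (ht : t ∈ I) (z : Phase N) (ε : ℝ) :
    HasDerivAt (fun ε => variedIntegrand m ħ w h Q v L δ ε t z)
      (variedIntegrandDeriv m ħ w h Q v L δ ε t z) ε := by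
  refine HasDerivAt.sub (HasDerivAt.smul_const (HasDerivAt.mul_const
    (HasDerivAt.fun_sum fun i _ => ?_) _) _) (HasDerivAt.smul_const
    (hQ.convergent.hasDerivAt_genApply_shift hħ hh ht (hQ.smooth t ht) z (δ t) ε) _)
  have h1 : HasDerivAt (fun ε : ℝ => (z + ε • δ t) (Sum.inl i)) (δ t (Sum.inl i)) ε := by
    simpa using ((hasDerivAt_id ε).mul_const (δ t (Sum.inl i))).const_add (z (Sum.inl i))
  have h2 : HasDerivAt (fun ε : ℝ => (v t z + ε • deriv δ t) (Sum.inr i))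
      (deriv δ t (Sum.inr i)) ε := by
    simpa using ((hasDerivAt_id ε).mul_const (deriv δ t (Sum.inr i))).const_add (v t z (Sum.inr i))
  exact h1.mul h2

/-- The action is differentiable along admissible variations. -/
lemma IsLabelBound.hasDerivAt_variedAction [CompleteSpace E] {ti tf : ℝ} (htt : ti < tf)
    (hb : IsLabelBound m ħ w (Icc ti tf) h Q v L M F g r)
    (hQ : IsRegularState m ħ w (Icc ti tf) h Q) (hħ : 0 < ħ)
    (hh : ContDiff ℝ (⊤ : ℕ∞) h) (hv : IsFluidVelocity (Icc ti tf) Q v)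
    (hL : ContinuousOn (uncurry L) (fluidRegion (Icc ti tf) Q)) {δ : ℝ → Phase N}
    (hδ : ContDiff ℝ 1 δ) :
    HasDerivAt (variedAction m ħ w ti tf h Q v L δ)
      (∫ t in ti..tf, ∫ z, variedIntegrandDeriv m ħ w h Q v L δ 0 t z) 0 := by
  obtain ⟨C₁, hC₁⟩ := isCompact_Icc.exists_bound_of_continuousOn
    (hδ.continuous.continuousOn (s := Icc ti tf))
  obtain ⟨C₂, hC₂⟩ := isCompact_Icc.exists_bound_of_continuousOn
    ((hδ.continuous_deriv le_rfl).continuousOn (s := Icc ti tf))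
  set C := max (max C₁ C₂) 0
  have hC : 0 ≤ C := le_max_right _ _
  have h1 : ∀ t ∈ Icc ti tf, ‖δ t‖ ≤ C := fun t ht =>
    (hC₁ t ht).trans ((le_max_left _ _).trans (le_max_left _ _))
  have h2 : ∀ t ∈ Icc ti tf, ‖deriv δ t‖ ≤ C := fun t ht =>
    (hC₂ t ht).trans ((le_max_right _ _).trans (le_max_left _ _))
  -- `|ε| ≤ 1` keeps the constants uniform, and `|ε| C ≤ r` keeps the displacement within the radius
  -- in which the label bounds hold.
  set ρ := min 1 (r / (C + 1))
  have hρ : 0 < ρ := lt_min one_pos (div_pos hb.pos (by positivity))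
  have hε1 {ε : ℝ} (hε : ε ∈ Metric.ball (0 : ℝ) ρ) : |ε| ≤ 1 := by
    rw [mem_ball_zero_iff, Real.norm_eq_abs] at hε
    exact (hε.trans_le (min_le_left _ _)).le
  have hε2 {ε : ℝ} (hε : ε ∈ Metric.ball (0 : ℝ) ρ) : |ε| * C ≤ r := by
    rw [mem_ball_zero_iff, Real.norm_eq_abs] at hε
    have h3 := (hε.trans_le (min_le_right _ _)).le
    rw [le_div_iff₀ (by positivity)] at h3
    nlinarith [abs_nonneg ε]
  set K := variedIntegrand m ħ w h Q v L δ
  set K' := variedIntegrandDeriv m ħ w h Q v L δ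
  set c := (N * ((1 + C) + (1 + C) * C) + 1 : ℝ)
  set c' := (N * (C + C * C + (1 + C) * C) + Fintype.card (Coord N) * C : ℝ)
  have hKc (ε) := hQ.continuousOn_variedIntegrand hħ hh hv hL hδ ε
  have hKc' (ε) := hQ.continuousOn_variedIntegrandDeriv hħ hh hv hL hδ ε
  have hKb {ε : ℝ} (hε : ε ∈ Metric.ball (0 : ℝ) ρ) : ∀ t ∈ Icc ti tf, ∀ z, Q t z ≠ 0 →
      ‖K ε t z‖ ≤ c * g z := fun t ht z hz =>
    hb.norm_variedIntegrand_le ht hC (h1 t ht) (h2 t ht) (hε1 hε) (hε2 hε) hz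
  have hKb' {ε : ℝ} (hε : ε ∈ Metric.ball (0 : ℝ) ρ) : ∀ t ∈ Icc ti tf, ∀ z, Q t z ≠ 0 →
      ‖K' ε t z‖ ≤ c' * g z := fun t ht z hz =>
    hb.norm_variedIntegrandDeriv_le ht hC (h1 t ht) (h2 t ht) (hε1 hε) (hε2 hε) hz
  -- Differentiation under the phase space integral at fixed time comes first; the time integral
  -- follows with the constant bound `∫ c' g`.
  have hinner : ∀ t ∈ Icc ti tf, ∀ ε ∈ Metric.ball (0 : ℝ) ρ,
      HasDerivAt (fun ε => ∫ z, K ε t z) (∫ z, K' ε t z) ε := by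
    intro t ht ε hε
    refine (hasDerivAt_integral_of_dominated_loc_of_deriv_le (bound := fun z => c' * g z)
      (F := fun ε z => K ε t z) (F' := fun ε z => K' ε t z) (Metric.isOpen_ball.mem_nhds hε)
      ?_ ?_ (hQ.aestronglyMeasurable ht (hKc' ε)) ?_
      (hb.integrable.const_mul c') ?_).2
    · exact Filter.Eventually.of_forall fun ε => hQ.aestronglyMeasurable ht (hKc ε)
    · exact hQ.integrable ht (hKc ε) (hb.integrable.const_mul c) (hKb hε t ht)
    · filter_upwards [hQ.ae_ne_zero ht] with z hz ε hε using hKb' hε t ht z hz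
    · exact Filter.Eventually.of_forall fun z ε _ =>
        hQ.hasDerivAt_variedIntegrand hħ hh δ ht z ε
  have hsub : Ioc ti tf ⊆ Icc ti tf := Ioc_subset_Icc_self
  have h0 : (0 : ℝ) ∈ Metric.ball (0 : ℝ) ρ := Metric.mem_ball_self hρ
  have hJc {ε : ℝ} (hε : ε ∈ Metric.ball (0 : ℝ) ρ) :
      ContinuousOn (fun t => ∫ z, K ε t z) (Icc ti tf) :=
    hQ.continuousOn_integral (hKc ε) (hb.integrable.const_mul c) (hKb hε)
  have hJc' : ContinuousOn (fun t => ∫ z, K' 0 t z) (Icc ti tf) :=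
    hQ.continuousOn_integral (hKc' 0) (hb.integrable.const_mul c') (hKb' h0)
  have houter : HasDerivAt (fun ε => ∫ t in ti..tf, ∫ z, K ε t z)
      (∫ t in ti..tf, ∫ z, K' 0 t z) 0 := by
    refine (intervalIntegral.hasDerivAt_integral_of_dominated_loc_of_deriv_le
      (bound := fun _ => ∫ z, c' * g z) (F := fun ε t => ∫ z, K ε t z)
      (F' := fun ε t => ∫ z, K' ε t z)
      (Metric.isOpen_ball.mem_nhds h0) ?_ ?_ ?_ ?_ intervalIntegrable_const ?_).2
    · filter_upwards [Metric.isOpen_ball.mem_nhds h0] with ε hε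
      rw [uIoc_of_le htt.le]
      exact ((hJc hε).mono hsub).aestronglyMeasurable measurableSet_Ioc
    · exact (hJc h0).intervalIntegrable_of_Icc htt.le
    · rw [uIoc_of_le htt.le]
      exact (hJc'.mono hsub).aestronglyMeasurable measurableSet_Ioc
    · refine Filter.Eventually.of_forall fun t ht ε hε => ?_
      rw [uIoc_of_le htt.le] at ht
      refine norm_integral_le_of_norm_le (hb.integrable.const_mul c') ?_
      filter_upwards [hQ.ae_ne_zero (hsub ht)] with z hz using hKb' hε t (hsub ht) z hz
    · refine Filter.Eventually.of_forall fun t ht ε hε => ?_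
      rw [uIoc_of_le htt.le] at ht
      exact hinner t (hsub ht) ε hε
  -- The action subtracts two integrals, whereas the estimates concern the integral of the
  -- difference. The energy part is integrable by the label bounds, hence so is the kinetic part.
  refine houter.congr_of_eventuallyEq ?_
  filter_upwards [Metric.isOpen_ball.mem_nhds h0] with ε hε
  rw [variedAction_eq]
  refine intervalIntegral.integral_congr fun t ht => ?_
  rw [uIcc_of_le htt.le] at ht
  have hi2 : Integrable fun z => genApply m ħ w h (Q t) (z + ε • δ t) z • L t z := by
    refine hQ.integrable (K := fun t z => genApply m ħ w h (Q t) (z + ε • δ t) z • L t z) ht ?_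
      hb.integrable fun z hz => ?_
    · exact (hQ.continuousOn_genApply_shift hħ hh (s := fun t => ε • δ t)
        (hδ.continuous.const_smul ε)).smul hL
    · rw [norm_smul, Real.norm_eq_abs, mul_comm]
      refine ((hb.eq t ht z hz).2.2 _ ?_).1
      rw [norm_smul, Real.norm_eq_abs]
      exact (mul_le_mul_of_nonneg_left (h1 t ht) (abs_nonneg _)).trans (hε2 hε)
  have hi := hQ.integrable ht (hKc ε) (hb.integrable.const_mul c) (hKb hε t ht)
  have hi1 : Integrable fun z => ((∑ i : Fin N, (z + ε • δ t) (Sum.inl i) *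
      (v t z + ε • deriv δ t) (Sum.inr i)) * Q t z) • L t z := by
    refine (hi.add hi2).congr (Filter.Eventually.of_forall fun z => ?_)
    simp [variedIntegrand]
  rw [← integral_sub hi1 hi2]
  rfl

/-- The continuity equation of the labels, extended to the zeros of the density. -/
lemma IsLabelBound.derivWithin_eq {ti tf : ℝ} (htt : ti < tf)
    (hb : IsLabelBound m ħ w (Icc ti tf) h Q v L M F g r)
    (hQ : IsRegularState m ħ w (Icc ti tf) h Q) (hv : IsFluidVelocity (Icc ti tf) Q v)
    (hL : IsLabel m ħ w (Icc ti tf) h Q v L) {t : ℝ} (ht : t ∈ Icc ti tf) (z : Phase N) :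
    derivWithin (fun τ => M τ z) (Icc ti tf) t = - ∑ a, pd a (F a t) z := by
  -- The extensions `M` and `F` make both sides continuous, so the computation is needed only where
  -- `Q ≠ 0`.
  suffices heq : (fun z => derivWithin (fun τ => M τ z) (Icc ti tf) t)
      = fun z => - ∑ a, pd a (F a t) z from congrFun heq z
  refine Continuous.ext_on (dense_ne_zero (hQ.null_zeros t ht))
    ((continuousOn_derivWithin_time htt hb.contDiffOn).slice ht) ?_ fun z hz => ?_
  · exact (continuous_finsetSum _ fun a _ => continuous_pd (hb.flux t ht a).1 a).neg
  · have hopen := (hQ.isOpen_ne_zero ht).mem_nhds hz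
    have hLd : DifferentiableAt ℝ (L t) z := by
      have h1 : ContDiffOn ℝ 1 (L t) {z | Q t z ≠ 0} :=
        hL.contDiffOn.comp (f := fun z => (t, z)) (by fun_prop) fun z hz => ⟨ht, hz⟩
      exact (h1.contDiffAt hopen).differentiableAt one_ne_zero
    have hvQ (a : Coord N) : DifferentiableAt ℝ (fun y => v t y a * Q t y) z := by
      have h1 : DifferentiableAt ℝ (v t) z :=
        ((hv.contDiffOn t ht).contDiffAt hopen).differentiableAt one_ne_zero
      exact ((coordCLM a).differentiableAt.comp z h1).mul
        ((hQ.smooth t ht).differentiable (by simp) z)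
    have hpd (a : Coord N) : pd a (F a t) z
        = (v t z a * Q t z) • pd a (L t) z + pd a (fun y => v t y a * Q t y) z • L t z := by
      have h1 : F a t =ᶠ[nhds z] fun y => (v t y a * Q t y) • L t y := by
        filter_upwards [hopen] with y hy using (hb.eq t ht y hy).2.1 a
      rw [pd_congr_of_eventuallyEq a h1, HasFDerivAt.pd_eq
        (f := fun y => (v t y a * Q t y) • L t y) ((hvQ a).hasFDerivAt.smul hLd.hasFDerivAt)]
      simp [pd]
    -- The product of the continuity equation for `Q` and the transport equation for `L` makes `Q L`
    -- a conserved density with flux `Q v L`.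
    have hd := (hv.continuity t ht z hz).smul (hL.transport t ht z hz)
    have hd' : HasDerivWithinAt (fun τ => M τ z) (- ∑ a, pd a (F a t) z) (Icc ti tf) t := by
      refine (hd.congr_of_eventuallyEq ?_ (hb.eq t ht z hz).1).congr_deriv ?_
      · have hc := (hQ.contDiffOn.continuousOn.slice_time z) t ht
        filter_upwards [self_mem_nhdsWithin, hc.eventually_ne hz] with τ hτ hτ'
        exact (hb.eq τ hτ z hτ').1
      · simp only [hpd, Finset.sum_add_distrib, smul_neg, neg_smul, Finset.smul_sum,
          Finset.sum_smul, smul_smul, neg_add, mul_comm]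
    exact hd'.derivWithin (uniqueDiffOn_Icc htt t ht)

lemma IsLabelBound.integrable_F (hb : IsLabelBound m ħ w I h Q v L M F g r) {t : ℝ}
    (ht : t ∈ I) (a : Coord N) {x : Phase N → ℝ} (hx : Continuous x)
    (hxb : ∀ z, |x z| ≤ 1 + ‖z‖) : Integrable fun z => x z • F a t z := by
  refine hb.integrable.mono'
    (hx.smul ((hb.flux t ht a).1.continuous)).aestronglyMeasurable
    (Filter.Eventually.of_forall fun z => ?_)
  rw [norm_smul, Real.norm_eq_abs]
  exact (mul_le_mul_of_nonneg_right (hxb z) (norm_nonneg _)).trans ((hb.bound t ht z).2.2 a)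

lemma IsLabelBound.integrable_M (hb : IsLabelBound m ħ w I h Q v L M F g r) {t : ℝ}
    (ht : t ∈ I) {x : Phase N → ℝ} (hx : Continuous x)
    (hxb : ∀ z, |x z| ≤ 1 + ‖z‖) : Integrable fun z => x z • M t z := by
  refine hb.integrable.mono' (hx.smul (hb.contDiffOn.continuousOn.slice ht)).aestronglyMeasurable
    (Filter.Eventually.of_forall fun z => ?_)
  rw [norm_smul, Real.norm_eq_abs]
  exact (mul_le_mul_of_nonneg_right (hxb z) (norm_nonneg _)).trans (hb.bound t ht z).1

lemma abs_coord_le_one_add (z : Phase N) (a : Coord N) : |z a| ≤ 1 + ‖z‖ := by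
  have := norm_coord_le z a
  rw [Real.norm_eq_abs] at this
  linarith

/-- The first moments of `Q L` change by the total flux. -/
lemma IsLabelBound.hasDerivWithinAt_moment [CompleteSpace E] {ti tf : ℝ} (htt : ti < tf)
    (hb : IsLabelBound m ħ w (Icc ti tf) h Q v L M F g r)
    (hQ : IsRegularState m ħ w (Icc ti tf) h Q) (hv : IsFluidVelocity (Icc ti tf) Q v)
    (hL : IsLabel m ħ w (Icc ti tf) h Q v L) (b : Coord N) {t : ℝ} (ht : t ∈ Icc ti tf) :
    HasDerivWithinAt (fun τ => ∫ z : Phase N, z b • M τ z) (∫ z, F b t z) (Icc ti tf) t := by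
  have hcoord : Continuous fun z : Phase N => z b := (coordCLM b).continuous
  have h1 : HasDerivWithinAt (fun τ => ∫ z : Phase N, z b • M τ z)
      (∫ z : Phase N, z b • derivWithin (fun τ => M τ z) (Icc ti tf) t) (Icc ti tf) t := by
    refine hasDerivWithinAt_integral_of_dominated (convex_Icc _ _) (bound := g)
      (F' := fun τ z => z b • derivWithin (fun τ => M τ z) (Icc ti tf) τ) ht
      (fun τ hτ => (hb.integrable_M hτ hcoord fun z => abs_coord_le_one_add z b).1)
      (hb.integrable_M ht hcoord fun z => abs_coord_le_one_add z b) ?_ hb.integrable ?_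
    · refine Filter.Eventually.of_forall fun z τ hτ => ?_
      rw [norm_smul, Real.norm_eq_abs]
      exact (mul_le_mul_of_nonneg_right (abs_coord_le_one_add z b)
        (norm_nonneg _)).trans (hb.bound τ hτ z).2.1
    · exact Filter.Eventually.of_forall fun z τ hτ =>
        (derivWithin_time_hasDerivWithinAt hb.contDiffOn hτ z).const_smul _
  refine h1.congr_deriv ?_
  have hpdi (a : Coord N) : Integrable fun z : Phase N => z b • pd a (F a t) z := by
    refine (hb.flux t ht a).2.mono' (hcoord.smul
      (continuous_pd (hb.flux t ht a).1 a)).aestronglyMeasurable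
      (Filter.Eventually.of_forall fun z => ?_)
    rw [norm_smul, Real.norm_eq_abs]
    exact mul_le_mul_of_nonneg_right (abs_coord_le_one_add z b) (norm_nonneg _)
  -- Integration by parts over the whole space: the weighted integrability of the flux and of its
  -- derivatives rules out boundary terms.
  have hparts (a : Coord N) : ∫ z : Phase N, z b • pd a (F a t) z
      = - ∫ z, (EuclideanSpace.single a (1 : ℝ) : Phase N) b • F a t z := by
    refine integral_bilinear_hasLineDerivAt_right_eq_neg_left_of_integrable
      (B := ContinuousLinearMap.lsmul ℝ ℝ) (f := fun z : Phase N => z b)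
      (f' := fun _ => (EuclideanSpace.single a (1 : ℝ) : Phase N) b)
      (v := (EuclideanSpace.single a (1 : ℝ) : Phase N)) ?_ (hpdi a)
      (hb.integrable_F ht a hcoord fun z => abs_coord_le_one_add z b)
      (fun z _ => ((coordCLM b).hasFDerivAt (x := z)).hasLineDerivAt _)
      (fun z _ => (((hb.flux t ht a).1.differentiable one_ne_zero z).hasFDerivAt).hasLineDerivAt _)
    refine Integrable.smul _ ?_
    simpa using hb.integrable_F ht a (x := fun _ => 1) continuous_const
      fun z => by simp
  simp only [hb.derivWithin_eq htt hQ hv hL ht, smul_neg, Finset.smul_sum]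
  rw [integral_neg, integral_finsetSum _ fun a _ => hpdi a, ← Finset.sum_neg_distrib]
  simp only [hparts, neg_neg]
  -- The derivative of the coordinate `z b` in direction `a` is 1 for `a = b` and 0 otherwise, so a
  -- single flux component survives.
  rw [Finset.sum_eq_single b]
  · simp
  · intro a _ hab
    simp [hab.symm]
  · simp

/-- The first variation of the action in terms of the residuals of the Hamilton equations. -/
lemma IsLabelBound.integral_variedIntegrandDeriv [CompleteSpace E] {ti tf : ℝ} (htt : ti < tf)
    (hb : IsLabelBound m ħ w (Icc ti tf) h Q v L M F g r)
    (hQ : IsRegularState m ħ w (Icc ti tf) h Q) (hħ : 0 < ħ)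
    (hh : ContDiff ℝ (⊤ : ℕ∞) h) (hv : IsFluidVelocity (Icc ti tf) Q v)
    (hL : IsLabel m ħ w (Icc ti tf) h Q v L) {δ : ℝ → Phase N}
    (hδ : ContDiff ℝ 1 δ) (hδi : δ ti = 0) (hδf : δ tf = 0) :
    (∀ a, ContinuousOn (fun t => ∫ z, (v t z a * Q t z - hamiltonFlux m ħ w h (Q t) a z) • L t z)
      (Icc ti tf)) ∧
    ∫ t in ti..tf, ∫ z, variedIntegrandDeriv m ħ w h Q v L δ 0 t z
      = ∫ t in ti..tf, ∑ i : Fin N,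
        (δ t (Sum.inl i) • (∫ z, (v t z (Sum.inr i) * Q t z
            - hamiltonFlux m ħ w h (Q t) (Sum.inr i) z) • L t z)
          - δ t (Sum.inr i) • ∫ z, (v t z (Sum.inl i) * Q t z
            - hamiltonFlux m ħ w h (Q t) (Sum.inl i) z) • L t z) := by
  have hLc := hL.contDiffOn.continuousOn
  have hQc := hQ.contDiffOn.continuousOn.mono (fluidRegion_subset _ Q)
  set R : Coord N → ℝ → Phase N → E := fun a t z =>
    (v t z a * Q t z - hamiltonFlux m ħ w h (Q t) a z) • L t z
  have hRc (a) : ContinuousOn (uncurry (R a)) (fluidRegion (Icc ti tf) Q) :=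
    (((hv.continuousOn_coord a).mul hQc).sub
      ((hQ.continuousOn_hamiltonFlux hħ hh a).mono (fluidRegion_subset _ Q))).smul hLc
  have hFb (a) : ∀ t ∈ Icc ti tf, ∀ z, Q t z ≠ 0 → ‖(v t z a * Q t z) • L t z‖ ≤ g z := by
    intro t ht z hz
    have := hb.norm_F_le ht hz a (x := 1) (C := 1) (by simp)
    simpa using this
  have hfluxb (a) : ∀ t ∈ Icc ti tf, ∀ z, Q t z ≠ 0 →
      ‖hamiltonFlux m ħ w h (Q t) a z • L t z‖ ≤ g z := by
    intro t ht z hz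
    have h0 (b) := ((hb.eq t ht z hz).2.2 0 (by simpa using hb.pos.le)).2 b
    simp only [add_zero] at h0
    rw [norm_smul, Real.norm_eq_abs, mul_comm]
    cases a with
    | inl i => simpa [hamiltonFlux] using h0 (Sum.inr i)
    | inr i => simpa [hamiltonFlux] using h0 (Sum.inl i)
  have hRb (a) : ∀ t ∈ Icc ti tf, ∀ z, Q t z ≠ 0 → ‖R a t z‖ ≤ 2 * g z := by
    intro t ht z hz
    simp only [R, sub_smul]
    exact (norm_sub_le _ _).trans (by linarith [hFb a t ht z hz, hfluxb a t ht z hz])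
  have hRI (a) : ContinuousOn (fun t => ∫ z, R a t z) (Icc ti tf) :=
    hQ.continuousOn_integral (hRc a) (hb.integrable.const_mul 2) (hRb a)
  refine ⟨hRI, ?_⟩
  -- `c i` is the moment of `p_i` and `B i` its time derivative: the ingredients of the total
  -- derivative to be split off.
  set c : Fin N → ℝ → E := fun i t => ∫ z : Phase N, z (Sum.inl i) • M t z
  set B : Fin N → ℝ → E := fun i t => ∫ z, F (Sum.inl i) t z
  have hcd (i) : ∀ t ∈ Icc ti tf, HasDerivWithinAt (c i) (B i t) (Icc ti tf) t := fun t ht =>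
    hb.hasDerivWithinAt_moment htt hQ hv hL (Sum.inl i) ht
  have hcc (i) : ContinuousOn (c i) (Icc ti tf) := fun t ht => (hcd i t ht).continuousWithinAt
  have hBc (i) : ContinuousOn (B i) (Icc ti tf) := by
    have h1 : ContinuousOn (fun t => ∫ z, (v t z (Sum.inl i) * Q t z) • L t z) (Icc ti tf) :=
      hQ.continuousOn_integral (K := fun t z => (v t z (Sum.inl i) * Q t z) • L t z)
        (((hv.continuousOn_coord _).mul hQc).smul hLc) hb.integrable (hFb _)
    refine h1.congr fun t ht => integral_congr_ae ?_
    filter_upwards [hQ.ae_ne_zero ht] with z hz using (hb.eq t ht z hz).2.1 _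
  -- Adding and subtracting `δx` times the flux of `p` completes the force on `δx` to a residual;
  -- what is left over is the time derivative of `δx · c`.
  have hpt : ∀ t ∈ Icc ti tf, ∫ z, variedIntegrandDeriv m ħ w h Q v L δ 0 t z
      = (∑ i : Fin N, (δ t (Sum.inl i) • (∫ z, R (Sum.inr i) t z)
          - δ t (Sum.inr i) • ∫ z, R (Sum.inl i) t z))
        + ∑ i : Fin N, (δ t (Sum.inr i) • B i t + deriv δ t (Sum.inr i) • c i t) := by
    intro t ht
    have hRi (a) : Integrable (R a t) :=
      hQ.integrable ht (hRc a) (hb.integrable.const_mul 2) (hRb a t ht)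
    have hMi (i : Fin N) : Integrable fun z : Phase N => z (Sum.inl i) • M t z :=
      hb.integrable_M ht (coordCLM (Sum.inl i)).continuous fun z => abs_coord_le_one_add z _
    have hFi (i : Fin N) : Integrable (F (Sum.inl i) t) := by
      simpa using hb.integrable_F ht (Sum.inl i) (x := fun _ => 1) continuous_const
        fun z => by simp
    have hRs (x : ℝ) (a) : Integrable fun z => x • R a t z := (hRi a).smul x
    have hFs (x : ℝ) (i) : Integrable fun z => x • F (Sum.inl i) t z := (hFi i).smul x
    have hMs (x : ℝ) (i) : Integrable fun z : Phase N => x • (z (Sum.inl i) • M t z) :=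
      (hMi i).smul x
    have hae : variedIntegrandDeriv m ħ w h Q v L δ 0 t =ᵐ[volume] fun z =>
        (∑ i : Fin N, (δ t (Sum.inl i) • R (Sum.inr i) t z
          - δ t (Sum.inr i) • R (Sum.inl i) t z))
        + ∑ i : Fin N, (δ t (Sum.inr i) • F (Sum.inl i) t z
          + deriv δ t (Sum.inr i) • (z (Sum.inl i) • M t z)) := by
      filter_upwards [hQ.ae_ne_zero ht] with z hz
      obtain ⟨hM, hF, -⟩ := hb.eq t ht z hz
      simp only [variedIntegrandDeriv, R, hM, hF, zero_smul, add_zero, smul_smul,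
        ← Finset.sum_smul, ← add_smul, ← sub_smul, hamiltonFlux]
      congr 1
      rw [Fintype.sum_sum_type, Finset.sum_mul, ← Finset.sum_add_distrib,
        ← Finset.sum_sub_distrib, ← Finset.sum_add_distrib]
      exact Finset.sum_congr rfl fun i _ => by ring
    rw [integral_congr_ae hae, integral_add, integral_finsetSum, integral_finsetSum]
    · congr 1
      · refine Finset.sum_congr rfl fun i _ => ?_
        rw [integral_sub (hRs _ _) (hRs _ _), integral_smul, integral_smul]
      · refine Finset.sum_congr rfl fun i _ => ?_
        rw [integral_add (hFs _ _) (hMs _ _), integral_smul, integral_smul]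
    · exact fun i _ => (hFs _ _).add (hMs _ _)
    · exact fun i _ => (hRs _ _).sub (hRs _ _)
    · exact integrable_finsetSum _ fun i _ => (hRs _ _).sub (hRs _ _)
    · exact integrable_finsetSum _ fun i _ => (hFs _ _).add (hMs _ _)
  have hδa (a) : Continuous fun t => δ t a := (coordCLM a).continuous.comp hδ.continuous
  have hδa' (a) : Continuous fun t => deriv δ t a :=
    (coordCLM a).continuous.comp (hδ.continuous_deriv le_rfl)
  have hI1 : ContinuousOn (fun t => ∑ i : Fin N, (δ t (Sum.inl i) • (∫ z, R (Sum.inr i) t z)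
      - δ t (Sum.inr i) • ∫ z, R (Sum.inl i) t z)) (Icc ti tf) :=
    continuousOn_finsetSum _ fun i _ => ((hδa _).continuousOn.smul (hRI _)).sub
      ((hδa _).continuousOn.smul (hRI _))
  have hI2 : ContinuousOn (fun t => ∑ i : Fin N, (δ t (Sum.inr i) • B i t
      + deriv δ t (Sum.inr i) • c i t)) (Icc ti tf) :=
    continuousOn_finsetSum _ fun i _ => ((hδa _).continuousOn.smul (hBc _)).add
      ((hδa' _).continuousOn.smul (hcc _))
  -- The fundamental theorem of calculus for `δx · c`; the variation vanishes at both end times.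
  have hend : ∫ t in ti..tf, ∑ i : Fin N, (δ t (Sum.inr i) • B i t
      + deriv δ t (Sum.inr i) • c i t) = 0 := by
    rw [intervalIntegral.integral_eq_sub_of_hasDerivAt_of_le htt.le
      (f := fun t => ∑ i : Fin N, δ t (Sum.inr i) • c i t)]
    · simp [hδi, hδf]
    · exact continuousOn_finsetSum _ fun i _ => (hδa _).continuousOn.smul (hcc _)
    · intro t ht
      refine HasDerivAt.fun_sum fun i _ => ?_
      have h1 : HasDerivAt (fun t => δ t (Sum.inr i)) (deriv δ t (Sum.inr i)) t :=
        (coordCLM (Sum.inr i)).hasFDerivAt.comp_hasDerivAt t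
          (hδ.differentiable one_ne_zero t).hasDerivAt
      exact h1.smul ((hcd i t (Ioo_subset_Icc_self ht)).hasDerivAt (Icc_mem_nhds ht.1 ht.2))
    · exact hI2.intervalIntegrable_of_Icc htt.le
  rw [intervalIntegral.integral_congr (g := fun t =>
      (∑ i : Fin N, (δ t (Sum.inl i) • (∫ z, R (Sum.inr i) t z)
          - δ t (Sum.inr i) • ∫ z, R (Sum.inl i) t z))
        + ∑ i : Fin N, (δ t (Sum.inr i) • B i t + deriv δ t (Sum.inr i) • c i t))
      (fun t ht => hpt t (by rwa [uIcc_of_le htt.le] at ht)),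
    intervalIntegral.integral_add (hI1.intervalIntegrable_of_Icc htt.le)
      (hI2.intervalIntegrable_of_Icc htt.le), hend, add_zero]

/-- The generalized Hamilton equations imply the variation principle. -/
lemma IsRegularState.variationPrinciple_of_hamiltonEquations [CompleteSpace E] {ti tf : ℝ}
    (htt : ti < tf) (hQ : IsRegularState m ħ w (Icc ti tf) h Q) (hħ : 0 < ħ)
    (hh : ContDiff ℝ (⊤ : ℕ∞) h) (hv : IsFluidVelocity (Icc ti tf) Q v)
    (hH : HamiltonEquations m ħ w (Icc ti tf) h Q v) :
    VariationPrinciple E m ħ w ti tf h Q v := by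
  intro L hL δ hδ hδi hδf
  obtain ⟨M, F, g, r, hb⟩ := hL.exists_bound
  have h1 := hb.hasDerivAt_variedAction htt hQ hħ hh hv hL.contDiffOn.continuousOn hδ
  rw [(hb.integral_variedIntegrandDeriv htt hQ hħ hh hv hL hδ hδi hδf).2] at h1
  convert h1
  symm
  rw [intervalIntegral.integral_congr (g := fun _ => (0 : E)), intervalIntegral.integral_zero]
  intro t ht
  rw [uIcc_of_le htt.le] at ht
  have h0 (a : Coord N) : ∫ z, (v t z a * Q t z - hamiltonFlux m ħ w h (Q t) a z) • L t z = 0 := by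
    rw [integral_congr_ae (g := fun _ => (0 : E)), integral_zero]
    filter_upwards [hQ.ae_ne_zero ht] with z hz
    rw [hamiltonEquations_iff.1 hH t ht z hz a, sub_self, zero_smul]
  simp [h0]

end FirstVariationFormula

/-! ### Labels carried by a parcel flow -/

section ParcelLabels

variable {N : ℕ} {E : Type*} [NormedAddCommGroup E] [NormedSpace ℝ E]
  {m : Mechanics} {ħ : ℝ} {w : Coord N → ℝ} {h : Phase N → ℝ}
  {Q : ℝ → Phase N → ℝ} {v : ℝ → Phase N → Phase N} {ti tf : ℝ}
  {D : Set (Phase N)} {Φ A : ℝ → Phase N → Phase N} {φ : Phase N → ℝ}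

open Classical in
/-- The function `φ` of the initial positions, carried along by the parcels. -/
def carried (D : Set (Phase N)) (Φ A : ℝ → Phase N → Phase N) (φ : Phase N → ℝ) (t : ℝ)
    (z : Phase N) : ℝ :=
  if z ∈ Φ t '' D then φ (A t z) else 0

/-- The part of space-time reached from the support of `φ`. -/
def carriedSupport (ti tf : ℝ) (Φ : ℝ → Phase N → Phase N) (φ : Phase N → ℝ) :
    Set (ℝ × Phase N) :=
  (fun q : ℝ × Phase N => (q.1, Φ q.1 q.2)) '' (Icc ti tf ×ˢ tsupport φ)

namespace IsParcelFlow

lemma carried_apply (hΦ : IsParcelFlow ti tf Q v D Φ A) {a : Phase N} (ha : a ∈ D) {t : ℝ}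
    (ht : t ∈ Icc ti tf) : carried D Φ A φ t (Φ t a) = φ a := by
  rw [carried, if_pos ⟨a, ha, rfl⟩, hΦ.left_inv a ha t ht]

lemma mem_carriedSupport (hΦ : IsParcelFlow ti tf Q v D Φ A) {t : ℝ} (ht : t ∈ Icc ti tf)
    {z : Phase N} (hz : carried D Φ A φ t z ≠ 0) : (t, z) ∈ carriedSupport ti tf Φ φ := by
  by_cases hzD : z ∈ Φ t '' D
  · obtain ⟨a, ha, rfl⟩ := hzD
    rw [hΦ.carried_apply ha ht] at hz
    exact ⟨(t, a), ⟨ht, subset_tsupport _ hz⟩, rfl⟩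
  · rw [carried, if_neg hzD] at hz
    exact absurd rfl hz

/-- A continuous image of a compact cylinder over the time interval. Compactness separates the
carried labels from the boundary of the filled region and bounds them in phase space. -/
lemma isCompact_carriedSupport (hΦ : IsParcelFlow ti tf Q v D Φ A) (hφ : HasCompactSupport φ)
    (hφD : tsupport φ ⊆ D) : IsCompact (carriedSupport ti tf Φ φ) := by
  refine (isCompact_Icc.prod hφ).image_of_continuousOn ?_
  exact (continuousOn_fst).prodMk (hΦ.continuousOn.mono (prod_mono_right hφD))

lemma ne_zero_of_mem (hΦ : IsParcelFlow ti tf Q v D Φ A) (hφD : tsupport φ ⊆ D) {t : ℝ}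
    {z : Phase N} (hz : (t, z) ∈ carriedSupport ti tf Φ φ) : Q t z ≠ 0 := by
  obtain ⟨⟨s, a⟩, ⟨hs, ha⟩, heq⟩ := hz
  obtain ⟨rfl, rfl⟩ := Prod.mk.inj heq
  exact hΦ.density_ne_zero a (hφD ha) s hs

lemma carried_eq_zero (hΦ : IsParcelFlow ti tf Q v D Φ A) {q : ℝ × Phase N}
    (hq : q.1 ∈ Icc ti tf) (hq' : q ∉ carriedSupport ti tf Φ φ) :
    carried D Φ A φ q.1 q.2 = 0 := by
  by_contra hne
  exact hq' (hΦ.mem_carriedSupport hq hne)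

/-- A space-time function that vanishes with the carried function off the carried support. -/
lemma eventually_not_mem (hΦ : IsParcelFlow ti tf Q v D Φ A) (hφ : HasCompactSupport φ)
    (hφD : tsupport φ ⊆ D) {q : ℝ × Phase N} (hq : q ∉ carriedSupport ti tf Φ φ) :
    ∀ᶠ p in nhds q, p ∉ carriedSupport ti tf Φ φ :=
  (hΦ.isCompact_carriedSupport hφ hφD).isClosed.isOpen_compl.mem_nhds hq

/-- On the relatively open filled region the function is `φ` composed with the `C¹` map to initial
positions; off the closed carried support it vanishes locally. These two cases cover the slab. -/
lemma contDiffOn_carried (hΦ : IsParcelFlow ti tf Q v D Φ A) (hφ : HasCompactSupport φ)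
    (hφD : tsupport φ ⊆ D) (hφ1 : ContDiff ℝ 1 φ) :
    ContDiffOn ℝ 1 (uncurry (carried D Φ A φ)) (Icc ti tf ×ˢ univ) := by
  intro q hq
  by_cases hqs : q ∈ carriedSupport ti tf Φ φ
  · obtain ⟨O, hO, hOeq⟩ := hΦ.isOpen_filled
    set filled := {q : ℝ × Phase N | q.1 ∈ Icc ti tf ∧ q.2 ∈ Φ q.1 '' D}
    have hqf : q ∈ filled := by
      obtain ⟨⟨s, a⟩, ⟨hs, ha⟩, rfl⟩ := hqs
      exact ⟨hs, a, hφD ha, rfl⟩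
    have hmem : filled ∈ nhdsWithin q (Icc ti tf ×ˢ univ) := by
      rw [hOeq, inter_comm]
      refine Filter.inter_mem self_mem_nhdsWithin (mem_nhdsWithin_of_mem_nhds (hO.mem_nhds ?_))
      rw [hOeq] at hqf; exact hqf.1
    have h1 : ContDiffWithinAt ℝ 1 (uncurry (carried D Φ A φ)) filled q := by
      refine (hφ1.comp_contDiffOn hΦ.contDiffOn q hqf).congr (fun p hp => ?_) ?_
      · exact if_pos hp.2
      · exact if_pos hqf.2
    exact h1.mono_of_mem_nhdsWithin hmem
  · refine (contDiffWithinAt_const (c := (0 : ℝ))).congr_of_eventuallyEq ?_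
      (hΦ.carried_eq_zero hq.1 hqs)
    filter_upwards [self_mem_nhdsWithin,
      mem_nhdsWithin_of_mem_nhds (hΦ.eventually_not_mem hφ hφD hqs)] with p hp hp'
    exact hΦ.carried_eq_zero hp.1 hp'

/-- `X` may be singular at the zeros of `Q`, but the carried support avoids them, and outside this
support the product is locally zero. -/
lemma continuousOn_mul_carried (hΦ : IsParcelFlow ti tf Q v D Φ A) (hφ : HasCompactSupport φ)
    (hφD : tsupport φ ⊆ D) (hφ1 : ContDiff ℝ 1 φ) (hQ : IsRegularState m ħ w (Icc ti tf) h Q)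
    {X : ℝ × Phase N → ℝ} (hX : ContinuousOn X (fluidRegion (Icc ti tf) Q)) :
    ContinuousOn (fun q : ℝ × Phase N => X q * carried D Φ A φ q.1 q.2)
      (Icc ti tf ×ˢ univ) := by
  intro q hq
  by_cases hqs : q ∈ carriedSupport ti tf Φ φ
  · have hq0 : q ∈ fluidRegion (Icc ti tf) Q := ⟨hq.1, hΦ.ne_zero_of_mem hφD hqs⟩
    refine ContinuousWithinAt.mul ?_ ((hΦ.contDiffOn_carried hφ hφD hφ1).continuousOn q hq)
    exact (hX q hq0).mono_of_mem_nhdsWithin (hQ.fluidRegion_mem_nhdsWithin hq0)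
  · refine (continuousWithinAt_const (b := (0 : ℝ))).congr_of_eventuallyEq ?_
      (by rw [hΦ.carried_eq_zero hq.1 hqs, mul_zero])
    filter_upwards [self_mem_nhdsWithin,
      mem_nhdsWithin_of_mem_nhds (hΦ.eventually_not_mem hφ hφD hqs)] with p hp hp'
    rw [hΦ.carried_eq_zero hp.1 hp', mul_zero]

lemma contDiff_mul_carried (hΦ : IsParcelFlow ti tf Q v D Φ A) (hφ : HasCompactSupport φ)
    (hφD : tsupport φ ⊆ D) (hφ1 : ContDiff ℝ 1 φ) (hQ : IsRegularState m ħ w (Icc ti tf) h Q)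
    {t : ℝ} (ht : t ∈ Icc ti tf) {X : Phase N → ℝ} (hX : ContDiffOn ℝ 1 X {z | Q t z ≠ 0}) :
    ContDiff ℝ 1 fun z => X z * carried D Φ A φ t z := by
  have hc : ContDiff ℝ 1 (carried D Φ A φ t) := by
    rw [← contDiffOn_univ]
    exact (hΦ.contDiffOn_carried hφ hφD hφ1).comp (f := fun z => (t, z)) (by fun_prop)
      fun z _ => ⟨ht, mem_univ _⟩
  rw [contDiff_iff_contDiffAt]
  intro z
  by_cases hzs : (t, z) ∈ carriedSupport ti tf Φ φ
  · exact (hX.contDiffAt ((hQ.isOpen_ne_zero ht).mem_nhds (hΦ.ne_zero_of_mem hφD hzs))).mul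
      hc.contDiffAt
  · refine (contDiffAt_const (c := (0 : ℝ))).congr_of_eventuallyEq ?_
    have hct : ContinuousAt (fun z : Phase N => (t, z)) z := by fun_prop
    filter_upwards [hct.eventually (hΦ.eventually_not_mem hφ hφD hzs)] with y hy
    rw [hΦ.carried_eq_zero ht hy, mul_zero]

lemma exists_radius (hΦ : IsParcelFlow ti tf Q v D Φ A) (hφ : HasCompactSupport φ)
    (hφD : tsupport φ ⊆ D) : ∃ R : ℝ, ∀ t ∈ Icc ti tf, ∀ z, R < ‖z‖ →
      carried D Φ A φ t z = 0 := by
  obtain ⟨R, hR⟩ := (hΦ.isCompact_carriedSupport hφ hφD).isBounded.exists_norm_le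
  refine ⟨R, fun t ht z hz => ?_⟩
  by_contra hne
  have := hR _ (hΦ.mem_carriedSupport ht hne)
  exact absurd ((norm_snd_le (t, z)).trans this) (not_le.2 hz)

lemma hasCompactSupport_mul_carried (hΦ : IsParcelFlow ti tf Q v D Φ A)
    (hφ : HasCompactSupport φ) (hφD : tsupport φ ⊆ D) {t : ℝ} (ht : t ∈ Icc ti tf)
    (X : Phase N → ℝ) : HasCompactSupport fun z => X z * carried D Φ A φ t z := by
  obtain ⟨R, hR⟩ := hΦ.exists_radius hφ hφD
  refine HasCompactSupport.of_support_subset_isCompact (isCompact_closedBall (0 : Phase N) R) ?_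
  intro z hz
  rw [mem_closedBall_zero_iff]
  by_contra hlt
  exact hz (by simp [hR t ht z (not_le.1 hlt)])

/-- Constancy along trajectories, by the chain rule in space-time; off the carried support all terms
vanish. -/
lemma transport_carried (htt : ti < tf) (hΦ : IsParcelFlow ti tf Q v D Φ A)
    (hφ : HasCompactSupport φ) (hφD : tsupport φ ⊆ D) (hφ1 : ContDiff ℝ 1 φ) {t : ℝ}
    (ht : t ∈ Icc ti tf) (z : Phase N) :
    HasDerivWithinAt (fun τ => carried D Φ A φ τ z)
      (- ∑ a, v t z a * pd a (carried D Φ A φ t) z) (Icc ti tf) t := by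
  have hd := ((hΦ.contDiffOn_carried hφ hφD hφ1).differentiableOn one_ne_zero (t, z)
    ⟨ht, mem_univ _⟩).hasFDerivWithinAt
  set T := fderivWithin ℝ (uncurry (carried D Φ A φ)) (Icc ti tf ×ˢ univ) (t, z)
  by_cases hzs : (t, z) ∈ carriedSupport ti tf Φ φ
  · obtain ⟨a, ha, rfl⟩ : ∃ a ∈ D, Φ t a = z := by
      obtain ⟨⟨s, a⟩, ⟨hs, ha⟩, heq⟩ := hzs
      obtain ⟨rfl, rfl⟩ := Prod.mk.inj heq
      exact ⟨a, hφD ha, rfl⟩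
    have hcurve : HasDerivWithinAt (fun τ => (τ, Φ τ a)) (1, v t (Φ t a)) (Icc ti tf) t :=
      (hasDerivWithinAt_id t _).prodMk (hΦ.trajectory a ha t ht)
    have hm : MapsTo (fun τ => (τ, Φ τ a)) (Icc ti tf) (Icc ti tf ×ˢ univ) :=
      fun τ hτ => ⟨hτ, mem_univ _⟩
    have h1 := HasFDerivWithinAt.comp_hasDerivWithinAt t hd hcurve hm
    have h2 : HasDerivWithinAt (uncurry (carried D Φ A φ) ∘ fun τ => (τ, Φ τ a)) 0
        (Icc ti tf) t := by
      refine (hasDerivWithinAt_const t _ (φ a)).congr (fun τ hτ => ?_) ?_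
      · exact hΦ.carried_apply ha hτ
      · exact hΦ.carried_apply ha ht
    -- The space-time derivative annihilates the direction `(1, v)` of the trajectory, because
    -- derivatives within a nondegenerate interval are unique, also at its ends.
    have h3 : T (1, v t (Φ t a)) = 0 :=
      (uniqueDiffOn_Icc htt t ht).eq_deriv _ h1 h2
    have hx : HasFDerivAt (carried D Φ A φ t) (T.comp (ContinuousLinearMap.inr ℝ ℝ (Phase N)))
        (Φ t a) := by
      rw [← hasFDerivWithinAt_univ]
      have hincl : HasFDerivWithinAt (fun y : Phase N => (t, y))
          (ContinuousLinearMap.inr ℝ ℝ (Phase N)) univ (Φ t a) :=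
        (hasFDerivAt_prodMk_right t (Φ t a)).hasFDerivWithinAt
      exact hd.comp (f := fun y : Phase N => (t, y)) (Φ t a) hincl fun y _ => ⟨ht, mem_univ _⟩
    refine (hasDerivWithinAt_time hd).congr_deriv ?_
    -- The pure time direction is the trajectory direction minus the spatial direction `(0, v)`.
    have h4 : (((1 : ℝ), (0 : Phase N)) : ℝ × Phase N)
        = ((1 : ℝ), v t (Φ t a)) - ContinuousLinearMap.inr ℝ ℝ (Phase N) (v t (Φ t a)) := by
      simp
    rw [h4, map_sub, h3, zero_sub]
    congr 1
    change (T.comp (ContinuousLinearMap.inr ℝ ℝ (Phase N))) (v t (Φ t a)) = _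
    rw [clm_apply_eq_sum]
    exact Finset.sum_congr rfl fun b _ => by rw [hx.pd_eq, smul_eq_mul]
  · have hct : ContinuousAt (fun z : Phase N => (t, z)) z := by fun_prop
    have hct' : ContinuousAt (fun τ : ℝ => (τ, z)) t := by fun_prop
    have h0 (a : Coord N) : pd a (carried D Φ A φ t) z = 0 := by
      have : carried D Φ A φ t =ᶠ[nhds z] fun _ => 0 := by
        filter_upwards [hct.eventually (hΦ.eventually_not_mem hφ hφD hzs)] with y hy
        exact hΦ.carried_eq_zero ht hy
      rw [pd_congr_of_eventuallyEq a this]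
      simp [pd]
    simp only [h0, mul_zero, Finset.sum_const_zero, neg_zero]
    refine (hasDerivWithinAt_const t _ (0 : ℝ)).congr_of_eventuallyEq ?_
      (hΦ.carried_eq_zero (q := (t, z)) ht hzs)
    filter_upwards [self_mem_nhdsWithin,
      mem_nhdsWithin_of_mem_nhds (hct'.eventually (hΦ.eventually_not_mem hφ hφD hzs))]
      with τ hτ hτ'
    exact hΦ.carried_eq_zero (q := (τ, z)) hτ hτ'

omit [NormedSpace ℝ E] in
lemma exists_bound_on_ball {X : ℝ × Phase N → E} (hX : ContinuousOn X (Icc ti tf ×ˢ univ))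
    (R : ℝ) : ∃ C, 0 ≤ C ∧ ∀ t ∈ Icc ti tf, ∀ z : Phase N, ‖z‖ ≤ R →
      (1 + ‖z‖) * ‖X (t, z)‖ ≤ C := by
  obtain ⟨C, hC⟩ :=
    (isCompact_Icc.prod (isCompact_closedBall (0 : Phase N) R)).exists_bound_of_continuousOn
    (hX.mono (prod_mono_right (subset_univ _)))
  refine ⟨(1 + |R|) * |C|, by positivity, fun t ht z hz => ?_⟩
  have h1 := hC (t, z) ⟨ht, mem_closedBall_zero_iff.2 hz⟩
  exact mul_le_mul (by linarith [le_abs_self R]) (h1.trans (le_abs_self C)) (norm_nonneg _)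
    (by positivity)

/-- The carried functions are labels. -/
lemma isLabel_carried (htt : ti < tf) (hΦ : IsParcelFlow ti tf Q v D Φ A)
    (hφ : HasCompactSupport φ) (hφD : tsupport φ ⊆ D) (hφ1 : ContDiff ℝ 1 φ)
    (hQ : IsRegularState m ħ w (Icc ti tf) h Q) (hħ : 0 < ħ)
    (hv : IsFluidVelocity (Icc ti tf) Q v) (e : E) :
    IsLabel m ħ w (Icc ti tf) h Q v fun t z => carried D Φ A φ t z • e := by
  set c := carried D Φ A φ
  have hc := hΦ.contDiffOn_carried hφ hφD hφ1
  have hcd {t : ℝ} (ht : t ∈ Icc ti tf) : ContDiff ℝ 1 (c t) := by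
    rw [← contDiffOn_univ]
    exact hc.comp (f := fun z => (t, z)) (by fun_prop) fun z _ => ⟨ht, mem_univ _⟩
  have hQc := hQ.contDiffOn.continuousOn.mono (fluidRegion_subset _ Q)
  refine ⟨(hc.smul contDiffOn_const).mono (fluidRegion_subset _ _), fun t ht z _ => ?_, ?_⟩
  · refine ((hΦ.transport_carried htt hφ hφD hφ1 ht z).smul_const e).congr_deriv ?_
    have hpd (a : Coord N) : pd a (fun z => c t z • e) z = pd a (c t) z • e := by
      rw [(((hcd ht).differentiable one_ne_zero z).hasFDerivAt.smul_const e).pd_eq]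
      simp [pd]
    simp only [hpd, smul_smul, neg_smul, Finset.sum_smul]
    rfl
  · set M : ℝ → Phase N → E := fun t z => (Q t z * c t z) • e
    set F : Coord N → ℝ → Phase N → E := fun a t z => (v t z a * Q t z * c t z) • e
    have hM : ContDiffOn ℝ 1 (uncurry M) (Icc ti tf ×ˢ univ) :=
      (hQ.contDiffOn.mul hc).smul contDiffOn_const
    have hF (a : Coord N) : ContinuousOn (uncurry (F a)) (Icc ti tf ×ˢ univ) :=
      (hΦ.continuousOn_mul_carried hφ hφD hφ1 hQ (X := fun q => v q.1 q.2 a * Q q.1 q.2)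
        ((hv.continuousOn_coord a).mul hQc)).smul continuousOn_const
    have hFd {t : ℝ} (ht : t ∈ Icc ti tf) (a : Coord N) :
        ContDiff ℝ 1 fun z => v t z a * Q t z * c t z := by
      refine hΦ.contDiff_mul_carried hφ hφD hφ1 hQ ht (X := fun z => v t z a * Q t z) ?_
      exact ((coordCLM a).contDiff.comp_contDiffOn (hv.contDiffOn t ht)).mul
        ((hQ.smooth t ht).of_le (by norm_cast)).contDiffOn
    obtain ⟨R, hR⟩ := hΦ.exists_radius hφ hφD
    obtain ⟨C₁, h1, hC₁⟩ := exists_bound_on_ball hM.continuousOn R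
    obtain ⟨C₂, h2, hC₂⟩ := exists_bound_on_ball (continuousOn_derivWithin_time htt hM) R
    choose C₃ h3 hC₃ using fun a => exists_bound_on_ball (hF a) R
    obtain ⟨C₄, h4, hC₄⟩ := exists_bound_on_ball (X := fun q : ℝ × Phase N => c q.1 q.2 • e)
      (hc.continuousOn.smul continuousOn_const) R
    -- The radius `R + 1` leaves room for the displacements `‖s‖ ≤ 1` admitted below.
    obtain ⟨C₅, h5, hC₅⟩ := hQ.convergent.exists_bound_genApply hħ (R + 1)
    choose C₆ h6 hC₆ using fun a => (hQ.convergent.pd_left a).exists_bound_genApply hħ (R + 1)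
    set S₃ := ∑ a, C₃ a
    set S₆ := ∑ a, C₄ * C₆ a
    have h3' : 0 ≤ S₃ := Finset.sum_nonneg fun a _ => h3 a
    have h6' : 0 ≤ S₆ := Finset.sum_nonneg fun a _ => mul_nonneg h4 (h6 a)
    have h45 : 0 ≤ C₄ * C₅ := mul_nonneg h4 h5
    have h3a (a) : C₃ a ≤ S₃ := Finset.single_le_sum (fun a _ => h3 a) (Finset.mem_univ a)
    have h6a (a) : C₄ * C₆ a ≤ S₆ :=
      Finset.single_le_sum (f := fun a => C₄ * C₆ a) (fun a _ => mul_nonneg h4 (h6 a))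
        (Finset.mem_univ a)
    -- The label and its products with `Q` and `v Q` vanish outside one ball at all times, so a
    -- constant on this ball dominates every quantity.
    set g : Phase N → ℝ := indicator (Metric.closedBall 0 R)
      fun _ => C₁ + C₂ + S₃ + C₄ * C₅ + S₆
    have hgR {z : Phase N} (hz : ‖z‖ ≤ R) : g z = C₁ + C₂ + S₃ + C₄ * C₅ + S₆ :=
      indicator_of_mem (mem_closedBall_zero_iff.2 hz) _
    have hgR' {z : Phase N} (hz : R < ‖z‖) : g z = 0 :=
      indicator_of_notMem (fun hm => absurd (mem_closedBall_zero_iff.1 hm) (not_le.2 hz)) _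
    refine ⟨M, F, g, 1, one_pos, ?_, hM, hF, fun t ht a => ⟨?_, ?_⟩, fun t ht z => ?_,
      fun t ht z hz => ⟨?_, fun a => ?_, fun s hs => ?_⟩⟩
    · exact (integrable_indicator_iff measurableSet_closedBall).2
        (integrableOn_const (isCompact_closedBall _ _).measure_lt_top.ne)
    · exact (hFd ht a).smul contDiff_const
    · have hcs : HasCompactSupport (F a t) :=
        (hΦ.hasCompactSupport_mul_carried hφ hφD ht (fun z => v t z a * Q t z)).smul_right
      have hFt : ContDiff ℝ 1 (F a t) := (hFd ht a).smul contDiff_const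
      refine Continuous.integrable_of_hasCompactSupport ?_ ?_
      · exact (by fun_prop : Continuous fun z : Phase N => 1 + ‖z‖).mul (continuous_pd hFt a).norm
      · have : HasCompactSupport (pd a (F a t)) :=
          (hcs.fderiv ℝ).comp_left (g := fun T : Phase N →L[ℝ] E => T (EuclideanSpace.single a 1))
            (by simp)
        exact this.norm.mul_left
    · by_cases hzR : ‖z‖ ≤ R
      · rw [hgR hzR]
        have := hC₁ t ht z hzR
        have := hC₂ t ht z hzR
        refine ⟨?_, ?_, fun a => ?_⟩
        · simp only [uncurry] at *; linarith
        · simp only at *; linarith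
        · have := hC₃ a t ht z hzR
          simp only [uncurry] at *; linarith [h3a a]
      · have hz0 : ∀ τ ∈ Icc ti tf, c τ z = 0 := fun τ hτ => hR τ hτ z (not_le.1 hzR)
        have hM0 : ∀ τ ∈ Icc ti tf, M τ z = 0 := fun τ hτ => by simp [M, hz0 τ hτ]
        have hdM : derivWithin (fun τ => M τ z) (Icc ti tf) t = 0 := by
          rw [derivWithin_congr (f := fun _ => (0 : E)) hM0 (hM0 t ht), derivWithin_fun_const]
          rfl
        rw [hgR' (not_le.1 hzR), hM0 t ht, hdM]
        refine ⟨by simp, by simp, fun a => ?_⟩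
        simp [F, hz0 t ht]
    · simp only [M, smul_smul]
    · simp only [F, smul_smul]
    · by_cases hzR : ‖z‖ ≤ R
      · rw [hgR hzR]
        have hL : ‖c t z • e‖ ≤ C₄ :=
          le_trans (by nlinarith [norm_nonneg z, norm_nonneg (c t z • e)]) (hC₄ t ht z hzR)
        have hzs : ‖z + s‖ ≤ R + 1 := (norm_add_le _ _).trans (by linarith)
        have hz1 : ‖z‖ ≤ R + 1 := by linarith
        refine ⟨?_, fun a => ?_⟩
        · have := mul_le_mul hL (hC₅ t ht (z + s) z hzs hz1) (abs_nonneg _) h4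
          linarith
        · have := mul_le_mul hL (hC₆ a t ht (z + s) z hzs hz1) (abs_nonneg _) h4
          linarith [h6a a]
      · rw [hgR' (not_le.1 hzR)]
        simp [c, hR t ht z (not_le.1 hzR)]

end IsParcelFlow

end ParcelLabels

/-! ### The variation principle implies the Hamilton equations -/

section Converse

variable {N : ℕ} {E : Type*} [NormedAddCommGroup E] [NormedSpace ℝ E]
  {m : Mechanics} {ħ : ℝ} {w : Coord N → ℝ} {h : Phase N → ℝ}
  {Q : ℝ → Phase N → ℝ} {v : ℝ → Phase N → Phase N} {ti tf : ℝ}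
  {D : Set (Phase N)} {Φ A : ℝ → Phase N → Phase N}

/-- The fundamental lemma of the calculus of variations on a compact interval. -/
lemma eqOn_zero_of_integral_smul_eq_zero [CompleteSpace E] (htt : ti < tf) {R : ℝ → E}
    (hR : ContinuousOn R (Icc ti tf))
    (h0 : ∀ η : ℝ → ℝ, ContDiff ℝ (⊤ : ℕ∞) η → η ti = 0 → η tf = 0 →
      ∫ t in ti..tf, η t • R t = 0) : ∀ t ∈ Icc ti tf, R t = 0 := by
  -- Test functions supported in the open interval give vanishing almost everywhere; continuity
  -- carries it to the closed interval.
  have hae : ∀ᵐ t : ℝ, t ∈ Ioo ti tf → R t = 0 := by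
    refine isOpen_Ioo.ae_eq_zero_of_integral_contDiff_smul_eq_zero ?_ fun η hη _ hsupp => ?_
    · exact (hR.mono Ioo_subset_Icc_self).locallyIntegrableOn measurableSet_Ioo
    · have hout {t : ℝ} (ht : t ∉ Ioo ti tf) : η t = 0 :=
        image_eq_zero_of_notMem_tsupport fun hm => ht (hsupp hm)
      rw [← h0 η hη (hout (by simp)) (hout (by simp)), intervalIntegral.integral_of_le htt.le,
        setIntegral_eq_integral_of_forall_compl_eq_zero]
      intro t ht
      rw [hout fun hm => ht (Ioo_subset_Ioc_self hm), zero_smul]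
  have hae' : R =ᵐ[volume.restrict (Icc ti tf)] fun _ => (0 : E) := by
    rw [← restrict_Ioo_eq_restrict_Icc]
    exact (ae_restrict_iff' measurableSet_Ioo).2 hae
  exact fun t ht => Measure.eqOn_Icc_of_ae_eq volume htt.ne hae' hR continuousOn_const ht

/-- The variation principle makes the residuals of the Hamilton equations orthogonal to all
labels. -/
lemma IsRegularState.integral_residual_smul_eq_zero [CompleteSpace E] (htt : ti < tf)
    (hQ : IsRegularState m ħ w (Icc ti tf) h Q) (hħ : 0 < ħ)
    (hh : ContDiff ℝ (⊤ : ℕ∞) h) (hv : IsFluidVelocity (Icc ti tf) Q v)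
    (hV : VariationPrinciple E m ħ w ti tf h Q v) {L : ℝ → Phase N → E}
    (hL : IsLabel m ħ w (Icc ti tf) h Q v L) (a : Coord N) :
    ∀ t ∈ Icc ti tf, ∫ z, (v t z a * Q t z - hamiltonFlux m ħ w h (Q t) a z) • L t z = 0 := by
  obtain ⟨M, F, g, r, hb⟩ := hL.exists_bound
  have hzero {δ : ℝ → Phase N} (hδ : ContDiff ℝ 1 δ) (hi : δ ti = 0) (hf : δ tf = 0) :=
    (hb.hasDerivAt_variedAction htt hQ hħ hh hv hL.contDiffOn.continuousOn hδ).unique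
      (hV L hL δ hδ hi hf)
  have hformula {δ : ℝ → Phase N} (hδ : ContDiff ℝ 1 δ) (hi : δ ti = 0) (hf : δ tf = 0) :=
    hb.integral_variedIntegrandDeriv htt hQ hħ hh hv hL hδ hi hf
  have hcont := (hformula (δ := fun _ => 0) contDiff_const rfl rfl).1 a
  refine eqOn_zero_of_integral_smul_eq_zero htt hcont fun η hη hηi hηf => ?_
  have hη1 : ContDiff ℝ 1 η := hη.of_le (by norm_cast)
  cases a with
  | inl j =>
    -- In the variation formula `δx` is paired with minus the residual of the `p` equation;
    -- displacing `x_j` with the sign `-1` isolates that residual.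
    have hδ : ContDiff ℝ 1 fun t => η t • (EuclideanSpace.single (Sum.inr j) (-1 : ℝ) : Phase N) :=
      hη1.smul contDiff_const
    have hz := (hformula hδ (by simp [hηi]) (by simp [hηf])).2
    rw [hzero hδ (by simp [hηi]) (by simp [hηf])] at hz
    rw [hz]
    refine intervalIntegral.integral_congr fun t _ => ?_
    simp only [PiLp.smul_apply, smul_eq_mul]
    rw [Finset.sum_eq_single j]
    · simp
    · intro i _ hij; simp [hij]
    · simp
  | inr j =>
    have hδ : ContDiff ℝ 1 fun t => η t • (EuclideanSpace.single (Sum.inl j) (1 : ℝ) : Phase N) :=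
      hη1.smul contDiff_const
    have hz := (hformula hδ (by simp [hηi]) (by simp [hηf])).2
    rw [hzero hδ (by simp [hηi]) (by simp [hηf])] at hz
    rw [hz]
    refine intervalIntegral.integral_congr fun t _ => ?_
    simp only [PiLp.smul_apply, smul_eq_mul]
    rw [Finset.sum_eq_single j]
    · simp
    · intro i _ hij; simp [hij]
    · simp

/-- For fluids with parcel trajectories, the variation principle implies the generalized Hamilton
equations. -/
lemma IsParcelFlow.hamiltonEquations_of_variationPrinciple [CompleteSpace E] [Nontrivial E]
    (htt : ti < tf) (hΦ : IsParcelFlow ti tf Q v D Φ A)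
    (hQ : IsRegularState m ħ w (Icc ti tf) h Q) (hħ : 0 < ħ)
    (hh : ContDiff ℝ (⊤ : ℕ∞) h) (hv : IsFluidVelocity (Icc ti tf) Q v)
    (hV : VariationPrinciple E m ħ w ti tf h Q v) :
    HamiltonEquations m ħ w (Icc ti tf) h Q v := by
  rw [hamiltonEquations_iff]
  intro t ht z hz a
  set res : Phase N → ℝ := fun z => v t z a * Q t z - hamiltonFlux m ħ w h (Q t) a z
  have hvQ : ContDiffOn ℝ 1 (fun z => v t z a * Q t z) {z | Q t z ≠ 0} :=
    ((coordCLM a).contDiff.comp_contDiffOn (hv.contDiffOn t ht)).mul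
        ((hQ.smooth t ht).of_le (by norm_cast)).contDiffOn
  have hres : ContDiffOn ℝ 1 res {z | Q t z ≠ 0} :=
    hvQ.sub (hQ.contDiff_hamiltonFlux hħ hh ht a).contDiffOn
  have hresc {y : Phase N} (hy : Q t y ≠ 0) : ContinuousAt res y :=
    (hres.contDiffAt ((hQ.isOpen_ne_zero ht).mem_nhds hy)).continuousAt
  have hfilled : ∀ a₀ ∈ D, res (Φ t a₀) = 0 := by
    intro a₀ ha₀
    by_contra hne
    -- Multiplication by the value at the parcel fixes the sign: near the parcel the residual times
    -- this value is positive, so a nonnegative bump carried by the flow yields a positive integral,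
    -- against orthogonality.
    have hpos : 0 < res (Φ t a₀) * res (Φ t a₀) := mul_self_pos.2 hne
    have hU : ∀ᶠ y in nhds (Φ t a₀), 0 < res (Φ t a₀) * res y :=
      (continuousAt_const.mul (hresc (hΦ.density_ne_zero a₀ ha₀ t ht))).eventually_const_lt hpos
    have hΦc : ContinuousAt (Φ t) a₀ := by
      have : ContinuousOn (Φ t) D := hΦ.continuousOn.comp (f := fun y => (t, y)) (by fun_prop)
        fun y hy => ⟨ht, hy⟩
      exact this.continuousAt (hΦ.isOpen_start.mem_nhds ha₀)
    have hV' : {y | y ∈ D ∧ 0 < res (Φ t a₀) * res (Φ t y)} ∈ nhds a₀ :=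
      Filter.inter_mem (hΦ.isOpen_start.mem_nhds ha₀) (hΦc.eventually hU)
    obtain ⟨ρ, hρ, hball⟩ := Metric.nhds_basis_closedBall.mem_iff.1 hV'
    let φ : ContDiffBump a₀ := ⟨ρ / 2, ρ, by positivity, by linarith⟩
    have hsupp : tsupport φ = Metric.closedBall a₀ ρ := φ.tsupport_eq
    have hφD : tsupport φ ⊆ D := by rw [hsupp]; exact fun y hy => (hball hy).1
    have hφ1 : ContDiff ℝ 1 φ := φ.contDiff
    have hφc : HasCompactSupport φ := φ.hasCompactSupport
    obtain ⟨e, he⟩ := exists_ne (0 : E)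
    have hint := hQ.integral_residual_smul_eq_zero htt hħ hh hv hV
      (hΦ.isLabel_carried htt hφc hφD hφ1 hQ hħ hv e) a t ht
    simp only [smul_smul] at hint
    rw [integral_smul_const, smul_eq_zero, or_iff_left he] at hint
    have hcont : Continuous fun z => res z * carried D Φ A φ t z :=
      (hΦ.contDiff_mul_carried hφc hφD hφ1 hQ ht hres).continuous
    have hcs := hΦ.hasCompactSupport_mul_carried (A := A) hφc hφD ht res
    have hgt : 0 < ∫ z, res (Φ t a₀) * (res z * carried D Φ A φ t z) := by
      refine Continuous.integral_pos_of_hasCompactSupport_nonneg_nonzero (x := Φ t a₀)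
        (continuous_const.mul hcont) hcs.mul_left (fun y => ?_) ?_
      · by_cases hy : carried D Φ A φ t y = 0
        · simp [hy]
        · obtain ⟨⟨s, b⟩, ⟨hs, hb⟩, heq⟩ := hΦ.mem_carriedSupport ht hy
          obtain ⟨rfl, rfl⟩ := Prod.mk.inj heq
          rw [hsupp] at hb
          have hbm := hball hb
          dsimp only
          rw [hΦ.carried_apply hbm.1 hs, ← mul_assoc]
          exact mul_nonneg hbm.2.le φ.nonneg
      · rw [hΦ.carried_apply ha₀ ht, ← mul_assoc]
        refine mul_ne_zero hpos.ne' ?_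
        rw [φ.one_of_mem_closedBall (Metric.mem_closedBall_self φ.rIn_pos.le)]
        exact one_ne_zero
    rw [integral_const_mul] at hgt
    refine hgt.ne' ?_
    rw [mul_eq_zero]
    exact Or.inr hint
  -- The residual is continuous off the zeros of `Q` and vanishes on the dense filled set.
  refine sub_eq_zero.1 ?_
  change res z = 0
  by_contra hne
  have hev : ∀ᶠ y in nhds z, res y ≠ 0 := (hresc hz).eventually_ne hne
  obtain ⟨O, hO, hOo, hzO⟩ := eventually_nhds_iff.1 hev
  obtain ⟨y, hyO, a₀, ha₀, rfl⟩ := (hΦ.dense_filled t ht).inter_open_nonempty O hOo ⟨z, hzO⟩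
  exact hO _ hyO (hfilled a₀ ha₀)

end Converse

/-! ### Moderate growth and rapid decay -/

section Growth

variable {N : ℕ}

/-- Smooth functions of polynomial growth, with all derivatives. -/
def IsModerate (f : Phase N → ℝ) : Prop :=
  ContDiff ℝ (⊤ : ℕ∞) f ∧ ∀ l : List (Coord N), ∃ (C : ℝ) (d : ℕ), ∀ y,
    |pds l f y| ≤ C * (1 + ‖y‖) ^ d

/-- Smooth functions of rapid decay, with all derivatives. -/
def IsRapid (ψ : Phase N → ℝ) : Prop :=
  ContDiff ℝ (⊤ : ℕ∞) ψ ∧ ∀ (l : List (Coord N)) (d : ℕ), ∃ C : ℝ, ∀ y,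
    (1 + ‖y‖) ^ d * |pds l ψ y| ≤ C

lemma IsModerate.pd {f : Phase N → ℝ} (hf : IsModerate f) (a : Coord N) : IsModerate (pd a f) :=
  ⟨hf.1.pd a, fun l => by simpa only [pds_pd] using hf.2 (l ++ [a])⟩

lemma IsRapid.pd {ψ : Phase N → ℝ} (hψ : IsRapid ψ) (a : Coord N) : IsRapid (pd a ψ) :=
  ⟨hψ.1.pd a, fun l => by simpa only [pds_pd] using hψ.2 (l ++ [a])⟩

lemma IsRapid.pds {ψ : Phase N → ℝ} (hψ : IsRapid ψ) (l : List (Coord N)) :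
    IsRapid (pds l ψ) := by
  induction l with
  | nil => exact hψ
  | cons a l ih => exact ih.pd a

lemma IsModerate.exists_bound {f : Phase N → ℝ} (hf : IsModerate f) :
    ∃ (C : ℝ) (d : ℕ), 0 ≤ C ∧ ∀ y, |f y| ≤ C * (1 + ‖y‖) ^ d := by
  obtain ⟨C, d, h⟩ := hf.2 []
  refine ⟨|C|, d, abs_nonneg _, fun y => (h y).trans ?_⟩
  exact mul_le_mul_of_nonneg_right (le_abs_self C) (by positivity)

lemma IsRapid.exists_bound {ψ : Phase N → ℝ} (hψ : IsRapid ψ) (d : ℕ) :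
    ∃ C : ℝ, 0 ≤ C ∧ ∀ y, (1 + ‖y‖) ^ d * |ψ y| ≤ C := by
  obtain ⟨C, h⟩ := hψ.2 [] d
  exact ⟨|C|, abs_nonneg _, fun y => (h y).trans (le_abs_self C)⟩

lemma IsRapid.isModerate {ψ : Phase N → ℝ} (hψ : IsRapid ψ) : IsModerate ψ := by
  refine ⟨hψ.1, fun l => ?_⟩
  obtain ⟨C, hC⟩ := (hψ.pds l).exists_bound 0
  exact ⟨C, 0, fun y => by simpa using hC.2 y⟩

lemma hasTemperateGrowth_pd {f : Phase N → ℝ} (hf : f.HasTemperateGrowth) (a : Coord N) :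
    (pd a f).HasTemperateGrowth := by
  refine ⟨ContDiff.pd hf.1 a, fun n => ?_⟩
  obtain ⟨k, C, h⟩ := hf.2 (n + 1)
  refine ⟨k, C, fun x => ?_⟩
  have h1 := norm_iteratedFDeriv_clm_apply_const (c := (EuclideanSpace.single a (1 : ℝ) : Phase N))
    (f := fderiv ℝ f) (x := x) (N := n) (n := n)
    ((hf.1.fderiv_right (m := n) (by norm_cast; exact le_top)).contDiffAt) le_rfl
  rw [norm_iteratedFDeriv_fderiv] at h1
  refine h1.trans ?_
  simpa using h x

lemma hasTemperateGrowth_pds {f : Phase N → ℝ} (hf : f.HasTemperateGrowth) (l : List (Coord N)) :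
    (pds l f).HasTemperateGrowth := by
  induction l with
  | nil => exact hf
  | cons a l ih => exact hasTemperateGrowth_pd ih a

lemma _root_.Function.HasTemperateGrowth.isModerate {f : Phase N → ℝ}
    (hf : f.HasTemperateGrowth) : IsModerate f := by
  refine ⟨hf.1, fun l => ?_⟩
  obtain ⟨k, C, h⟩ := (hasTemperateGrowth_pds hf l).2 0
  exact ⟨C, k, fun y => by simpa using h y⟩

/-- The Peetre inequality. It trades decay in `z - y` for decay in one point at the price of growth
in the other. -/
lemma one_add_norm_le_mul (y z : Phase N) : 1 + ‖y‖ ≤ (1 + ‖z‖) * (1 + ‖z - y‖) := by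
  have : ‖y‖ ≤ ‖z‖ + ‖z - y‖ := by
    calc ‖y‖ = ‖z - (z - y)‖ := by rw [sub_sub_cancel]
      _ ≤ _ := norm_sub_le _ _
  nlinarith [norm_nonneg z, norm_nonneg (z - y)]

/-- The phase space has dimension `2 N`, so one more power is integrable. -/
lemma integrable_one_add_norm_pow (N : ℕ) :
    Integrable fun y : Phase N => ((1 + ‖y‖) ^ (2 * N + 1))⁻¹ := by
  have h := integrable_one_add_norm (E := Phase N) (μ := volume) (r := (2 * N + 1 : ℕ))
    (by simp; linarith)
  refine h.congr (Filter.Eventually.of_forall fun y => ?_)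
  dsimp only
  rw [Real.rpow_neg (by positivity), Real.rpow_natCast]

/-- Functions that are integrable with a polynomial weight. -/
def IsTempered (ρ : Measure (Phase N)) (g : Phase N → ℝ) : Prop :=
  ∃ d : ℕ, Integrable (fun y => ((1 + ‖y‖) ^ d)⁻¹ * g y) ρ

lemma isTempered_volume_of_bound {g : Phase N → ℝ} (hg : AEStronglyMeasurable g)
    {C : ℝ} {d : ℕ} (h : ∀ y, |g y| ≤ C * (1 + ‖y‖) ^ d) : IsTempered volume g := by
  refine ⟨d + (2 * N + 1), ((integrable_one_add_norm_pow N).const_mul C).mono' ?_ ?_⟩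
  · refine AEStronglyMeasurable.mul (Continuous.aestronglyMeasurable ?_) hg
    exact Continuous.inv₀ (by fun_prop) fun y => by positivity
  · refine Filter.Eventually.of_forall fun y => ?_
    rw [norm_mul, norm_inv, Real.norm_of_nonneg (by positivity), Real.norm_eq_abs, pow_add,
      mul_inv]
    have h0 : (0 : ℝ) < (1 + ‖y‖) ^ d := by positivity
    calc _ ≤ ((1 + ‖y‖) ^ d)⁻¹ * ((1 + ‖y‖) ^ (2 * N + 1))⁻¹ * (C * (1 + ‖y‖) ^ d) := by
          gcongr; exact h y
      _ = _ := by field_simp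

lemma IsModerate.isTempered {g : Phase N → ℝ} (hg : IsModerate g) : IsTempered volume g := by
  obtain ⟨C, d, -, h⟩ := hg.exists_bound
  exact isTempered_volume_of_bound hg.1.continuous.aestronglyMeasurable h

lemma IsTempered.aestronglyMeasurable {ρ : Measure (Phase N)} {g : Phase N → ℝ}
    (hg : IsTempered ρ g) : AEStronglyMeasurable g ρ := by
  obtain ⟨d, hd⟩ := hg
  have h1 : AEStronglyMeasurable (fun y : Phase N => (1 + ‖y‖) ^ d) ρ :=
    (by fun_prop : Continuous fun y : Phase N => (1 + ‖y‖) ^ d).aestronglyMeasurable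
  refine (h1.mul hd.1).congr (Filter.Eventually.of_forall fun y => ?_)
  have : (1 + ‖y‖) ^ d ≠ 0 := by positivity
  simp only [Pi.mul_apply]
  field_simp

end Growth

/-! ### Convolution with rapidly decreasing functions -/

section Convolution

variable {N : ℕ} {ρ : Measure (Phase N)} {g ψ : Phase N → ℝ}

/-- Convolution of the measure `g ρ` with `ψ`. -/
def smear (ρ : Measure (Phase N)) (g ψ : Phase N → ℝ) (z : Phase N) : ℝ :=
  ∫ y, g y * ψ (z - y) ∂ρ

lemma IsRapid.abs_sub_le (hψ : IsRapid ψ) (d : ℕ) : ∃ C : ℝ, 0 ≤ C ∧ ∀ z y : Phase N,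
    |ψ (z - y)| ≤ C * (1 + ‖z‖) ^ d * ((1 + ‖y‖) ^ d)⁻¹ := by
  obtain ⟨C, hC, h⟩ := hψ.exists_bound d
  refine ⟨C, hC, fun z y => ?_⟩
  rw [← div_eq_mul_inv, le_div_iff₀ (by positivity)]
  calc |ψ (z - y)| * (1 + ‖y‖) ^ d
      ≤ |ψ (z - y)| * ((1 + ‖z‖) * (1 + ‖z - y‖)) ^ d := by
        gcongr; exact one_add_norm_le_mul y z
    _ = ((1 + ‖z - y‖) ^ d * |ψ (z - y)|) * (1 + ‖z‖) ^ d := by rw [mul_pow]; ring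
    _ ≤ _ := by gcongr; exact h _

lemma norm_fderiv_le (f : Phase N → ℝ) (z : Phase N) :
    ‖fderiv ℝ f z‖ ≤ ∑ a, |pd a f z| := by
  refine ContinuousLinearMap.opNorm_le_bound _ (Finset.sum_nonneg fun a _ => abs_nonneg _)
    fun v => ?_
  rw [fderiv_eq_sum_pd, Finset.sum_mul]
  refine (norm_sum_le _ _).trans (Finset.sum_le_sum fun a _ => ?_)
  rw [norm_smul, mul_comm]
  exact mul_le_mul_of_nonneg_left (norm_coord_le v a) (norm_nonneg _)

lemma IsTempered.integrable_mul (hg : IsTempered ρ g) (hψ : IsRapid ψ) (z : Phase N) :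
    Integrable (fun y => g y * ψ (z - y)) ρ := by
  obtain ⟨d, hd⟩ := hg
  obtain ⟨C, hC, h⟩ := hψ.abs_sub_le d
  have hg' : AEStronglyMeasurable g ρ := IsTempered.aestronglyMeasurable ⟨d, hd⟩
  refine (hd.norm.const_mul (C * (1 + ‖z‖) ^ d)).mono' (hg'.mul
    (hψ.1.continuous.comp (by fun_prop)).aestronglyMeasurable)
    (Filter.Eventually.of_forall fun y => ?_)
  rw [norm_mul, norm_mul, norm_inv, Real.norm_of_nonneg (by positivity : 0 ≤ (1 + ‖y‖) ^ d)]
  calc ‖g y‖ * ‖ψ (z - y)‖ ≤ ‖g y‖ * (C * (1 + ‖z‖) ^ d * ((1 + ‖y‖) ^ d)⁻¹) := by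
        gcongr; exact h z y
    _ = _ := by ring

lemma IsTempered.exists_bound_smear (hg : IsTempered ρ g) (hψ : IsRapid ψ) :
    ∃ (C : ℝ) (d : ℕ), ∀ z, |smear ρ g ψ z| ≤ C * (1 + ‖z‖) ^ d := by
  obtain ⟨d, hd⟩ := hg
  obtain ⟨C, hC, h⟩ := hψ.abs_sub_le d
  refine ⟨C * ∫ y, ‖((1 + ‖y‖) ^ d)⁻¹ * g y‖ ∂ρ, d, fun z => ?_⟩
  rw [← Real.norm_eq_abs, smear, mul_right_comm, ← integral_const_mul]
  refine norm_integral_le_of_norm_le (hd.norm.const_mul _) (Filter.Eventually.of_forall fun y => ?_)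
  rw [norm_mul, norm_mul, norm_inv, Real.norm_of_nonneg (by positivity : 0 ≤ (1 + ‖y‖) ^ d)]
  calc ‖g y‖ * ‖ψ (z - y)‖ ≤ ‖g y‖ * (C * (1 + ‖z‖) ^ d * ((1 + ‖y‖) ^ d)⁻¹) := by
        gcongr; exact h z y
    _ = _ := by ring

/-- Differentiation under the integral: for base points within distance 1 of `z`, rapid decay of the
first derivatives of `ψ` beats the polynomial weight of `g`, uniformly in the base point. -/
lemma IsTempered.hasFDerivAt_smear (hg : IsTempered ρ g) (hψ : IsRapid ψ) (z : Phase N) :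
    HasFDerivAt (smear ρ g ψ) (∑ a, smear ρ g (pd a ψ) z • coordCLM a) z := by
  have hgm := hg.aestronglyMeasurable
  obtain ⟨d, hd⟩ := id hg
  choose C hC h using fun a => (hψ.pd a).abs_sub_le d
  have hψd : Differentiable ℝ ψ := hψ.1.differentiable (by simp)
  have key := hasFDerivAt_integral_of_dominated_of_fderiv_le (μ := ρ) (𝕜 := ℝ)
    (F := fun z y => g y * ψ (z - y)) (F' := fun z y => g y • fderiv ℝ ψ (z - y)) (x₀ := z)
    (bound := fun y => (∑ a, C a * (2 + ‖z‖) ^ d) * ‖((1 + ‖y‖) ^ d)⁻¹ * g y‖)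
    (Metric.ball_mem_nhds z one_pos)
    (Filter.Eventually.of_forall fun z => (hg.integrable_mul hψ z).1)
    (hg.integrable_mul hψ z) ?_ ?_ (hd.norm.const_mul _) ?_
  · refine key.congr_fderiv (ContinuousLinearMap.ext fun v => ?_)
    have hi : Integrable (fun y => g y • fderiv ℝ ψ (z - y)) ρ := by
      refine (integrable_finsetSum Finset.univ fun a _ =>
        ((hg.integrable_mul (hψ.pd a) z).norm)).mono' (hgm.smul
        ((hψ.1.continuous_fderiv (by simp)).comp (by fun_prop)).aestronglyMeasurable) ?_
      refine Filter.Eventually.of_forall fun y => ?_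
      rw [norm_smul]
      refine (mul_le_mul_of_nonneg_left (norm_fderiv_le ψ (z - y)) (norm_nonneg _)).trans ?_
      simp only [norm_mul, Finset.mul_sum, Real.norm_eq_abs]
      exact le_rfl
    rw [ContinuousLinearMap.integral_apply hi]
    simp only [smul_apply, fderiv_eq_sum_pd, sum_apply, smul_eq_mul, Finset.mul_sum, smear]
    rw [integral_finsetSum]
    · refine Finset.sum_congr rfl fun a _ => ?_
      rw [← integral_mul_const]
      exact integral_congr_ae (Filter.Eventually.of_forall fun y => by simp; ring)
    · intro a _
      refine ((hg.integrable_mul (hψ.pd a) z).mul_const (v a)).congr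
        (Filter.Eventually.of_forall fun y => by ring)
  · exact hgm.smul ((hψ.1.continuous_fderiv (by simp)).comp (by fun_prop)).aestronglyMeasurable
  · refine Filter.Eventually.of_forall fun y x hx => ?_
    have hx' : ‖x‖ ≤ 1 + ‖z‖ := by
      have h1 : ‖x - z‖ < 1 := by simpa [dist_eq_norm] using hx
      have h2 : ‖x‖ ≤ ‖x - z‖ + ‖z‖ := by simpa using norm_add_le (x - z) z
      linarith
    rw [norm_smul, norm_mul, norm_inv, Real.norm_of_nonneg (by positivity : 0 ≤ (1 + ‖y‖) ^ d)]
    calc ‖g y‖ * ‖fderiv ℝ ψ (x - y)‖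
        ≤ ‖g y‖ * ∑ a, C a * (2 + ‖z‖) ^ d * ((1 + ‖y‖) ^ d)⁻¹ := by
          refine mul_le_mul_of_nonneg_left ((norm_fderiv_le ψ _).trans
            (Finset.sum_le_sum fun a _ => (h a x y).trans ?_)) (norm_nonneg _)
          exact mul_le_mul_of_nonneg_right (mul_le_mul_of_nonneg_left
            (pow_le_pow_left₀ (by positivity) (by linarith) d) (hC a)) (by positivity)
      _ = _ := by rw [← Finset.sum_mul]; ring
  · refine Filter.Eventually.of_forall fun y x _ => ?_
    have h1 : HasFDerivAt (fun x => ψ (x - y)) (fderiv ℝ ψ (x - y)) x := by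
      have := (hψd (x - y)).hasFDerivAt.comp x ((hasFDerivAt_id x).sub_const y)
      exact this
    exact h1.const_mul (g y)

lemma IsTempered.pd_smear (hg : IsTempered ρ g) (hψ : IsRapid ψ) (a : Coord N) :
    _root_.pd a (smear ρ g ψ) = smear ρ g (pd a ψ) := by
  funext z
  rw [(hg.hasFDerivAt_smear hψ z).pd_eq]
  simp [sum_apply, -Fintype.sum_sum_type]

lemma IsTempered.pds_smear (hg : IsTempered ρ g) (hψ : IsRapid ψ) (l : List (Coord N)) :
    _root_.pds l (smear ρ g ψ) = smear ρ g (pds l ψ) := by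
  induction l with
  | nil => rfl
  | cons a l ih => rw [pds_cons, ih, hg.pd_smear (hψ.pds l), pds_cons]

/-- The gradient consists of convolutions with derivatives of `ψ`, which are again rapidly
decreasing, so the induction must run over all `ψ` at once. -/
lemma IsTempered.contDiff_smear (hg : IsTempered ρ g) (hψ : IsRapid ψ) :
    ContDiff ℝ (⊤ : ℕ∞) (smear ρ g ψ) := by
  rw [contDiff_infty]
  intro n
  induction n generalizing ψ with
  | zero =>
    exact contDiff_zero.2 (continuous_iff_continuousAt.2 fun z =>
      (hg.hasFDerivAt_smear hψ z).continuousAt)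
  | succ n ih =>
    have hf : fderiv ℝ (smear ρ g ψ) = fun z => ∑ a, smear ρ g (pd a ψ) z • coordCLM a :=
      funext fun z => (hg.hasFDerivAt_smear hψ z).fderiv
    push_cast
    refine (contDiff_succ_iff_fderiv (n := (n : WithTop ℕ∞))).2
      ⟨fun z => (hg.hasFDerivAt_smear hψ z).differentiableAt, by simp, ?_⟩
    rw [hf]
    exact ContDiff.sum fun a _ => (ih (hψ.pd a)).smul contDiff_const

lemma IsTempered.isModerate_smear (hg : IsTempered ρ g) (hψ : IsRapid ψ) :
    IsModerate (smear ρ g ψ) := by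
  refine ⟨hg.contDiff_smear hψ, fun l => ?_⟩
  rw [hg.pds_smear hψ]
  exact hg.exists_bound_smear (hψ.pds l)

/-- Derivatives may be moved from the convolution kernel to the function. -/
lemma smear_pd_right {C : ℝ} {d : ℕ} (hg1 : ContDiff ℝ 1 g)
    (h0 : ∀ y, |g y| ≤ C * (1 + ‖y‖) ^ d) (a : Coord N)
    (h1 : ∀ y, |pd a g y| ≤ C * (1 + ‖y‖) ^ d) (hψ : IsRapid ψ) :
    smear volume g (pd a ψ) = smear volume (pd a g) ψ := by
  funext z
  have ht0 := isTempered_volume_of_bound hg1.continuous.aestronglyMeasurable h0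
  have ht1 := isTempered_volume_of_bound (continuous_pd hg1 a).aestronglyMeasurable h1
  have hψd : Differentiable ℝ ψ := hψ.1.differentiable (by simp)
  have hd (y : Phase N) : HasFDerivAt (fun y => ψ (z - y)) (-fderiv ℝ ψ (z - y)) y := by
    have := (hψd (z - y)).hasFDerivAt.comp y ((hasFDerivAt_id y).const_sub z)
    refine this.congr_fderiv ?_
    ext v; simp
  have hd' (y : Phase N) : fderiv ℝ (fun y => ψ (z - y)) y (EuclideanSpace.single a 1)
      = - pd a ψ (z - y) := by
    rw [(hd y).fderiv]; rfl
  have := integral_mul_fderiv_eq_neg_fderiv_mul_of_integrable (μ := volume)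
    (f := g) (g := fun y => ψ (z - y)) (v := EuclideanSpace.single a (1 : ℝ))
    (ht1.integrable_mul hψ z) ?_ (ht0.integrable_mul hψ z)
    (fun y _ => hg1.differentiable one_ne_zero y) fun y _ => (hd y).differentiableAt
  · simp only [hd', mul_neg, integral_neg, neg_inj] at this
    exact this
  · simp only [hd', mul_neg]
    exact (ht0.integrable_mul (hψ.pd a) z).neg

end Convolution

/-! ### The Gaussian kernel -/

section Kernel

variable {N : ℕ} {w : Coord N → ℝ}

/-- The normalization of the Gaussian kernel. -/
def gaussNorm (w : Coord N → ℝ) : ℝ := ∏ a, (√(2 * Real.pi) * w a)⁻¹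

lemma gaussNorm_pos (hw : ∀ a, 0 < w a) : 0 < gaussNorm w :=
  Finset.prod_pos fun a _ => by have := hw a; positivity

lemma husimiKernel_eq_prod (w : Coord N → ℝ) (y : Phase N) :
    husimiKernel w y
      = ∏ a, (√(2 * Real.pi) * w a)⁻¹ * Real.exp (-(1 / (2 * w a ^ 2)) * (y a) ^ 2) := by
  rw [husimiKernel, Fintype.prod_sum_type, ← Finset.prod_mul_distrib]
  refine Finset.prod_congr rfl fun i _ => ?_
  rw [mul_mul_mul_comm, ← Real.exp_add, ← mul_inv, mul_mul_mul_comm,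
    Real.mul_self_sqrt (by positivity), one_div, ← mul_assoc (2 * Real.pi)]
  congr 2
  ring

lemma husimiKernel_eq (w : Coord N → ℝ) (y : Phase N) :
    husimiKernel w y = gaussNorm w * Real.exp (-∑ a, (y a) ^ 2 / (2 * w a ^ 2)) := by
  rw [husimiKernel_eq_prod, Finset.prod_mul_distrib, gaussNorm, ← Real.exp_sum,
    ← Finset.sum_neg_distrib]
  congr 3
  funext a
  ring

lemma husimiKernel_pos (hw : ∀ a, 0 < w a) (y : Phase N) : 0 < husimiKernel w y := by
  rw [husimiKernel_eq]
  exact mul_pos (gaussNorm_pos hw) (Real.exp_pos _)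

lemma husimiKernel_neg (w : Coord N → ℝ) (y : Phase N) :
    husimiKernel w (-y) = husimiKernel w y := by
  simp [husimiKernel_eq, -Fintype.sum_sum_type]

lemma husimiKernel_sub_comm (w : Coord N → ℝ) (y z : Phase N) :
    husimiKernel w (z - y) = husimiKernel w (y - z) := by
  rw [← husimiKernel_neg, neg_sub]

lemma integral_husimiKernel (hw : ∀ a, 0 < w a) : ∫ y, husimiKernel w y = 1 := by
  have h := (EuclideanSpace.volume_preserving_symm_measurableEquiv_toLp (Coord N)).integral_comp
    (MeasurableEquiv.measurableEmbedding _) (fun y : Coord N → ℝ => ∏ a, (√(2 * Real.pi) * w a)⁻¹ *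
      Real.exp (-(1 / (2 * w a ^ 2)) * (y a) ^ 2))
  have h2 : (fun y : Phase N => husimiKernel w y) = fun y => (fun y : Coord N → ℝ =>
      ∏ a, (√(2 * Real.pi) * w a)⁻¹ * Real.exp (-(1 / (2 * w a ^ 2)) * (y a) ^ 2))
      ((MeasurableEquiv.toLp 2 (Coord N → ℝ)).symm y) := by
    funext y
    rw [husimiKernel_eq_prod]
    rfl
  rw [h2, h, integral_fintype_prod_volume_eq_prod
    (fun a (x : ℝ) => (√(2 * Real.pi) * w a)⁻¹ * Real.exp (-(1 / (2 * w a ^ 2)) * x ^ 2))]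
  refine Finset.prod_eq_one fun a _ => ?_
  have ha := hw a
  rw [integral_const_mul, integral_gaussian, div_div_eq_mul_div, div_one,
    show Real.pi * (2 * w a ^ 2) = (2 * Real.pi) * w a ^ 2 by ring,
    Real.sqrt_mul (by positivity) (w a ^ 2),
    Real.sqrt_sq ha.le]
  exact inv_mul_cancel₀ (by positivity)

lemma contDiff_husimiKernel (w : Coord N → ℝ) : ContDiff ℝ (⊤ : ℕ∞) (husimiKernel w) := by
  have : husimiKernel w = fun y => gaussNorm w *
      Real.exp (-∑ a, (coordCLM a y) ^ 2 / (2 * w a ^ 2)) :=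
    funext fun y => husimiKernel_eq w y
  rw [this]
  fun_prop

lemma pd_husimiKernel (w : Coord N → ℝ) (a : Coord N) (y : Phase N) :
    pd a (husimiKernel w) y = -(y a / w a ^ 2) * husimiKernel w y := by
  have h (b : Coord N) : HasFDerivAt (fun y : Phase N => (coordCLM b y) ^ 2 / (2 * w b ^ 2))
      ((y b / w b ^ 2) • coordCLM b) y := by
    have := ((coordCLM b).hasFDerivAt (x := y)).pow 2 |>.mul_const (2 * w b ^ 2)⁻¹
    refine this.congr_fderiv ?_
    ext v
    simp [div_eq_mul_inv, coordCLM]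
    ring
  have h2 := ((HasFDerivAt.fun_sum fun b (_ : b ∈ Finset.univ) => h b).neg.exp).const_mul
    (gaussNorm w)
  have : husimiKernel w = fun y => gaussNorm w *
      Real.exp (-∑ a, (coordCLM a y) ^ 2 / (2 * w a ^ 2)) :=
    funext fun y => husimiKernel_eq w y
  have h3 : HasFDerivAt (husimiKernel w) _ y := this ▸ h2
  have h4 : gaussNorm w * Real.exp (-∑ a, (coordCLM a y) ^ 2 / (2 * w a ^ 2)) = husimiKernel w y :=
    (husimiKernel_eq w y).symm
  rw [h3.pd_eq]
  simp only [smul_apply, neg_apply, sum_apply, smul_eq_mul, ← mul_assoc, Pi.neg_apply]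
  rw [h4, Finset.sum_eq_single a]
  · simp [coordCLM]; ring
  · intro b _ hb
    simp [coordCLM, hb]
  · simp

/-- The polynomial factor of the partial derivatives of the Gaussian kernel. -/
def kernelPoly (w : Coord N → ℝ) : List (Coord N) → Phase N → ℝ
  | [] => fun _ => 1
  | a :: l => fun y => pd a (kernelPoly w l) y - y a / w a ^ 2 * kernelPoly w l y

lemma hasTemperateGrowth_kernelPoly (w : Coord N → ℝ) (l : List (Coord N)) :
    (kernelPoly w l).HasTemperateGrowth := by
  induction l with
  | nil => exact Function.HasTemperateGrowth.const 1
  | cons a l ih =>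
    have h1 : (fun y : Phase N => y a / w a ^ 2).HasTemperateGrowth := by
      have := ((w a ^ 2)⁻¹ • coordCLM (N := N) a).hasTemperateGrowth
      convert this using 2 with y
      simp [coordCLM, div_eq_inv_mul]
    exact (hasTemperateGrowth_pd ih a).sub (h1.mul ih)

lemma pds_husimiKernel (w : Coord N → ℝ) (l : List (Coord N)) (y : Phase N) :
    pds l (husimiKernel w) y = kernelPoly w l y * husimiKernel w y := by
  induction l generalizing y with
  | nil => simp [pds, kernelPoly]
  | cons a l ih =>
    rw [pds_cons, show pds l (husimiKernel w) = fun y => kernelPoly w l y * husimiKernel w y from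
      funext ih, pd_mul, pd_husimiKernel, kernelPoly]
    · ring
    · exact ((hasTemperateGrowth_kernelPoly w l).1.differentiable (by simp)) y
    · exact ((contDiff_husimiKernel w).differentiable (by simp)) y

lemma exists_bound_pow_mul_husimiKernel (hw : ∀ a, 0 < w a) (d : ℕ) :
    ∃ C : ℝ, 0 ≤ C ∧ ∀ y : Phase N, (1 + ‖y‖) ^ d * husimiKernel w y ≤ C := by
  -- `W` bounds every width, so the kernel is at most a multiple of `exp(-‖y‖²/(2W²))`; the 1 keeps
  -- `W` positive even without coordinates.
  set W : ℝ := 1 + ∑ a, w a with hW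
  have hsum : 0 ≤ ∑ a, w a := Finset.sum_nonneg fun a _ => (hw a).le
  have hwW (a : Coord N) : w a ≤ W := by
    have := Finset.single_le_sum (f := w) (fun a _ => (hw a).le) (Finset.mem_univ a)
    linarith
  have hW0 : 0 < W := by linarith
  have hc := gaussNorm_pos hw
  refine ⟨gaussNorm w * (d.factorial * Real.exp (1 + W ^ 2 / 2)), by positivity, fun y => ?_⟩
  have h1 : (1 + ‖y‖) ^ d ≤ d.factorial * Real.exp (1 + ‖y‖) := by
    have := Real.pow_div_factorial_le_exp (1 + ‖y‖) (by positivity) d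
    rwa [div_le_iff₀' (by positivity)] at this
  have h2 : ‖y‖ ^ 2 / (2 * W ^ 2) ≤ ∑ a, (y a) ^ 2 / (2 * w a ^ 2) := by
    rw [EuclideanSpace.norm_sq_eq, Finset.sum_div]
    refine Finset.sum_le_sum fun a _ => ?_
    have := hw a
    rw [Real.norm_eq_abs, sq_abs]
    gcongr
    exact hwW a
  -- From `(‖y‖/W - W)² ≥ 0`: the Gaussian exponent beats the linear exponent that came from the
  -- power.
  have h3 : ‖y‖ ≤ ‖y‖ ^ 2 / (2 * W ^ 2) + W ^ 2 / 2 := by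
    have : 0 ≤ (‖y‖ / W - W) ^ 2 := sq_nonneg _
    have h : (‖y‖ / W - W) ^ 2 = 2 * (‖y‖ ^ 2 / (2 * W ^ 2) + W ^ 2 / 2 - ‖y‖) := by
      field_simp; ring
    linarith
  rw [husimiKernel_eq, mul_left_comm]
  refine mul_le_mul_of_nonneg_left ?_ hc.le
  calc (1 + ‖y‖) ^ d * Real.exp (-∑ a, (y a) ^ 2 / (2 * w a ^ 2))
      ≤ d.factorial * Real.exp (1 + ‖y‖) * Real.exp (-∑ a, (y a) ^ 2 / (2 * w a ^ 2)) := by gcongr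
    _ = d.factorial * Real.exp (1 + ‖y‖ - ∑ a, (y a) ^ 2 / (2 * w a ^ 2)) := by
        rw [mul_assoc, ← Real.exp_add]; rfl
    _ ≤ _ := by gcongr; linarith

lemma isRapid_mul_husimiKernel (hw : ∀ a, 0 < w a) {p : Phase N → ℝ} (hp : p.HasTemperateGrowth) :
    IsRapid fun y => p y * husimiKernel w y := by
  refine ⟨hp.1.mul (contDiff_husimiKernel w), fun l => ?_⟩
  -- Peeling off the innermost derivative turns `p` times the kernel into another temperate factor
  -- times the kernel, so the induction hypothesis applies to the new factor.
  induction l using List.reverseRecOn generalizing p with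
  | nil =>
    intro d
    obtain ⟨C, k, hC, h⟩ := hp.isModerate.exists_bound
    obtain ⟨C', hC', h'⟩ := exists_bound_pow_mul_husimiKernel hw (d + k)
    refine ⟨C * C', fun y => ?_⟩
    have := husimiKernel_pos hw y
    calc (1 + ‖y‖) ^ d * |p y * husimiKernel w y|
        = (1 + ‖y‖) ^ d * (|p y| * husimiKernel w y) := by rw [abs_mul, abs_of_pos this]
      _ ≤ (1 + ‖y‖) ^ d * (C * (1 + ‖y‖) ^ k * husimiKernel w y) := by gcongr; exact h y
      _ = C * ((1 + ‖y‖) ^ (d + k) * husimiKernel w y) := by rw [pow_add]; ring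
      _ ≤ _ := by gcongr; exact h' y
  | append_singleton l a ih =>
    have h1 : (fun y : Phase N => y a / w a ^ 2).HasTemperateGrowth := by
      have := ((w a ^ 2)⁻¹ • coordCLM (N := N) a).hasTemperateGrowth
      convert this using 2 with y
      simp [coordCLM, div_eq_inv_mul]
    have h2 : pd a (fun y => p y * husimiKernel w y)
        = fun y => (pd a p y - y a / w a ^ 2 * p y) * husimiKernel w y := by
      funext y
      rw [pd_mul, pd_husimiKernel]
      · ring
      · exact (hp.1.differentiable (by simp)) y
      · exact ((contDiff_husimiKernel w).differentiable (by simp)) y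
    rw [← pds_pd, h2]
    exact ih ((hasTemperateGrowth_pd hp a).sub (h1.mul hp))

lemma isRapid_husimiKernel (hw : ∀ a, 0 < w a) : IsRapid (husimiKernel w) := by
  simpa using isRapid_mul_husimiKernel hw (Function.HasTemperateGrowth.const (1 : ℝ))

/-- Completion of the square: convolving two Gaussians whose squared widths are complementary
fractions of `w²`. -/
lemma husimiKernel_mul_husimiKernel (hw : ∀ a, 0 < w a) {σ τ : ℝ} (hσ : 0 < σ) (hτ : 0 < τ)
    (hστ : σ + τ = 1) (x y : Phase N) :
    husimiKernel (fun a => √σ * w a) (x - y) * husimiKernel (fun a => √τ * w a) y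
      = husimiKernel w x * husimiKernel (fun a => √(σ * τ) * w a) (y - τ • x) := by
  simp only [husimiKernel_eq_prod, ← Finset.prod_mul_distrib]
  refine Finset.prod_congr rfl fun a _ => ?_
  have ha := hw a
  have hs : 0 < √σ := Real.sqrt_pos.2 hσ
  have ht : 0 < √τ := Real.sqrt_pos.2 hτ
  have hs2 : √σ ^ 2 = σ := Real.sq_sqrt hσ.le
  have ht2 : √τ ^ 2 = τ := Real.sq_sqrt hτ.le
  rw [mul_mul_mul_comm, mul_mul_mul_comm (√(2 * Real.pi) * w a)⁻¹, ← Real.exp_add, ← Real.exp_add,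
    Real.sqrt_mul hσ.le]
  congr 1
  · field_simp
  · congr 1
    simp only [mul_pow, hs2, ht2, PiLp.sub_apply, PiLp.smul_apply, smul_eq_mul]
    obtain rfl : σ = 1 - τ := by linarith
    field_simp
    ring

end Kernel

/-! ### Injectivity of the Husimi transform -/

section Injectivity

variable {N : ℕ} {w : Coord N → ℝ}

/-- Finite measures with equal finite exponential moments coincide. -/
lemma measure_ext_of_integral_exp {μ ν : Measure (Phase N)} [IsFiniteMeasure μ] [IsFiniteMeasure ν]
    (hμ : ∀ k : Phase N, Integrable (fun y => Real.exp (inner ℝ y k)) μ)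
    (h : ∀ k : Phase N, ∫ y, Real.exp (inner ℝ y k) ∂μ = ∫ y, Real.exp (inner ℝ y k) ∂ν) :
    μ = ν := by
  refine Measure.ext_of_charFun (funext fun k => ?_)
  have hexp (t : ℝ) (y : Phase N) : t * inner ℝ y k = inner ℝ y (t • k) := by
    rw [inner_smul_right]
  -- With all exponential moments finite, the complex moment generating function is entire; equality
  -- on the real axis extends to `i`, where it is the characteristic function.
  have hset : ProbabilityTheory.integrableExpSet (fun y : Phase N => inner ℝ y k) μ = univ := by
    refine eq_univ_of_forall fun t => ?_
    simp only [ProbabilityTheory.integrableExpSet, mem_ofPred_eq, hexp]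
    exact hμ _
  have hmgf : ProbabilityTheory.mgf (fun y : Phase N => inner ℝ y k) μ
      = ProbabilityTheory.mgf (fun y : Phase N => inner ℝ y k) ν := by
    funext t
    simp only [ProbabilityTheory.mgf, hexp]
    exact h _
  have hmass : μ.real univ = ν.real univ := by simpa using h 0
  have h0 : μ = 0 ↔ ν = 0 := by
    rw [← Measure.measure_univ_eq_zero, ← Measure.measure_univ_eq_zero,
      ← measureReal_eq_zero_iff, ← measureReal_eq_zero_iff, hmass]
  have hI := ProbabilityTheory.eqOn_complexMGF_of_mgf' hmgf h0
    (x := Complex.I) (by simp [hset])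
  simpa [ProbabilityTheory.complexMGF, charFun_apply, mul_comm] using hI

/-- A translated Gaussian is the centred one tilted by an exponential. Values of a Husimi transform
thereby become exponential moments. -/
lemma husimiKernel_sub_eq (w : Coord N → ℝ) (s y : Phase N) :
    husimiKernel w (s - y) = husimiKernel w y *
      Real.exp (∑ a, (y a * s a) / w a ^ 2) * Real.exp (-∑ a, (s a) ^ 2 / (2 * w a ^ 2)) := by
  rw [husimiKernel_eq, husimiKernel_eq, mul_assoc, mul_assoc, ← Real.exp_add, ← Real.exp_add,
    ← Finset.sum_neg_distrib, ← Finset.sum_neg_distrib, ← Finset.sum_neg_distrib,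
    ← Finset.sum_add_distrib, ← Finset.sum_add_distrib]
  congr 3
  funext a
  simp only [PiLp.sub_apply]
  ring

/-- Injectivity of the Husimi transform. The positive and negative parts of `f` times the centred
kernel are densities of finite measures with the same exponential moments, hence equal; the kernel
has no zeros. -/
lemma ae_eq_zero_of_integral_mul_husimiKernel (hw : ∀ a, 0 < w a) {f : Phase N → ℝ}
    (hf : ∀ z, Integrable fun y => f y * husimiKernel w (z - y))
    (h0 : ∀ z, ∫ y, f y * husimiKernel w (z - y) = 0) : f =ᵐ[volume] 0 := by
  set G : Phase N → ℝ := fun y => f y * husimiKernel w y with hG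
  -- Evaluation at the point with coordinates `w_a² k_a` produces the tilt `exp ⟨y, k⟩`; the
  -- constant is the inverse of the remaining Gaussian factor.
  have hGexp (k : Phase N) : ∃ c : ℝ, ∀ y, G y * Real.exp (inner ℝ y k) = c *
      (f y * husimiKernel w (WithLp.toLp 2 (fun a => w a ^ 2 * k a) - y)) := by
    refine ⟨Real.exp (∑ a, (w a ^ 2 * k a) ^ 2 / (2 * w a ^ 2)), fun y => ?_⟩
    have h1 : ∑ a, y a * (w a ^ 2 * k a) / w a ^ 2 = inner ℝ y k := by
      rw [PiLp.inner_apply]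
      refine Finset.sum_congr rfl fun a _ => ?_
      have := hw a
      simp
      field_simp
    rw [husimiKernel_sub_eq, hG, Real.exp_neg]
    simp only [h1]
    field_simp
  have hint (k : Phase N) : Integrable fun y => G y * Real.exp (inner ℝ y k) := by
    obtain ⟨c, hc⟩ := hGexp k
    simp only [hc]
    exact (hf _).const_mul c
  have hzero (k : Phase N) : ∫ y, G y * Real.exp (inner ℝ y k) = 0 := by
    obtain ⟨c, hc⟩ := hGexp k
    simp only [hc]
    rw [integral_const_mul, h0, mul_zero]
  have hGi : Integrable G := by simpa using hint 0
  have hm1 : AEMeasurable (fun y => ENNReal.ofReal (G y)) := hGi.1.aemeasurable.ennreal_ofReal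
  have hm2 : AEMeasurable (fun y => ENNReal.ofReal (-G y)) := hGi.neg.1.aemeasurable.ennreal_ofReal
  have hfin1 : IsFiniteMeasure (volume.withDensity fun y => ENNReal.ofReal (G y)) :=
    isFiniteMeasure_withDensity_ofReal hGi.2
  have hfin2 : IsFiniteMeasure (volume.withDensity fun y => ENNReal.ofReal (-G y)) :=
    isFiniteMeasure_withDensity_ofReal hGi.neg.2
  have hpos (k : Phase N) : Integrable fun y => max (G y) 0 * Real.exp (inner ℝ y k) := by
    have := (hint k).pos_part
    refine this.congr (Filter.Eventually.of_forall fun y => ?_)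
    dsimp only
    rw [max_mul_of_nonneg _ _ (Real.exp_pos _).le, zero_mul]
  have hneg (k : Phase N) : Integrable fun y => max (-G y) 0 * Real.exp (inner ℝ y k) := by
    have := (hint k).neg_part
    refine this.congr (Filter.Eventually.of_forall fun y => ?_)
    dsimp only
    rw [max_mul_of_nonneg _ _ (Real.exp_pos _).le, zero_mul, neg_mul]
  have heq := measure_ext_of_integral_exp
    (μ := volume.withDensity fun y => ENNReal.ofReal (G y))
    (ν := volume.withDensity fun y => ENNReal.ofReal (-G y)) ?_ ?_
  · rw [withDensity_eq_iff_of_sigmaFinite hm1 hm2] at heq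
    filter_upwards [heq] with y hy
    have hGy : G y = 0 := by
      rcases le_total (G y) 0 with h | h
      · rw [ENNReal.ofReal_of_nonpos h, eq_comm, ENNReal.ofReal_eq_zero] at hy
        linarith
      · rw [ENNReal.ofReal_of_nonpos (neg_nonpos.2 h), ENNReal.ofReal_eq_zero] at hy
        linarith
    exact (mul_eq_zero.1 hGy).resolve_right (husimiKernel_pos hw y).ne'
  · intro k
    rw [integrable_withDensity_iff_integrable_smul₀' hm1
      (Filter.Eventually.of_forall fun y => ENNReal.ofReal_lt_top)]
    simpa [ENNReal.toReal_ofReal'] using hpos k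
  · intro k
    rw [integral_withDensity_eq_integral_toReal_smul₀ hm1
      (Filter.Eventually.of_forall fun y => ENNReal.ofReal_lt_top),
      integral_withDensity_eq_integral_toReal_smul₀ hm2
      (Filter.Eventually.of_forall fun y => ENNReal.ofReal_lt_top)]
    simp only [ENNReal.toReal_ofReal', smul_eq_mul]
    rw [← sub_eq_zero, ← integral_sub (hpos k) (hneg k)]
    refine Eq.trans ?_ (hzero k)
    refine integral_congr_ae (Filter.Eventually.of_forall fun y => ?_)
    dsimp only
    rw [← sub_mul]
    congr 1
    rcases le_total (G y) 0 with h | h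
    · rw [max_eq_right h, max_eq_left (neg_nonneg.2 h)]; ring
    · rw [max_eq_left h, max_eq_right (neg_nonpos.2 h)]; ring

end Injectivity

/-! ### Parseval frames -/

section Frame

variable {X : Type*} [NormedAddCommGroup X] [InnerProductSpace ℝ X] {ι J : Type*}

/-- A family that satisfies the Parseval identity on a total set satisfies it everywhere. -/
lemma hasSum_inner_mul_inner_of_dense {φ : ι → X} {e : J → X}
    (hd : Dense (Submodule.span ℝ (range e) : Set X))
    (h : ∀ j j', HasSum (fun i => inner ℝ (φ i) (e j) * inner ℝ (φ i) (e j'))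
      (inner ℝ (e j) (e j'))) (x y : X) :
    HasSum (fun i => inner ℝ (φ i) x * inner ℝ (φ i) y) (inner ℝ x y) := by
  have hspan : ∀ x ∈ Submodule.span ℝ (range e), ∀ y ∈ Submodule.span ℝ (range e),
      HasSum (fun i => inner ℝ (φ i) x * inner ℝ (φ i) y) (inner ℝ x y) := by
    intro x hx y hy
    induction hx, hy using Submodule.span_induction₂ with
    | mem_mem x y hx hy =>
      obtain ⟨j, rfl⟩ := hx
      obtain ⟨j', rfl⟩ := hy
      exact h j j'
    | zero_left y hy => simp [hasSum_zero]
    | zero_right x hx => simp [hasSum_zero]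
    | add_left x y z hx hy hz h1 h2 =>
      simpa [inner_add_right, inner_add_left, add_mul] using h1.add h2
    | add_right x y z hx hy hz h1 h2 => simpa [inner_add_right, mul_add] using h1.add h2
    | smul_left r x y hx hy h1 =>
      simpa [inner_smul_right, inner_smul_left, mul_assoc] using h1.mul_left r
    | smul_right r x y hx hy h1 =>
      simpa [inner_smul_right, mul_left_comm] using h1.mul_left r
  -- Bessel's inequality for a finite partial sum is a closed condition, so it extends from the span
  -- to the whole space.
  have hbound (S : Finset ι) (x : X) : ∑ i ∈ S, ‖inner ℝ (φ i) x‖ ^ 2 ≤ ‖x‖ ^ 2 := by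
    have hcl : IsClosed {x : X | ∑ i ∈ S, ‖inner ℝ (φ i) x‖ ^ 2 ≤ ‖x‖ ^ 2} :=
      isClosed_le (by fun_prop) (by fun_prop)
    have hsub : closure (Submodule.span ℝ (range e) : Set X) ⊆
        {x : X | ∑ i ∈ S, ‖inner ℝ (φ i) x‖ ^ 2 ≤ ‖x‖ ^ 2} := by
      refine hcl.closure_subset_iff.2 fun x hx => ?_
      have hs := hspan x hx x hx
      rw [real_inner_self_eq_norm_sq] at hs
      have h1 : ∀ i, ‖inner ℝ (φ i) x‖ ^ 2 = inner ℝ (φ i) x * inner ℝ (φ i) x := fun i => by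
        rw [Real.norm_eq_abs, sq_abs, sq]
      simp only [mem_ofPred_eq, h1]
      exact sum_le_hasSum S (fun i _ => mul_self_nonneg _) hs
    exact hsub (hd x)
  have hmem (x : X) : Memℓp (fun i => inner ℝ (φ i) x) 2 :=
    memℓp_gen' (C := ‖x‖ ^ 2) fun S => by simpa using hbound S x
  -- The analysis operator into `ℓ²`, bounded by Bessel. Preservation of inner products on the span
  -- extends by continuity, one argument at a time.
  let T₀ : X →ₗ[ℝ] lp (fun _ : ι => ℝ) 2 :=
    { toFun := fun x => ⟨fun i => inner ℝ (φ i) x, hmem x⟩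
      map_add' := fun x y => by
        ext i
        exact inner_add_right _ _ _
      map_smul' := fun r x => by
        ext i
        exact inner_smul_right _ _ _ }
  have hT₀ (x : X) : ‖T₀ x‖ ≤ 1 * ‖x‖ := by
    rw [one_mul]
    refine lp.norm_le_of_forall_sum_le (by norm_num) (norm_nonneg x) fun S => ?_
    simpa [T₀] using hbound S x
  let T : X →L[ℝ] lp (fun _ : ι => ℝ) 2 := T₀.mkContinuous 1 hT₀
  have hT (x y : X) :
      HasSum (fun i => inner ℝ (φ i) x * inner ℝ (φ i) y) (inner ℝ (T x) (T y)) := by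
    refine (lp.hasSum_inner (𝕜 := ℝ) (T x) (T y)).congr_fun ?_
    intro i
    simp [T, T₀, mul_comm]
  have h1 : ∀ y ∈ Submodule.span ℝ (range e), ∀ x, inner ℝ (T x) (T y) = inner ℝ x y := by
    intro y hy
    refine congrFun (Continuous.ext_on hd (by fun_prop) (by fun_prop) fun x hx => ?_)
    exact (hT x y).unique (hspan x hx y hy)
  have h2 : (fun y => inner ℝ (T x) (T y)) = fun y => inner ℝ x y :=
    Continuous.ext_on hd (by fun_prop) (by fun_prop) fun y hy => h1 y hy x
  rw [← congrFun h2 y]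
  exact hT x y

end Frame

/-! ### The Parseval identity for Hermite polynomials -/

section Parseval

variable {N : ℕ} {w : Coord N → ℝ}

lemma isTempered_kernelPoly (w : Coord N → ℝ) (l : List (Coord N)) :
    IsTempered volume (kernelPoly w l) :=
  (hasTemperateGrowth_kernelPoly w l).isModerate.isTempered

/-- Hermite polynomials against a translated Gaussian give monomials in the translation: integrating
by parts cancels the derivative, and each letter of the word contributes one linear factor. -/
lemma integral_kernelPoly (hw : ∀ a, 0 < w a) (l : List (Coord N)) (s : Phase N) :
    ∫ y, kernelPoly w l y * husimiKernel w (s - y) = (l.map fun a => -(s a / w a ^ 2)).prod := by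
  have hκ := isRapid_husimiKernel hw
  induction l with
  | nil =>
    simp only [kernelPoly, one_mul, List.map_nil, List.prod_nil]
    rw [integral_sub_left_eq_self (husimiKernel w) volume s]
    exact integral_husimiKernel hw
  | cons a l ih =>
    have hp := (hasTemperateGrowth_kernelPoly w l).isModerate
    obtain ⟨C, d, hC, h0⟩ := hp.exists_bound
    obtain ⟨C', d', hC', h1⟩ := (hp.pd a).exists_bound
    have hparts := congrFun (smear_pd_right (g := kernelPoly w l) (C := C + C') (d := d + d')
      (hp.1.of_le (by exact_mod_cast le_top))
      (fun y => (h0 y).trans ?_) a (fun y => (h1 y).trans ?_) hκ) s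
    · have hI1 := (isTempered_kernelPoly w l).integrable_mul (hκ.pd a) s
      have hI2 := (isTempered_kernelPoly w l).integrable_mul hκ s
      have hI3 := (hp.pd a).isTempered.integrable_mul hκ s
      -- With `y_a = s_a - (s - y)_a`, the second part is recognised as a derivative of the kernel,
      -- ready for cancellation by `hparts`.
      have hpt : (fun y => kernelPoly w (a :: l) y * husimiKernel w (s - y))
          = fun y => pd a (kernelPoly w l) y * husimiKernel w (s - y)
            - kernelPoly w l y * pd a (husimiKernel w) (s - y)
            - s a / w a ^ 2 * (kernelPoly w l y * husimiKernel w (s - y)) := by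
        funext y
        rw [pd_husimiKernel, kernelPoly, PiLp.sub_apply]
        ring
      rw [hpt, integral_sub (show Integrable (fun y =>
        pd a (kernelPoly w l) y * husimiKernel w (s - y)
          - kernelPoly w l y * pd a (husimiKernel w) (s - y)) volume from hI3.sub hI1)
        (hI2.const_mul (s a / w a ^ 2)), integral_sub hI3 hI1,
        integral_const_mul, ih]
      simp only [smear] at hparts
      rw [hparts, sub_self, List.map_cons, List.prod_cons]
      ring
    · rw [pow_add]
      have : (1 : ℝ) ≤ (1 + ‖y‖) ^ d' := one_le_pow₀ (by linarith [norm_nonneg y])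
      have h2 : 0 ≤ (1 + ‖y‖) ^ d := by positivity
      nlinarith [mul_nonneg hC h2, mul_nonneg hC' h2,
        mul_nonneg (mul_nonneg hC' h2) (sub_nonneg.2 this),
        mul_nonneg (mul_nonneg hC h2) (sub_nonneg.2 this)]
    · rw [pow_add]
      have : (1 : ℝ) ≤ (1 + ‖y‖) ^ d := one_le_pow₀ (by linarith [norm_nonneg y])
      have h2 : 0 ≤ (1 + ‖y‖) ^ d' := by positivity
      nlinarith [mul_nonneg hC h2, mul_nonneg hC' h2,
        mul_nonneg (mul_nonneg hC' h2) (sub_nonneg.2 this),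
        mul_nonneg (mul_nonneg hC h2) (sub_nonneg.2 this)]

/-- The probability measure with the Gaussian kernel as density. -/
def gaussMeasure (w : Coord N → ℝ) : Measure (Phase N) :=
  volume.withDensity fun y => ENNReal.ofReal (husimiKernel w y)

lemma measurable_ofReal_husimiKernel (w : Coord N → ℝ) :
    Measurable fun y => ENNReal.ofReal (husimiKernel w y) :=
  ((contDiff_husimiKernel w).continuous.measurable).ennreal_ofReal

lemma integral_gaussMeasure (hw : ∀ a, 0 < w a) (g : Phase N → ℝ) :
    ∫ y, g y ∂(gaussMeasure w) = ∫ y, g y * husimiKernel w y := by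
  rw [gaussMeasure, integral_withDensity_eq_integral_toReal_smul (measurable_ofReal_husimiKernel w)
    (Filter.Eventually.of_forall fun _ => ENNReal.ofReal_lt_top)]
  refine integral_congr_ae (Filter.Eventually.of_forall fun y => ?_)
  simp [ENNReal.toReal_ofReal (husimiKernel_pos hw y).le, mul_comm]

lemma integrable_gaussMeasure_iff (hw : ∀ a, 0 < w a) {g : Phase N → ℝ} :
    Integrable g (gaussMeasure w) ↔ Integrable fun y => g y * husimiKernel w y := by
  rw [gaussMeasure, integrable_withDensity_iff_integrable_smul' (measurable_ofReal_husimiKernel w)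
    (Filter.Eventually.of_forall fun _ => ENNReal.ofReal_lt_top)]
  refine integrable_congr (Filter.Eventually.of_forall fun y => ?_)
  simp [ENNReal.toReal_ofReal (husimiKernel_pos hw y).le, mul_comm]

lemma memLp_gaussMeasure (hw : ∀ a, 0 < w a) {F : Phase N → ℝ} (hF : AEStronglyMeasurable F)
    (hF2 : Integrable fun y => F y ^ 2 * husimiKernel w y) : MemLp F 2 (gaussMeasure w) :=
  (memLp_two_iff_integrable_sq (hF.mono_ac (withDensity_absolutelyContinuous _ _))).2
    ((integrable_gaussMeasure_iff hw).2 hF2)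

lemma inner_toLp_gaussMeasure (hw : ∀ a, 0 < w a) {F G : Phase N → ℝ}
    (hF : MemLp F 2 (gaussMeasure w)) (hG : MemLp G 2 (gaussMeasure w)) :
    inner ℝ (hF.toLp F) (hG.toLp G) = ∫ y, F y * G y * husimiKernel w y := by
  rw [L2.inner_def, ← integral_gaussMeasure hw]
  refine integral_congr_ae ?_
  filter_upwards [hF.coeFn_toLp, hG.coeFn_toLp] with y h1 h2
  simp [h1, h2, mul_comm]

/-- The density of a translated Gaussian relative to the centered one. -/
def kernelRatio (w : Coord N → ℝ) (s y : Phase N) : ℝ := husimiKernel w (s - y) / husimiKernel w y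

lemma kernelRatio_mul (hw : ∀ a, 0 < w a) (s y : Phase N) :
    kernelRatio w s y * husimiKernel w y = husimiKernel w (s - y) :=
  div_mul_cancel₀ _ (husimiKernel_pos hw y).ne'

/-- Exponents of tilts add. Once integrated, the inner product of two tilts is `exp(∑ s s' / w²)`,
the exponential kernel that the Hermite expansion must reproduce. -/
lemma kernelRatio_mul_kernelRatio (hw : ∀ a, 0 < w a) (s s' y : Phase N) :
    kernelRatio w s y * kernelRatio w s' y * husimiKernel w y
      = Real.exp (∑ a, s a * s' a / w a ^ 2) * husimiKernel w (s + s' - y) := by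
  have hy := (husimiKernel_pos hw y).ne'
  have h (u : Phase N) : kernelRatio w u y
      = Real.exp (∑ a, (y a * u a) / w a ^ 2 - ∑ a, (u a) ^ 2 / (2 * w a ^ 2)) := by
    rw [kernelRatio, husimiKernel_sub_eq, Real.exp_sub, Real.exp_neg]
    field_simp
  rw [h, h, husimiKernel_sub_eq w (s + s'), ← Real.exp_add, mul_assoc (husimiKernel w y),
    ← Real.exp_add, mul_left_comm, ← Real.exp_add, mul_comm]
  congr 2
  simp only [← Finset.sum_neg_distrib, ← Finset.sum_sub_distrib, ← Finset.sum_add_distrib]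
  refine Finset.sum_congr rfl fun a _ => ?_
  have := (hw a).ne'
  simp only [PiLp.add_apply]
  field_simp
  ring

lemma continuous_kernelRatio (hw : ∀ a, 0 < w a) (s : Phase N) : Continuous (kernelRatio w s) :=
  ((contDiff_husimiKernel w).continuous.comp (by fun_prop)).div
    (contDiff_husimiKernel w).continuous fun y => (husimiKernel_pos hw y).ne'

lemma integrable_husimiKernel_sub (hw : ∀ a, 0 < w a) (z : Phase N) :
    Integrable fun y => husimiKernel w (z - y) := by
  simpa using (isTempered_volume_of_bound (g := fun _ : Phase N => (1 : ℝ)) (C := 1) (d := 0)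
    aestronglyMeasurable_const (by simp)).integrable_mul (isRapid_husimiKernel hw) z

lemma memLp_kernelRatio (hw : ∀ a, 0 < w a) (s : Phase N) :
    MemLp (kernelRatio w s) 2 (gaussMeasure w) := by
  refine memLp_gaussMeasure hw (continuous_kernelRatio hw s).aestronglyMeasurable ?_
  simp only [sq, kernelRatio_mul_kernelRatio hw]
  exact (integrable_husimiKernel_sub hw _).const_mul _

lemma integrable_mul_husimiKernel (hw : ∀ a, 0 < w a) {g : Phase N → ℝ} (hg : IsTempered volume g) :
    Integrable fun y => g y * husimiKernel w y := by
  simpa [husimiKernel_neg] using hg.integrable_mul (isRapid_husimiKernel hw) 0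

lemma memLp_kernelPoly (hw : ∀ a, 0 < w a) (l : List (Coord N)) :
    MemLp (kernelPoly w l) 2 (gaussMeasure w) := by
  have h := hasTemperateGrowth_kernelPoly w l
  refine memLp_gaussMeasure hw h.1.continuous.aestronglyMeasurable ?_
  simp only [sq]
  exact integrable_mul_husimiKernel hw (h.mul h).isModerate.isTempered

/-- A vector orthogonal to all tilts has vanishing Husimi transform, so injectivity makes it zero.
-/
lemma dense_span_kernelRatio (hw : ∀ a, 0 < w a) :
    Dense (Submodule.span ℝ (range fun s : Phase N => (memLp_kernelRatio hw s).toLp) :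
      Set (Lp ℝ 2 (gaussMeasure w))) := by
  rw [Submodule.dense_iff_topologicalClosure_eq_top,
    Submodule.topologicalClosure_eq_top_iff, Submodule.eq_bot_iff]
  intro X hX
  rw [Submodule.mem_orthogonal] at hX
  have hX' : MemLp X 2 (gaussMeasure w) := Lp.memLp X
  have hX0 (s : Phase N) := hX _ (Submodule.subset_span (mem_range_self s))
  have hXeq : hX'.toLp X = X := Lp.toLp_coeFn X hX'
  have hker (s y : Phase N) : kernelRatio w s y * X y * husimiKernel w y
      = X y * husimiKernel w (s - y) := by
    rw [mul_right_comm, kernelRatio_mul hw, mul_comm]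
  have hae : (X : Phase N → ℝ) =ᵐ[volume] 0 := by
    refine ae_eq_zero_of_integral_mul_husimiKernel hw (fun s => ?_) fun s => ?_
    · have := (integrable_gaussMeasure_iff hw).1 ((memLp_kernelRatio hw s).integrable_mul hX')
      simpa only [Pi.mul_apply, hker] using this
    · have := hX0 s
      rw [← hXeq] at this
      rw [inner_toLp_gaussMeasure hw] at this
      simpa only [hker] using this
  refine Lp.eq_zero_iff_ae_eq_zero.2 ?_
  exact (withDensity_absolutelyContinuous volume _).ae_le hae

/-- The `k`-th power of the sum is expanded over ordered words of length `k`. Words instead of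
multi-indices avoid multinomial coefficients and match the iteration of `G`. -/
lemma hasSum_sigma_prod (x : Coord N → ℝ) :
    HasSum (fun c : Σ k, Fin k → Coord N => 1 / (c.1.factorial : ℝ) * ∏ i, x (c.2 i))
      (Real.exp (∑ a, x a)) := by
  have hfib (x : Coord N → ℝ) (k : ℕ) :
      HasSum (fun c : Fin k → Coord N => 1 / (k.factorial : ℝ) * ∏ i, x (c i))
        ((∑ a, x a) ^ k / k.factorial) := by
    have := hasSum_fintype fun c : Fin k → Coord N => 1 / (k.factorial : ℝ) * ∏ i, x (c i)
    rwa [← Finset.mul_sum, ← Fintype.sum_pow, one_div_mul_eq_div] at this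
  have hexp (r : ℝ) : HasSum (fun k : ℕ => r ^ k / k.factorial) (Real.exp r) := by
    rw [Real.exp_eq_exp_ℝ]
    exact NormedSpace.exp_series_hasSum_exp' r |>.congr_fun fun k => by
      rw [smul_eq_mul, div_eq_inv_mul]
  refine HasSum.sigma_of_hasSum (hexp _) (fun k => hfib x k) ?_
  refine Summable.of_norm ?_
  have hn : (fun c : Σ k, Fin k → Coord N => ‖1 / (c.1.factorial : ℝ) * ∏ i, x (c.2 i)‖)
      = fun c => 1 / (c.1.factorial : ℝ) * ∏ i, |x (c.2 i)| := by
    funext c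
    rw [norm_mul, Real.norm_of_nonneg (by positivity), norm_prod]
    rfl
  rw [hn, summable_sigma_of_nonneg fun c => by positivity]
  refine ⟨fun k => (hfib (fun a => |x a|) k).summable, ?_⟩
  simp only [fun k => (hfib (fun a => |x a|) k).tsum_eq]
  exact (hexp _).summable

/-- Scaled Hermite polynomials indexed by words form a Parseval frame; it is redundant, since
permuted words repeat a polynomial. The identity is checked on tilts, where both sides are the
exponential of `∑ s s' / w²`, and tilts are total. -/
lemma hasSum_integral_mul_kernelPoly (hw : ∀ a, 0 < w a) {F G : Phase N → ℝ}
    (hF : AEStronglyMeasurable F) (hF2 : Integrable fun y => F y ^ 2 * husimiKernel w y)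
    (hG : AEStronglyMeasurable G) (hG2 : Integrable fun y => G y ^ 2 * husimiKernel w y) :
    HasSum (fun c : Σ k, Fin k → Coord N => 1 / (c.1.factorial : ℝ) * (∏ i, w (c.2 i) ^ 2) *
        ((∫ y, F y * pds (List.ofFn c.2) (husimiKernel w) y) *
          ∫ y, G y * pds (List.ofFn c.2) (husimiKernel w) y))
      (∫ y, F y * G y * husimiKernel w y) := by
  have hFm := memLp_gaussMeasure hw hF hF2
  have hGm := memLp_gaussMeasure hw hG hG2
  -- The square root distributes the coefficient of the expansion evenly over the two factors of the
  -- frame.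
  let coef (c : Σ k, Fin k → Coord N) : ℝ := √(1 / (c.1.factorial : ℝ) * ∏ i, w (c.2 i) ^ 2)
  have hcoef (c : Σ k, Fin k → Coord N) :
      coef c * coef c = 1 / (c.1.factorial : ℝ) * ∏ i, w (c.2 i) ^ 2 :=
    Real.mul_self_sqrt (mul_nonneg (by positivity) (Finset.prod_nonneg fun i _ => sq_nonneg _))
  have key := hasSum_inner_mul_inner_of_dense
    (φ := fun c : Σ k, Fin k → Coord N => coef c • (memLp_kernelPoly hw (List.ofFn c.2)).toLp)
    (dense_span_kernelRatio hw) ?_ (hFm.toLp F) (hGm.toLp G)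
  · rw [inner_toLp_gaussMeasure hw] at key
    refine key.congr_fun fun c => ?_
    rw [inner_smul_left, inner_smul_left, inner_toLp_gaussMeasure hw, inner_toLp_gaussMeasure hw,
      ← hcoef]
    simp only [pds_husimiKernel, conj_trivial, mul_left_comm (F _), mul_left_comm (G _), mul_assoc]
    ring
  · intro s s'
    have hval (c : Σ k, Fin k → Coord N) (s : Phase N) :
        inner ℝ ((memLp_kernelPoly hw (List.ofFn c.2)).toLp) ((memLp_kernelRatio hw s).toLp)
          = ∏ i, -(s (c.2 i) / w (c.2 i) ^ 2) := by
      rw [inner_toLp_gaussMeasure hw]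
      simp only [mul_assoc, kernelRatio_mul hw]
      rw [integral_kernelPoly hw, List.map_ofFn, List.prod_ofFn]
      rfl
    rw [inner_toLp_gaussMeasure hw]
    simp only [kernelRatio_mul_kernelRatio hw]
    rw [integral_const_mul, integral_sub_left_eq_self (husimiKernel w) volume,
      integral_husimiKernel hw, mul_one]
    refine (hasSum_sigma_prod fun a => s a * s' a / w a ^ 2).congr_fun fun c => ?_
    rw [inner_smul_left, inner_smul_left, hval, hval, conj_trivial, mul_mul_mul_comm, hcoef,
      ← Finset.prod_mul_distrib, mul_assoc, ← Finset.prod_mul_distrib]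
    congr 1
    refine Finset.prod_congr rfl fun i _ => ?_
    have := (hw (c.2 i)).ne'
    field_simp

end Parseval

/-! ### The Husimi transform of products -/

section GaussianProduct

variable {N : ℕ} {w : Coord N → ℝ}

lemma IsTempered.of_le {ρ : Measure (Phase N)} {g : Phase N → ℝ} {d d' : ℕ} (hdd : d ≤ d')
    (h : Integrable (fun y => ((1 + ‖y‖) ^ d)⁻¹ * g y) ρ) :
    Integrable (fun y => ((1 + ‖y‖) ^ d')⁻¹ * g y) ρ := by
  have hg : AEStronglyMeasurable g ρ := IsTempered.aestronglyMeasurable ⟨d, h⟩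
  refine h.mono (AEStronglyMeasurable.mul (Continuous.aestronglyMeasurable
    (Continuous.inv₀ (by fun_prop) fun y => by positivity)) hg)
    (Filter.Eventually.of_forall fun y => ?_)
  rw [norm_mul, norm_mul]
  refine mul_le_mul_of_nonneg_right ?_ (norm_nonneg _)
  rw [norm_inv, norm_inv, Real.norm_of_nonneg (by positivity), Real.norm_of_nonneg (by positivity)]
  exact inv_anti₀ (by positivity) (pow_le_pow_right₀ (by linarith [norm_nonneg y]) hdd)

lemma IsTempered.add {ρ : Measure (Phase N)} {f g : Phase N → ℝ} (hf : IsTempered ρ f)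
    (hg : IsTempered ρ g) : IsTempered ρ fun y => f y + g y := by
  obtain ⟨d, hd⟩ := hf
  obtain ⟨d', hd'⟩ := hg
  refine ⟨d + d', ((IsTempered.of_le (Nat.le_add_right d d') hd).add
    (IsTempered.of_le (Nat.le_add_left d' d) hd')).congr (Filter.Eventually.of_forall fun y => ?_)⟩
  simp only [Pi.add_apply]
  ring

lemma IsTempered.const_mul {ρ : Measure (Phase N)} {f : Phase N → ℝ} (hf : IsTempered ρ f)
    (c : ℝ) : IsTempered ρ fun y => c * f y := by
  obtain ⟨d, hd⟩ := hf
  exact ⟨d, (hd.const_mul c).congr (Filter.Eventually.of_forall fun y => by ring)⟩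

lemma IsTempered.sub {ρ : Measure (Phase N)} {f g : Phase N → ℝ} (hf : IsTempered ρ f)
    (hg : IsTempered ρ g) : IsTempered ρ fun y => f y - g y := by
  simpa [sub_eq_add_neg] using hf.add (hg.const_mul (-1))

lemma IsTempered.sum {ρ : Measure (Phase N)} {J : Type*} (s : Finset J) {f : J → Phase N → ℝ}
    (hf : ∀ j, IsTempered ρ (f j)) : IsTempered ρ fun y => ∑ j ∈ s, f j y := by
  classical
  induction s using Finset.induction_on with
  | empty => exact ⟨0, by simp⟩
  | insert j s hj ih => simpa [Finset.sum_insert hj] using (hf j).add ih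

lemma IsModerate.exists_bound_mul {f g : Phase N → ℝ} (hf : IsModerate f) (hg : IsModerate g) :
    ∃ (C : ℝ) (d : ℕ), ∀ y, |f y * g y| ≤ C * (1 + ‖y‖) ^ d := by
  obtain ⟨C, d, hC, h⟩ := hf.exists_bound
  obtain ⟨C', d', hC', h'⟩ := hg.exists_bound
  refine ⟨C * C', d + d', fun y => ?_⟩
  rw [abs_mul, pow_add, mul_mul_mul_comm]
  exact mul_le_mul (h y) (h' y) (abs_nonneg _) (by positivity)

lemma IsModerate.isTempered_mul {f g : Phase N → ℝ} (hf : IsModerate f) (hg : IsModerate g) :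
    IsTempered volume fun y => f y * g y := by
  obtain ⟨C, d, h⟩ := hf.exists_bound_mul hg
  exact isTempered_volume_of_bound (hf.1.continuous.mul hg.1.continuous).aestronglyMeasurable h

lemma husimi_eq_smear (w : Coord N → ℝ) (f : Phase N → ℝ) :
    husimi w f = smear volume f (husimiKernel w) := rfl

lemma IsModerate.husimi (hw : ∀ a, 0 < w a) {f : Phase N → ℝ} (hf : IsModerate f) :
    IsModerate (husimi w f) :=
  hf.isTempered.isModerate_smear (isRapid_husimiKernel hw)

lemma pd_husimi (hw : ∀ a, 0 < w a) {f : Phase N → ℝ} (hf : IsModerate f) (a : Coord N) :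
    pd a (husimi w f) = husimi w (pd a f) := by
  obtain ⟨C, d, hC, h⟩ := hf.exists_bound
  obtain ⟨C', d', hC', h'⟩ := (hf.pd a).exists_bound
  have hmono (y : Phase N) : (1 + ‖y‖) ^ d ≤ (1 + ‖y‖) ^ (d + d') ∧
      (1 + ‖y‖) ^ d' ≤ (1 + ‖y‖) ^ (d + d') :=
    ⟨pow_le_pow_right₀ (by linarith [norm_nonneg y]) (Nat.le_add_right _ _),
      pow_le_pow_right₀ (by linarith [norm_nonneg y]) (Nat.le_add_left _ _)⟩
  rw [husimi_eq_smear, hf.isTempered.pd_smear (isRapid_husimiKernel hw)]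
  refine smear_pd_right (C := C + C') (d := d + d') (hf.1.of_le (by exact_mod_cast le_top))
    (fun y => (h y).trans ?_) a (fun y => (h' y).trans ?_) (isRapid_husimiKernel hw)
  · exact mul_le_mul (by linarith) (hmono y).1 (by positivity) (by positivity)
  · exact mul_le_mul (by linarith) (hmono y).2 (by positivity) (by positivity)

/-- `Gᵏ` as a sum over words. The new letter goes to the end of the word because a step of `G`
differentiates the functions first. -/
lemma lamGauss_zero_eq_sum (w : Coord N → ℝ) (k : ℕ) (f g : Phase N → ℝ) (y z : Phase N) :
    lamGauss w 0 k f g y z = ∑ c : Fin k → Coord N, (∏ i, w (c i) ^ 2) *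
      (pds (List.ofFn c) f y * pds (List.ofFn c) g z) := by
  induction k generalizing f g with
  | zero => simp [lamGauss, bidiffOne, pds]
  | succ k ih =>
    rw [lamGauss_zero_succ, ← (Fin.snocEquiv fun _ => Coord N).sum_comp, Fintype.sum_prod_type]
    refine Finset.sum_congr rfl fun a _ => ?_
    rw [ih, Finset.mul_sum]
    refine Finset.sum_congr rfl fun c _ => ?_
    simp only [Fin.snocEquiv_apply, Fin.prod_univ_castSucc, Fin.snoc_castSucc, Fin.snoc_last,
      List.ofFn_succ', List.concat_eq_append, pds_pd]
    ring

/-- Differentiating under the convolution puts the derivatives on the kernel. The derivatives of the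
Husimi symbol at `z` are thus the Hermite coefficients of `f(z - ·)`. -/
lemma integral_sub_left_mul_pds {f : Phase N → ℝ} (hw : ∀ a, 0 < w a) (hf : IsModerate f)
    (l : List (Coord N)) (z : Phase N) :
    ∫ y, f (z - y) * pds l (husimiKernel w) y = pds l (husimi w f) z := by
  rw [husimi_eq_smear, hf.isTempered.pds_smear (isRapid_husimiKernel hw), smear,
    ← integral_sub_left_eq_self (fun y => f y * pds l (husimiKernel w) (z - y)) volume z]
  simp only [sub_sub_cancel]

lemma integrable_sub_left_sq_mul_husimiKernel (hw : ∀ a, 0 < w a) {f : Phase N → ℝ}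
    (hf : IsModerate f) (z : Phase N) : Integrable fun y => f (z - y) ^ 2 * husimiKernel w y := by
  have := (hf.isTempered_mul hf).integrable_mul (isRapid_husimiKernel hw) z
  simpa [sq] using this.comp_sub_left z

/-- The Husimi scalar product of two Husimi symbols is the Husimi symbol of the product. -/
lemma hasSum_lamGauss_zero_husimi (hw : ∀ a, 0 < w a) {f g : Phase N → ℝ} (hf : IsModerate f)
    (hg : IsModerate g) (z : Phase N) :
    HasSum (fun k : ℕ => 1 / (k.factorial : ℝ) * lamGauss w 0 k (husimi w f) (husimi w g) z z)
      (husimi w (fun y => f y * g y) z) := by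
  have key := hasSum_integral_mul_kernelPoly hw
    (F := fun y => f (z - y)) (G := fun y => g (z - y))
    (hf.1.continuous.comp (by fun_prop)).aestronglyMeasurable
    (integrable_sub_left_sq_mul_husimiKernel hw hf z)
    (hg.1.continuous.comp (by fun_prop)).aestronglyMeasurable
    (integrable_sub_left_sq_mul_husimiKernel hw hg z)
  have hsum := key.sigma fun k => hasSum_fintype _
  have hval : ∫ y, f (z - y) * g (z - y) * husimiKernel w y = husimi w (fun y => f y * g y) z := by
    rw [husimi, ← integral_sub_left_eq_self _ volume z]
    simp only [sub_sub_cancel]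
  rw [hval] at hsum
  refine hsum.congr_fun fun k => ?_
  rw [lamGauss_zero_eq_sum, Finset.mul_sum]
  refine Finset.sum_congr rfl fun c _ => ?_
  rw [integral_sub_left_mul_pds hw hf, integral_sub_left_mul_pds hw hg]
  ring

/-- The terms `f Λⁿ g` of the Moyal product. -/
def lamDiag (n : ℕ) (f g : Phase N → ℝ) (x : Phase N) : ℝ := lamStep^[n] bidiffOne f g x x

lemma lamDiag_succ (n : ℕ) (f g : Phase N → ℝ) (x : Phase N) :
    lamDiag (n + 1) f g x = ∑ i : Fin N, (lamDiag n (pd (Sum.inr i) f) (pd (Sum.inl i) g) x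
      - lamDiag n (pd (Sum.inl i) f) (pd (Sum.inr i) g) x) := by
  unfold lamDiag
  rw [iterate_succ_apply']
  rfl

lemma continuous_lamDiag (n : ℕ) {f g : Phase N → ℝ} (hf : ContDiff ℝ (⊤ : ℕ∞) f)
    (hg : ContDiff ℝ (⊤ : ℕ∞) g) : Continuous (lamDiag n f g) :=
  ((IsBidiff.lamGauss (fun _ => 0) n 0).contDiff hf hg).continuous.comp
    (continuous_id.prodMk continuous_id)

lemma isTempered_lamDiag (n : ℕ) {f g : Phase N → ℝ} (hf : IsModerate f) (hg : IsModerate g) :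
    IsTempered volume (lamDiag n f g) := by
  induction n generalizing f g with
  | zero => exact hf.isTempered_mul hg
  | succ n ih =>
    rw [show lamDiag (n + 1) f g = _ from funext (lamDiag_succ n f g)]
    exact IsTempered.sum _ fun i => (ih (hf.pd _) (hg.pd _)).sub (ih (hf.pd _) (hg.pd _))

/-- The Husimi transform commutes with derivatives, so each further `Λ` acts on the symbols before
or after the transform alike. -/
lemma hasSum_lamGauss_husimi (hw : ∀ a, 0 < w a) (n : ℕ) {f g : Phase N → ℝ} (hf : IsModerate f)
    (hg : IsModerate g) (z : Phase N) :
    HasSum (fun k : ℕ => 1 / (k.factorial : ℝ) * lamGauss w n k (husimi w f) (husimi w g) z z)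
      (husimi w (lamDiag n f g) z) := by
  induction n generalizing f g with
  | zero => exact hasSum_lamGauss_zero_husimi hw hf hg z
  | succ n ih =>
    have hκ := isRapid_husimiKernel hw
    have hI (a b : Coord N) := (isTempered_lamDiag n (hf.pd a) (hg.pd b)).integrable_mul hκ z
    have hval : husimi w (lamDiag (n + 1) f g) z
        = ∑ i : Fin N, (husimi w (lamDiag n (pd (Sum.inr i) f) (pd (Sum.inl i) g)) z
          - husimi w (lamDiag n (pd (Sum.inl i) f) (pd (Sum.inr i) g)) z) := by
      simp only [husimi, lamDiag_succ, Finset.sum_mul, sub_mul]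
      rw [integral_finsetSum]
      · exact Finset.sum_congr rfl fun i _ => integral_sub (hI _ _) (hI _ _)
      · exact fun i _ => (hI _ _).sub (hI _ _)
    rw [hval]
    refine (hasSum_sum fun i _ => (ih (hf.pd (Sum.inr i)) (hg.pd (Sum.inl i))).sub
      (ih (hf.pd (Sum.inl i)) (hg.pd (Sum.inr i)))).congr_fun fun k => ?_
    simp only [lamGauss_succ, pd_husimi hw hf, pd_husimi hw hg, Finset.mul_sum, mul_sub]

lemma lamExpGauss_husimi (hw : ∀ a, 0 < w a) (n : ℕ) {f g : Phase N → ℝ} (hf : IsModerate f)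
    (hg : IsModerate g) (z : Phase N) :
    lamExpGauss w n (husimi w f) (husimi w g) z z = husimi w (lamDiag n f g) z :=
  (hasSum_lamGauss_husimi hw n hf hg z).tsum_eq

end GaussianProduct

/-! ### The Liouville equation and its Husimi form -/

section Liouville

variable {N : ℕ} {m : Mechanics} {ħ : ℝ} {w : Coord N → ℝ} {I : Set ℝ}
  {H : Phase N → ℝ} {P : ℝ → Phase N → ℝ}

/-- The bracket `f Λ sinc(ħΛ/2) g` of quantum mechanics, `f Λ g` in classical mechanics. -/
def bracket (m : Mechanics) (ħ : ℝ) (f g : Phase N → ℝ) (z : Phase N) : ℝ :=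
  ∑' j, sincCoeff m ħ j * lamDiag (2 * j + 1) f g z

lemma lamDiag_swap (n : ℕ) (f g : Phase N → ℝ) (z : Phase N) :
    lamDiag n g f z = (-1) ^ n * lamDiag n f g z :=
  lamGauss_swap (fun _ => 0) n 0 f g z z

namespace IsRegularDistribution

lemma isRapid (hP : IsRegularDistribution m ħ I H P) {t : ℝ} (ht : t ∈ I) : IsRapid (P t) :=
  ⟨hP.smooth t ht, fun l d => (hP.decay l d).imp fun _ h z => h t ht z⟩

/-- The coefficient of `sinc` at `j` is dominated by the weight at `2j`. The convergence assumption
is therefore applied to `Λ²ʲ` of the first derivatives, which assemble to `Λ²ʲ⁺¹`. -/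
lemma exists_bound_lamDiag (hP : IsRegularDistribution m ħ I H P) (hħ : 0 < ħ) :
    ∃ (b : ℕ → ℝ) (d : ℕ), Summable b ∧ ∀ t ∈ I, ∀ z, ∀ j : ℕ,
      |sincCoeff m ħ j * lamDiag (2 * j + 1) H (P t) z| ≤ b j * (1 + ‖z‖) ^ d := by
  choose b d hb hle using fun p : Coord N × Coord N => hP.convergent [p.1] [p.2]
  set D := ∑ p, d p with hD
  have hdD (p : Coord N × Coord N) : d p ≤ D :=
    Finset.single_le_sum (f := d) (fun _ _ => Nat.zero_le _) (Finset.mem_univ p)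
  have hterm (p : Coord N × Coord N) (t : ℝ) (ht : t ∈ I) (z : Phase N) (j : ℕ) :
      |sincCoeff m ħ j| * |lamDiag (2 * j) (pd p.1 H) (pd p.2 (P t)) z|
        ≤ |b p (2 * j)| * (1 + ‖z‖) ^ D := by
    calc _ ≤ lamCoeff m ħ (2 * j) * |lamDiag (2 * j) (pd p.1 H) (pd p.2 (P t)) z| :=
          mul_le_mul_of_nonneg_right (abs_sincCoeff_le m hħ j) (abs_nonneg _)
      _ ≤ b p (2 * j) * (1 + ‖z‖) ^ d p := hle p t ht z (2 * j)
      _ ≤ |b p (2 * j)| * (1 + ‖z‖) ^ d p :=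
          mul_le_mul_of_nonneg_right (le_abs_self _) (by positivity)
      _ ≤ _ := mul_le_mul_of_nonneg_left
          (pow_le_pow_right₀ (by linarith [norm_nonneg z]) (hdD p)) (abs_nonneg _)
  refine ⟨fun j => ∑ i : Fin N, (|b (Sum.inr i, Sum.inl i) (2 * j)|
    + |b (Sum.inl i, Sum.inr i) (2 * j)|), D, ?_, fun t ht z j => ?_⟩
  · have hs (p : Coord N × Coord N) : Summable fun j : ℕ => |b p (2 * j)| :=
      ((hb p).comp_injective (i := fun j : ℕ => 2 * j) fun _ _ h => by simpa using h).abs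
    exact summable_sum fun i _ => (hs _).add (hs _)
  · rw [lamDiag_succ, Finset.mul_sum, Finset.sum_mul]
    refine (Finset.abs_sum_le_sum_abs _ _).trans (Finset.sum_le_sum fun i _ => ?_)
    rw [mul_sub, add_mul]
    refine (abs_sub _ _).trans (add_le_add ?_ ?_)
    · rw [abs_mul]; exact hterm (Sum.inr i, Sum.inl i) t ht z j
    · rw [abs_mul]; exact hterm (Sum.inl i, Sum.inr i) t ht z j

lemma liouvilleEq_iff (hP : IsRegularDistribution m ħ I H P) (hħ : 0 < ħ) :
    LiouvilleEq m ħ I H P ↔ ∀ t ∈ I, ∀ z, HasDerivWithinAt (fun τ => P τ z)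
      (bracket m ħ H (P t) z) I t := by
  cases m
  · refine forall₂_congr fun t ht => forall_congr' fun z => ?_
    rw [← hasDerivWithinAt_ofReal_iff]
    obtain ⟨b, d, hb, hle⟩ := hP.convergent [] []
    have hs : Summable fun n : ℕ => (ħ / 2) ^ n / (n.factorial : ℝ) * |lamDiag n H (P t) z| :=
      Summable.of_nonneg_of_le (fun n => by positivity) (fun n => hle t ht z n)
        (hb.mul_right ((1 + ‖z‖) ^ d))
    have := commutator_exp_series hħ (fun n => lamDiag n H (P t) z) hs
    simp only [← lamDiag_swap] at this
    simp only [moyal]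
    change HasDerivWithinAt _ (-(Complex.I / (ħ : ℂ)) *
      ((∑' n : ℕ, (Complex.I * (ħ : ℂ) / 2) ^ n / (n.factorial : ℂ) *
          ((lamDiag n H (P t) z : ℝ) : ℂ)) -
        ∑' n : ℕ, (Complex.I * (ħ : ℂ) / 2) ^ n / (n.factorial : ℂ) *
          ((lamDiag n (P t) H z : ℝ) : ℂ))) I t ↔ _
    rw [this]
    rfl
  · refine forall₂_congr fun t ht => forall_congr' fun z => ?_
    have : bracket Mechanics.classical ħ H (P t) z = poisson H (P t) z := by
      rw [bracket, tsum_eq_single 0]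
      · simp [sincCoeff, lamDiag, poisson]
      · intro j hj; simp [sincCoeff, hj]
    rw [this]

lemma continuous_bracket (hP : IsRegularDistribution m ħ I H P) (hħ : 0 < ħ)
    (hH : IsModerate H) {t : ℝ} (ht : t ∈ I) : Continuous (bracket m ħ H (P t)) := by
  obtain ⟨b, d, hb, hle⟩ := hP.exists_bound_lamDiag hħ
  refine continuous_iff_continuousAt.2 fun z => ?_
  have hc : ContinuousOn (bracket m ħ H (P t)) (Metric.ball z 1) := by
    refine continuousOn_tsum (u := fun j => |b j| * (2 + ‖z‖) ^ d) (fun j => ?_)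
      (hb.abs.mul_right _) fun j y hy => ?_
    · exact ((continuous_lamDiag _ hH.1 (hP.smooth t ht)).const_mul _).continuousOn
    · have hy' : 1 + ‖y‖ ≤ 2 + ‖z‖ := by
        have h1 : ‖y - z‖ < 1 := by simpa [dist_eq_norm] using hy
        have h2 : ‖y‖ ≤ ‖y - z‖ + ‖z‖ := by simpa using norm_add_le (y - z) z
        linarith
      calc _ ≤ b j * (1 + ‖y‖) ^ d := hle t ht y j
        _ ≤ |b j| * (1 + ‖y‖) ^ d := mul_le_mul_of_nonneg_right (le_abs_self _) (by positivity)
        _ ≤ _ := mul_le_mul_of_nonneg_left (pow_le_pow_left₀ (by positivity) hy' d) (abs_nonneg _)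
  exact hc.continuousAt (Metric.ball_mem_nhds z one_pos)

lemma isTempered_bracket (hP : IsRegularDistribution m ħ I H P) (hħ : 0 < ħ)
    (hH : IsModerate H) {t : ℝ} (ht : t ∈ I) : IsTempered volume (bracket m ħ H (P t)) := by
  obtain ⟨b, d, hb, hle⟩ := hP.exists_bound_lamDiag hħ
  refine isTempered_volume_of_bound (C := ∑' j, b j) (d := d)
    (hP.continuous_bracket hħ hH ht).aestronglyMeasurable fun z => ?_
  rw [← Real.norm_eq_abs, ← tsum_mul_right]
  exact tsum_of_norm_bounded (hb.mul_right _).hasSum fun j => hle t ht z j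

/-- The polynomial majorant is integrable against the Gaussian, so sum and integral may be
exchanged, and the product formula applies term by term. -/
lemma husimi_bracket (hP : IsRegularDistribution m ħ I H P) (hħ : 0 < ħ) (hw : ∀ a, 0 < w a)
    (hH : IsModerate H) {t : ℝ} (ht : t ∈ I) (z : Phase N) :
    husimi w (bracket m ħ H (P t)) z
      = ∑' j, sincCoeff m ħ j * lamExpGauss w (2 * j + 1) (husimi w H) (husimi w (P t)) z z := by
  obtain ⟨b, d, hb, hle⟩ := hP.exists_bound_lamDiag hħ
  have hκ := isRapid_husimiKernel hw
  have hPm := (hP.isRapid ht).isModerate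
  have hI (j : ℕ) : Integrable fun y =>
      sincCoeff m ħ j * lamDiag (2 * j + 1) H (P t) y * husimiKernel w (z - y) :=
    ((isTempered_lamDiag _ hH hPm).const_mul _).integrable_mul hκ z
  have hbd : Integrable fun y : Phase N => (1 + ‖y‖) ^ d * husimiKernel w (z - y) := by
    refine (isTempered_volume_of_bound (C := 1) (d := d) (Continuous.aestronglyMeasurable
      (by fun_prop)) fun y => ?_).integrable_mul hκ z
    rw [one_mul, abs_of_nonneg (by positivity)]
  have hnorm : Summable fun j => ∫ y,
      ‖sincCoeff m ħ j * lamDiag (2 * j + 1) H (P t) y * husimiKernel w (z - y)‖ := by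
    refine Summable.of_nonneg_of_le (fun j => integral_nonneg fun y => norm_nonneg _) (fun j => ?_)
      (hb.mul_right (∫ y : Phase N, (1 + ‖y‖) ^ d * husimiKernel w (z - y)))
    rw [← integral_const_mul]
    refine integral_mono (hI j).norm (hbd.const_mul _) fun y => ?_
    dsimp only
    rw [norm_mul, ← mul_assoc, Real.norm_of_nonneg (husimiKernel_pos hw _).le]
    exact mul_le_mul_of_nonneg_right (hle t ht y j) (husimiKernel_pos hw _).le
  have key := hasSum_integral_of_summable_integral_norm hI hnorm
  simp only [tsum_mul_right] at key
  rw [show husimi w (bracket m ħ H (P t)) z = _ from key.tsum_eq.symm]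
  refine tsum_congr fun j => ?_
  rw [lamExpGauss_husimi hw _ hH hPm, husimi, ← integral_const_mul]
  exact integral_congr_ae (Filter.Eventually.of_forall fun y => by ring)

lemma isTempered_derivWithin {ti tf : ℝ} (htt : ti < tf)
    (hP : IsRegularDistribution m ħ (Icc ti tf) H P) {t : ℝ} (ht : t ∈ Icc ti tf) :
    IsTempered volume fun z => derivWithin (fun τ => P τ z) (Icc ti tf) t := by
  obtain ⟨C, d, h⟩ := hP.growth_deriv
  exact isTempered_volume_of_bound
    ((continuousOn_derivWithin_time htt hP.contDiffOn).slice ht).aestronglyMeasurable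
    fun z => h t ht z

lemma hasDerivWithinAt_husimi {ti tf : ℝ}
    (hP : IsRegularDistribution m ħ (Icc ti tf) H P) (hw : ∀ a, 0 < w a)
    {t : ℝ} (ht : t ∈ Icc ti tf) (z : Phase N) :
    HasDerivWithinAt (fun τ => husimi w (P τ) z)
      (husimi w (fun z => derivWithin (fun τ => P τ z) (Icc ti tf) t) z) (Icc ti tf) t := by
  obtain ⟨C, d, h⟩ := hP.growth_deriv
  have hκ := isRapid_husimiKernel hw
  have hbd : Integrable fun y : Phase N => C * (1 + ‖y‖) ^ d * husimiKernel w (z - y) := by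
    refine (isTempered_volume_of_bound (C := |C|) (d := d) (Continuous.aestronglyMeasurable
      (by fun_prop)) fun y => ?_).integrable_mul hκ z
    rw [abs_mul, abs_of_nonneg (by positivity : 0 ≤ (1 + ‖y‖) ^ d)]
  refine hasDerivWithinAt_integral_of_dominated (convex_Icc ti tf)
    (F := fun τ y => P τ y * husimiKernel w (z - y))
    (F' := fun τ y => derivWithin (fun τ => P τ y) (Icc ti tf) τ * husimiKernel w (z - y)) ht
    (fun τ hτ => ((hP.isRapid hτ).isModerate.isTempered.integrable_mul hκ z).1)
    ((hP.isRapid ht).isModerate.isTempered.integrable_mul hκ z)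
    (Filter.Eventually.of_forall fun y τ hτ => ?_) hbd
    (Filter.Eventually.of_forall fun y τ hτ =>
      (derivWithin_time_hasDerivWithinAt hP.contDiffOn hτ y).mul_const _)
  rw [norm_mul, Real.norm_of_nonneg (husimiKernel_pos hw _).le]
  exact mul_le_mul_of_nonneg_right (h τ hτ y) (husimiKernel_pos hw _).le

/-- The inverse Husimi transform turns the Husimi form of the Liouville equation into the
Liouville equation. -/
theorem husimiLiouville_iff_liouvilleEq {ti tf : ℝ} (htt : ti < tf) (hħ : 0 < ħ)
    (hw : ∀ a, 0 < w a) (hH : IsModerate H) {Q : ℝ → Phase N → ℝ}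
    (hc : NormallyConvergent m ħ w (Icc ti tf) (husimi w H) Q)
    (hP : IsRegularDistribution m ħ (Icc ti tf) H P)
    (hQ : ∀ t ∈ Icc ti tf, Q t = husimi w (P t)) :
    HusimiLiouville m ħ w (Icc ti tf) (husimi w H) Q ↔ LiouvilleEq m ħ (Icc ti tf) H P := by
  rw [husimiLiouville_iff hc hħ, hP.liouvilleEq_iff hħ]
  refine forall₂_congr fun t ht => ?_
  have hud := uniqueDiffOn_Icc htt t ht
  have hκ := isRapid_husimiKernel hw
  have hQd (z : Phase N) : HasDerivWithinAt (fun τ => Q τ z)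
      (husimi w (fun z => derivWithin (fun τ => P τ z) (Icc ti tf) t) z) (Icc ti tf) t :=
    (hP.hasDerivWithinAt_husimi hw ht z).congr (fun τ hτ => by rw [hQ τ hτ]) (by rw [hQ t ht])
  have hPd (z : Phase N) := derivWithin_time_hasDerivWithinAt hP.contDiffOn ht z
  have hbr (z : Phase N) : lamStep (genApply m ħ w) (husimi w H) (Q t) z z
      = husimi w (bracket m ħ H (P t)) z := by
    rw [hc.lamStep_genApply hħ ht, hP.husimi_bracket hħ hw hH ht, hQ t ht]
  have hl : (∀ z, HasDerivWithinAt (fun τ => Q τ z)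
      (lamStep (genApply m ħ w) (husimi w H) (Q t) z z) (Icc ti tf) t) ↔
      ∀ z, husimi w (fun z => derivWithin (fun τ => P τ z) (Icc ti tf) t) z
        = husimi w (bracket m ħ H (P t)) z := by
    refine forall_congr' fun z => ⟨fun h => ?_, fun h => ?_⟩
    · rw [← hbr]; exact hud.eq_deriv _ (hQd z) h
    · rw [hbr, ← h]; exact hQd z
  have hr : (∀ z, HasDerivWithinAt (fun τ => P τ z) (bracket m ħ H (P t) z) (Icc ti tf) t) ↔
      ∀ z, derivWithin (fun τ => P τ z) (Icc ti tf) t = bracket m ħ H (P t) z :=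
    forall_congr' fun z => ⟨fun h => h.derivWithin hud, fun h => h ▸ hPd z⟩
  rw [hl, hr]
  have hT1 := hP.isTempered_derivWithin htt ht
  have hT2 := hP.isTempered_bracket hħ hH ht
  refine ⟨fun h => ?_, fun h z => by rw [show (fun z => derivWithin (fun τ => P τ z) (Icc ti tf) t)
    = bracket m ħ H (P t) from funext h]⟩
  -- Injectivity yields equality almost everywhere; continuity of both sides in `z` makes it hold
  -- everywhere.
  have hae := ae_eq_zero_of_integral_mul_husimiKernel hw
    (f := fun z => derivWithin (fun τ => P τ z) (Icc ti tf) t - bracket m ħ H (P t) z)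
    (fun z => (hT1.sub hT2).integrable_mul hκ z) fun z => by
      simp only [sub_mul]
      rw [integral_sub (hT1.integrable_mul hκ z) (hT2.integrable_mul hκ z), sub_eq_zero]
      exact h z
  have hcont : Continuous fun z => derivWithin (fun τ => P τ z) (Icc ti tf) t
      - bracket m ħ H (P t) z :=
    ((continuousOn_derivWithin_time htt hP.contDiffOn).slice ht).sub
      (hP.continuous_bracket hħ hH ht)
  have := (hcont.ae_eq_iff_eq volume continuous_zero).1 hae
  exact fun z => sub_eq_zero.1 (congrFun this z)

end IsRegularDistribution

end Liouville

/-! ### The Husimi transform of measures -/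

section MeasureTransform

variable {N : ℕ} {w : Coord N → ℝ}

lemma isTempered_of_bound {ρ : Measure (Phase N)} [IsFiniteMeasure ρ] {g : Phase N → ℝ}
    (hg : AEStronglyMeasurable g ρ) {C : ℝ} {d : ℕ} (h : ∀ y, |g y| ≤ C * (1 + ‖y‖) ^ d) :
    IsTempered ρ g := by
  refine ⟨d, (integrable_const C).mono' (AEStronglyMeasurable.mul (Continuous.aestronglyMeasurable
    (Continuous.inv₀ (by fun_prop) fun y => by positivity)) hg)
    (Filter.Eventually.of_forall fun y => ?_)⟩
  rw [norm_mul, norm_inv, Real.norm_of_nonneg (by positivity), Real.norm_eq_abs,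
    inv_mul_le_iff₀ (by positivity), mul_comm]
  exact h y

lemma husimi_one (hw : ∀ a, 0 < w a) (z : Phase N) : husimi w (fun _ => 1) z = 1 := by
  simp only [husimi, one_mul]
  rw [integral_sub_left_eq_self (husimiKernel w) volume z, integral_husimiKernel hw]

/-- A Gaussian average against a Gaussian mixture. -/
lemma husimi_mul_smear (hw : ∀ a, 0 < w a) {σ τ : ℝ} (hσ : 0 < σ) (hτ : 0 < τ) (hστ : σ + τ = 1)
    {ρ : Measure (Phase N)} [SFinite ρ] {F g : Phase N → ℝ} (hF : Continuous F) {C : ℝ} {d : ℕ}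
    (hFb : ∀ x, |F x| ≤ C * (1 + ‖x‖) ^ d) (hg : IsTempered ρ g) (z : Phase N) :
    husimi (fun a => √σ * w a) (fun x => F x * smear ρ g (husimiKernel fun a => √τ * w a) x) z
      = ∫ u, g u * husimiKernel w (z - u) *
          husimi (fun a => √(σ * τ) * w a) F (u + τ • (z - u)) ∂ρ := by
  have hwσ : ∀ a, 0 < √σ * w a := fun a => mul_pos (Real.sqrt_pos.2 hσ) (hw a)
  have hwτ : ∀ a, 0 < √τ * w a := fun a => mul_pos (Real.sqrt_pos.2 hτ) (hw a)
  have hκσ := isRapid_husimiKernel hwσ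
  have hκτ := isRapid_husimiKernel hwτ
  have hgm := hg.aestronglyMeasurable
  obtain ⟨e, he⟩ := hg
  obtain ⟨C', hC', h'⟩ := hκτ.abs_sub_le e
  have hFe : Integrable fun x =>
      F x * (1 + ‖x‖) ^ e * husimiKernel (fun a => √σ * w a) (z - x) := by
    refine (isTempered_volume_of_bound (C := C) (d := d + e) (Continuous.aestronglyMeasurable
      (by fun_prop)) fun x => ?_).integrable_mul hκσ z
    rw [abs_mul, abs_of_nonneg (by positivity : 0 ≤ (1 + ‖x‖) ^ e), pow_add, ← mul_assoc]
    exact mul_le_mul_of_nonneg_right (hFb x) (by positivity)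
  -- For Fubini, the decay of the inner kernel pays for the weight of `g`, at the cost of a power of
  -- `1 + ‖x‖` that the outer kernel absorbs.
  have hint : Integrable (uncurry fun x u => F x *
      (g u * husimiKernel (fun a => √τ * w a) (x - u)) * husimiKernel (fun a => √σ * w a) (z - x))
      (volume.prod ρ) := by
    refine ((hFe.norm.const_mul C').mul_prod he.norm).mono' ?_
      (Filter.Eventually.of_forall fun p => ?_)
    · refine AEStronglyMeasurable.mul (AEStronglyMeasurable.mul
        (hF.comp continuous_fst).aestronglyMeasurable (AEStronglyMeasurable.mul hgm.comp_snd
        (hκτ.1.continuous.comp (by fun_prop)).aestronglyMeasurable))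
        (hκσ.1.continuous.comp (by fun_prop)).aestronglyMeasurable
    · obtain ⟨x, u⟩ := p
      have hx : 0 ≤ (1 + ‖x‖) ^ e := by positivity
      have hu : 0 ≤ (1 + ‖u‖) ^ e := by positivity
      simp only [uncurry_apply_pair, norm_mul, norm_inv, Real.norm_of_nonneg hx,
        Real.norm_of_nonneg hu]
      calc ‖F x‖ * (‖g u‖ * ‖husimiKernel (fun a => √τ * w a) (x - u)‖)
            * ‖husimiKernel (fun a => √σ * w a) (z - x)‖
          ≤ ‖F x‖ * (‖g u‖ * (C' * (1 + ‖x‖) ^ e * ((1 + ‖u‖) ^ e)⁻¹))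
            * ‖husimiKernel (fun a => √σ * w a) (z - x)‖ := by
            gcongr; exact h' x u
        _ = _ := by ring
  calc husimi (fun a => √σ * w a) (fun x => F x * smear ρ g (husimiKernel fun a => √τ * w a) x) z
      = ∫ x, ∫ u, F x * (g u * husimiKernel (fun a => √τ * w a) (x - u))
          * husimiKernel (fun a => √σ * w a) (z - x) ∂ρ := by
        refine integral_congr_ae (Filter.Eventually.of_forall fun x => ?_)
        dsimp only
        rw [integral_mul_const, integral_const_mul, smear]
    _ = ∫ u, (∫ x, F x * (g u * husimiKernel (fun a => √τ * w a) (x - u))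
          * husimiKernel (fun a => √σ * w a) (z - x)) ∂ρ := integral_integral_swap hint
    _ = _ := by
        refine integral_congr_ae (Filter.Eventually.of_forall fun u => ?_)
        dsimp only
        rw [husimi, ← integral_const_mul]
        refine integral_congr_ae (Filter.Eventually.of_forall fun x => ?_)
        -- Completing the square leaves a kernel in `z - u` times a Gaussian in `x` centred at `u +
        -- τ (z - u)`, which averages `F`.
        have := husimiKernel_mul_husimiKernel hw hσ hτ hστ (z - u) (x - u)
        rw [sub_sub_sub_cancel_right, sub_sub, husimiKernel_sub_comm _ (u + τ • (z - u))] at this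
        dsimp only
        rw [mul_assoc (F x), mul_assoc (g u), mul_comm (husimiKernel (fun a => √τ * w a) (x - u)),
          this]
        ring

/-- The case `F = 1` of `husimi_mul_smear`: splitting the squared widths into fractions `σ` and `τ`
splits the Gaussian convolution. -/
lemma smear_husimiKernel_eq_husimi_smear (hw : ∀ a, 0 < w a) {σ τ : ℝ} (hσ : 0 < σ) (hτ : 0 < τ)
    (hστ : σ + τ = 1) {ρ : Measure (Phase N)} [SFinite ρ] {g : Phase N → ℝ} (hg : IsTempered ρ g)
    (z : Phase N) :
    smear ρ g (husimiKernel w) z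
      = husimi (fun a => √σ * w a) (smear ρ g (husimiKernel fun a => √τ * w a)) z := by
  have hwστ : ∀ a, 0 < √(σ * τ) * w a := fun a => mul_pos (Real.sqrt_pos.2 (mul_pos hσ hτ)) (hw a)
  have := husimi_mul_smear hw hσ hτ hστ (F := fun _ => 1) (C := 1) (d := 0) continuous_const
    (by simp) hg z
  simp only [one_mul, husimi_one hwστ, mul_one] at this
  rw [this, smear]

lemma husimi_husimi (hw : ∀ a, 0 < w a) {s t : ℝ} (hs : 0 < s) (ht : 0 < t) {f : Phase N → ℝ}
    (hf : IsTempered volume f) (z : Phase N) :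
    husimi (fun a => √s * w a) (husimi (fun a => √t * w a) f) z
      = husimi (fun a => √(s + t) * w a) f z := by
  have hst : 0 < s + t := add_pos hs ht
  have key := smear_husimiKernel_eq_husimi_smear (w := fun a => √(s + t) * w a)
    (fun a => mul_pos (Real.sqrt_pos.2 hst) (hw a)) (div_pos hs hst) (div_pos ht hst)
    (by field_simp) hf z
  have hr (r : ℝ) (hr : 0 < r) (a : Coord N) : √(r / (s + t)) * (√(s + t) * w a) = √r * w a := by
    rw [← mul_assoc, ← Real.sqrt_mul (by positivity), div_mul_cancel₀ _ hst.ne']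
  simp only [hr s hs, hr t ht] at key
  exact key.symm

/-- Rescaling moves the width into the argument of `f`, so that a shrinking width can be studied
against one fixed Gaussian. -/
lemma husimi_smul_width (hw : ∀ a, 0 < w a) {ε : ℝ} (hε : 0 < ε) (f : Phase N → ℝ) (c : Phase N) :
    husimi (fun a => ε * w a) f c = ∫ y, f (c - ε • y) * husimiKernel w y := by
  have hker (y : Phase N) : husimiKernel w y
      = ε ^ (Fintype.card (Coord N)) * husimiKernel (fun a => ε * w a) (ε • y) := by
    rw [husimiKernel_eq, husimiKernel_eq, gaussNorm, gaussNorm, ← mul_assoc, Fintype.card,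
      ← Finset.prod_const, ← Finset.prod_mul_distrib]
    congr 1
    · refine Finset.prod_congr rfl fun a _ => ?_
      have := (hw a).ne'
      field_simp
    · congr 2
      refine Finset.sum_congr rfl fun a _ => ?_
      have := (hw a).ne'
      simp only [PiLp.smul_apply, smul_eq_mul]
      field_simp
  have h1 := Measure.integral_comp_smul (volume : Measure (Phase N))
    (fun y => f (c - y) * husimiKernel (fun a => ε * w a) y) ε
  rw [finrank_euclideanSpace, abs_inv, abs_of_pos (by positivity), smul_eq_mul] at h1
  have h2 : ∫ y, f (c - ε • y) * husimiKernel w y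
      = ε ^ (Fintype.card (Coord N)) *
        ∫ y, f (c - ε • y) * husimiKernel (fun a => ε * w a) (ε • y) := by
    rw [← integral_const_mul]
    refine integral_congr_ae (Filter.Eventually.of_forall fun y => ?_)
    dsimp only
    rw [hker y]
    ring
  rw [h2, h1, mul_inv_cancel_left₀ (by positivity), husimi, ← integral_sub_left_eq_self _ volume c]
  simp only [sub_sub_cancel]

/-- Scaling the widths by `√σ` multiplies `G` by `σ`: Abel means of the series in `k` are the same
series with smaller widths. -/
lemma lamGauss_zero_sqrt_mul (w : Coord N → ℝ) {σ : ℝ} (hσ : 0 ≤ σ) (k : ℕ) (f g : Phase N → ℝ)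
    (y z : Phase N) :
    lamGauss (fun a => √σ * w a) 0 k f g y z = σ ^ k * lamGauss w 0 k f g y z := by
  simp only [lamGauss_zero_eq_sum, mul_pow, Real.sq_sqrt hσ, Finset.prod_mul_distrib,
    Finset.prod_const, Finset.card_univ, Fintype.card_fin, Finset.mul_sum, mul_assoc]

/-- The Abel means of the Husimi scalar product of a symbol and the Husimi transform of a
measure. -/
lemma tsum_pow_mul_lamGauss_zero (hw : ∀ a, 0 < w a) {σ : ℝ} (hσ : 0 < σ) (hσ1 : σ < 1)
    {μ : Measure (Phase N)} [IsFiniteMeasure μ] {f : Phase N → ℝ} (hf : IsModerate f)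
    (z : Phase N) :
    ∑' k : ℕ, 1 / (k.factorial : ℝ) * (σ ^ k *
        lamGauss w 0 k (husimi w f) (smear μ (fun _ => 1) (husimiKernel w)) z z)
      = ∫ u, husimiKernel w (z - u) * (∫ y, f (u + (1 - σ) • (z - u) -
          √(σ * (1 - σ) + (1 - σ)) • y) * husimiKernel w y) ∂μ := by
  have hτ : 0 < 1 - σ := by linarith
  have hwσ : ∀ a, 0 < √σ * w a := fun a => mul_pos (Real.sqrt_pos.2 hσ) (hw a)
  have hwτ : ∀ a, 0 < √(1 - σ) * w a := fun a => mul_pos (Real.sqrt_pos.2 hτ) (hw a)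
  have h1 : IsTempered μ fun _ => 1 :=
    isTempered_of_bound (C := 1) (d := 0) aestronglyMeasurable_const (by simp)
  have hf' := IsModerate.husimi hwτ hf
  have hμ' := h1.isModerate_smear (isRapid_husimiKernel hwτ)
  have key := (hasSum_lamGauss_zero_husimi hwσ hf' hμ' z).tsum_eq
  -- Both symbols are Husimi transforms with the smaller width of presmoothed functions, to which
  -- the product formula for functions applies.
  have e1 : husimi (fun a => √σ * w a) (husimi (fun a => √(1 - σ) * w a) f) = husimi w f :=
    funext fun x => (smear_husimiKernel_eq_husimi_smear hw hσ hτ (by ring) hf.isTempered x).symm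
  have e2 : husimi (fun a => √σ * w a) (smear μ (fun _ => 1) (husimiKernel fun a => √(1 - σ) * w a))
      = smear μ (fun _ => 1) (husimiKernel w) :=
    funext fun x => (smear_husimiKernel_eq_husimi_smear hw hσ hτ (by ring) h1 x).symm
  obtain ⟨C, d, -, hb⟩ := hf'.exists_bound
  rw [e1, e2, husimi_mul_smear hw hσ hτ (by ring) hf'.1.continuous hb h1] at key
  simp only [lamGauss_zero_sqrt_mul w hσ.le] at key
  rw [key]
  refine integral_congr_ae (Filter.Eventually.of_forall fun u => ?_)
  -- The squared width is `σ(1-σ)` from completing the square plus `1-σ` from presmoothing `f`. It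
  -- tends to zero as `σ → 1`.
  have hpos : 0 < σ * (1 - σ) + (1 - σ) := by positivity
  dsimp only
  rw [husimi_husimi hw (mul_pos hσ hτ) hτ hf.isTempered, one_mul,
    husimi_smul_width hw (Real.sqrt_pos.2 hpos)]

/-- The centre is a convex combination of `u` and `z`, and the squared width `1 - σ²` is at most 1,
so the bound is uniform in `σ`. -/
lemma abs_convex_sub_smul_le {f : Phase N → ℝ} {C : ℝ} {d : ℕ} (hC : 0 ≤ C)
    (hb : ∀ y, |f y| ≤ C * (1 + ‖y‖) ^ d) (z : Phase N) {σ : ℝ} (hσ : 0 < σ ∧ σ < 1)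
    (u y : Phase N) :
    |f (u + (1 - σ) • (z - u) - √(σ * (1 - σ) + (1 - σ)) • y)|
      ≤ C * 2 ^ d * (1 + ‖u‖ + ‖z‖) ^ d * (1 + ‖y‖) ^ d := by
  refine (hb _).trans ?_
  have h1 : ‖u + (1 - σ) • (z - u)‖ ≤ ‖u‖ + ‖z‖ := by
    have : u + (1 - σ) • (z - u) = σ • u + (1 - σ) • z := by
      rw [smul_sub, sub_smul, sub_smul, one_smul, one_smul]; abel
    rw [this]
    refine (norm_add_le _ _).trans ?_
    rw [norm_smul, norm_smul, Real.norm_of_nonneg hσ.1.le,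
      Real.norm_of_nonneg (by linarith : 0 ≤ 1 - σ)]
    nlinarith [norm_nonneg u, norm_nonneg z]
  have h2 : √(σ * (1 - σ) + (1 - σ)) ≤ 1 := by
    rw [Real.sqrt_le_one]
    nlinarith
  have h3 : ‖√(σ * (1 - σ) + (1 - σ)) • y‖ ≤ ‖y‖ := by
    rw [norm_smul, Real.norm_of_nonneg (Real.sqrt_nonneg _)]
    exact mul_le_of_le_one_left (norm_nonneg _) h2
  have h4 : 1 + ‖u + (1 - σ) • (z - u) - √(σ * (1 - σ) + (1 - σ)) • y‖
      ≤ 2 * (1 + ‖u‖ + ‖z‖) * (1 + ‖y‖) := by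
    have := norm_sub_le (u + (1 - σ) • (z - u)) (√(σ * (1 - σ) + (1 - σ)) • y)
    nlinarith [norm_nonneg u, norm_nonneg z, norm_nonneg y,
      mul_nonneg (norm_nonneg u) (norm_nonneg y), mul_nonneg (norm_nonneg z) (norm_nonneg y)]
  calc C * (1 + ‖u + (1 - σ) • (z - u) - √(σ * (1 - σ) + (1 - σ)) • y‖) ^ d
      ≤ C * (2 * (1 + ‖u‖ + ‖z‖) * (1 + ‖y‖)) ^ d := by gcongr
    _ = _ := by rw [mul_pow, mul_pow]; ring

/-- An approximate identity with moving centre: the integrand converges pointwise to its value at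
`u`, dominated by a polynomial times the Gaussian. -/
lemma tendsto_integral_husimiKernel (hw : ∀ a, 0 < w a) {f : Phase N → ℝ} (hf : Continuous f)
    {l : Filter ℝ} [l.IsCountablyGenerated] {c : ℝ → Phase N} {ε : ℝ → ℝ} {u : Phase N}
    (hc : Filter.Tendsto c l (nhds u)) (hε : Filter.Tendsto ε l (nhds 0)) {K : ℝ} {d : ℕ}
    (hb : ∀ᶠ σ in l, ∀ y, |f (c σ - ε σ • y)| ≤ K * (1 + ‖y‖) ^ d) :
    Filter.Tendsto (fun σ => ∫ y, f (c σ - ε σ • y) * husimiKernel w y) l (nhds (f u)) := by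
  have hκ := isRapid_husimiKernel hw
  have hlim : ∫ y, f u * husimiKernel w y = f u := by
    rw [integral_const_mul, integral_husimiKernel hw, mul_one]
  have hyd : Integrable fun y : Phase N => K * (1 + ‖y‖) ^ d * husimiKernel w y := by
    refine integrable_mul_husimiKernel hw (isTempered_volume_of_bound (C := |K|) (d := d)
      (Continuous.aestronglyMeasurable (by fun_prop)) fun y => ?_)
    rw [abs_mul, abs_of_nonneg (by positivity : 0 ≤ (1 + ‖y‖) ^ d)]
  rw [← hlim]
  refine tendsto_integral_filter_of_dominated_convergence
    (fun y => K * (1 + ‖y‖) ^ d * husimiKernel w y) ?_ ?_ hyd ?_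
  · refine Filter.Eventually.of_forall fun σ => Continuous.aestronglyMeasurable ?_
    have h1 : Continuous fun y : Phase N => c σ - ε σ • y := by fun_prop
    exact (hf.comp h1).mul hκ.1.continuous
  · filter_upwards [hb] with σ hσ
    refine Filter.Eventually.of_forall fun y => ?_
    rw [norm_mul, Real.norm_of_nonneg (husimiKernel_pos hw y).le]
    exact mul_le_mul_of_nonneg_right (hσ y) (husimiKernel_pos hw y).le
  · refine Filter.Eventually.of_forall fun y => Filter.Tendsto.mul_const _ ?_
    have h1 : Filter.Tendsto (fun σ => c σ - ε σ • y) l (nhds (u - (0 : ℝ) • y)) :=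
      hc.sub (hε.smul_const y)
    rw [zero_smul, sub_zero] at h1
    exact (hf.tendsto u).comp h1

lemma abs_poly_le {K : ℝ} (hK : 0 ≤ K) (M : ℝ) (d : ℕ) (z u : Phase N) :
    |K * (1 + ‖u‖ + ‖z‖) ^ d * M| ≤ K * (1 + ‖z‖) ^ d * |M| * (1 + ‖u‖) ^ d := by
  rw [abs_mul, abs_mul, abs_of_nonneg hK, abs_of_nonneg (by positivity : 0 ≤ (1 + ‖u‖ + ‖z‖) ^ d)]
  have : (1 + ‖u‖ + ‖z‖) ^ d ≤ (1 + ‖z‖) ^ d * (1 + ‖u‖) ^ d := by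
    rw [← mul_pow]
    refine pow_le_pow_left₀ (by positivity) ?_ d
    nlinarith [mul_nonneg (norm_nonneg u) (norm_nonneg z)]
  calc K * (1 + ‖u‖ + ‖z‖) ^ d * |M|
      ≤ K * ((1 + ‖z‖) ^ d * (1 + ‖u‖) ^ d) * |M| :=
        mul_le_mul_of_nonneg_right (mul_le_mul_of_nonneg_left this hK) (abs_nonneg _)
    _ = _ := by ring

/-- Abel's theorem. As `σ` increases to 1, the series side converges by the assumed summability; on
the other side the Gaussian average of `f` around `u` shrinks to `f u`, dominated with the help of
the kernel in `z - u`. -/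
lemma lamExpGauss_zero_husimi_smear (hw : ∀ a, 0 < w a) {μ : Measure (Phase N)} [IsFiniteMeasure μ]
    {f : Phase N → ℝ} (hf : IsModerate f) (z : Phase N)
    (hs : Summable fun k : ℕ => 1 / (k.factorial : ℝ) *
      lamGauss w 0 k (husimi w f) (smear μ (fun _ => 1) (husimiKernel w)) z z) :
    lamExpGauss w 0 (husimi w f) (smear μ (fun _ => 1) (husimiKernel w)) z z
      = smear μ f (husimiKernel w) z := by
  have hκ := isRapid_husimiKernel hw
  obtain ⟨C, d, hC, hb⟩ := hf.exists_bound
  have hev : ∀ᶠ σ : ℝ in nhdsWithin 1 (Iio 1), 0 < σ ∧ σ < 1 :=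
    ((eventually_gt_nhds one_pos).filter_mono nhdsWithin_le_nhds).and self_mem_nhdsWithin
  have hcont {Y : Type} [TopologicalSpace Y] (F : ℝ → Y) (hF : Continuous F) :
      Filter.Tendsto F (nhdsWithin 1 (Iio 1)) (nhds (F 1)) :=
    hF.continuousAt.tendsto.mono_left nhdsWithin_le_nhds
  have hleft : Filter.Tendsto (fun σ : ℝ => ∑' k : ℕ, 1 / (k.factorial : ℝ) * (σ ^ k *
      lamGauss w 0 k (husimi w f) (smear μ (fun _ => 1) (husimiKernel w)) z z))
      (nhdsWithin 1 (Iio 1))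
      (nhds (lamExpGauss w 0 (husimi w f) (smear μ (fun _ => 1) (husimiKernel w)) z z)) := by
    refine tendsto_tsum_of_dominated_convergence hs.norm (fun k => ?_) ?_
    · have := hcont (fun σ => 1 / (k.factorial : ℝ) * (σ ^ k *
        lamGauss w 0 k (husimi w f) (smear μ (fun _ => 1) (husimiKernel w)) z z)) (by fun_prop)
      simpa using this
    · filter_upwards [hev] with σ hσ k
      rw [mul_left_comm, norm_mul]
      refine mul_le_of_le_one_left (norm_nonneg _) ?_
      rw [norm_pow, Real.norm_of_nonneg hσ.1.le]
      exact pow_le_one₀ hσ.1.le hσ.2.le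
  have hyd : Integrable fun y : Phase N => (1 + ‖y‖) ^ d * husimiKernel w y := by
    refine integrable_mul_husimiKernel hw (isTempered_volume_of_bound (C := 1) (d := d)
      (Continuous.aestronglyMeasurable (by fun_prop)) fun y => ?_)
    rw [one_mul, abs_of_nonneg (by positivity)]
  have hinner_bound {σ : ℝ} (hσ : 0 < σ ∧ σ < 1) (u y : Phase N) :
      ‖f (u + (1 - σ) • (z - u) - √(σ * (1 - σ) + (1 - σ)) • y) * husimiKernel w y‖
        ≤ C * 2 ^ d * (1 + ‖u‖ + ‖z‖) ^ d * ((1 + ‖y‖) ^ d * husimiKernel w y) := by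
    rw [norm_mul, Real.norm_of_nonneg (husimiKernel_pos hw y).le, ← mul_assoc]
    exact mul_le_mul_of_nonneg_right (abs_convex_sub_smul_le hC hb z hσ u y)
      (husimiKernel_pos hw y).le
  have hright : Filter.Tendsto (fun σ : ℝ => ∫ u, husimiKernel w (z - u) *
      (∫ y, f (u + (1 - σ) • (z - u) - √(σ * (1 - σ) + (1 - σ)) • y) * husimiKernel w y) ∂μ)
      (nhdsWithin 1 (Iio 1)) (nhds (∫ u, husimiKernel w (z - u) * f u ∂μ)) := by
    set M : ℝ := ∫ y : Phase N, (1 + ‖y‖) ^ d * husimiKernel w y with hM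
    refine tendsto_integral_filter_of_dominated_convergence
      (fun u => husimiKernel w (z - u) * (C * 2 ^ d * (1 + ‖u‖ + ‖z‖) ^ d * M)) ?_ ?_ ?_ ?_
    · refine Filter.Eventually.of_forall fun σ => AEStronglyMeasurable.mul
        (hκ.1.continuous.comp (by fun_prop)).aestronglyMeasurable ?_
      refine StronglyMeasurable.aestronglyMeasurable ?_
      refine StronglyMeasurable.integral_prod_right'
        (f := fun p : Phase N × Phase N => f (p.1 + (1 - σ) • (z - p.1) -
          √(σ * (1 - σ) + (1 - σ)) • p.2) * husimiKernel w p.2) ?_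
      exact ((hf.1.continuous.comp (by fun_prop)).mul
        (hκ.1.continuous.comp continuous_snd)).stronglyMeasurable
    · filter_upwards [hev] with σ hσ
      refine Filter.Eventually.of_forall fun u => ?_
      rw [norm_mul, Real.norm_of_nonneg (husimiKernel_pos hw _).le]
      refine mul_le_mul_of_nonneg_left ?_ (husimiKernel_pos hw _).le
      rw [hM, ← integral_const_mul]
      exact norm_integral_le_of_norm_le (hyd.const_mul _)
        (Filter.Eventually.of_forall fun y => hinner_bound hσ u y)
    · have hg : IsTempered μ fun u => C * 2 ^ d * (1 + ‖u‖ + ‖z‖) ^ d * M :=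
        isTempered_of_bound (Continuous.aestronglyMeasurable (by fun_prop))
          (abs_poly_le (mul_nonneg hC (pow_nonneg zero_le_two d)) M d z)
      have := hg.integrable_mul hκ z
      simpa only [mul_comm] using this
    · refine Filter.Eventually.of_forall fun u => Filter.Tendsto.const_mul _ ?_
      have h1 := hcont (fun σ => u + (1 - σ) • (z - u)) (by fun_prop)
      have h2 := hcont (fun σ => √(σ * (1 - σ) + (1 - σ))) (by fun_prop)
      simp only [sub_self, zero_smul, add_zero] at h1
      simp only [sub_self, mul_zero, add_zero, Real.sqrt_zero] at h2
      refine tendsto_integral_husimiKernel hw hf.1.continuous h1 h2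
        (K := C * 2 ^ d * (1 + ‖u‖ + ‖z‖) ^ d) (d := d) ?_
      filter_upwards [hev] with σ hσ y
      exact abs_convex_sub_smul_le hC hb z hσ u y
  have heq := tendsto_nhds_unique hleft (hright.congr' (by
    filter_upwards [hev] with σ hσ
    exact (tsum_pow_mul_lamGauss_zero hw hσ.1 hσ.2 hf z).symm))
  rw [heq, smear]
  exact integral_congr_ae (Filter.Eventually.of_forall fun u => mul_comm _ _)

end MeasureTransform

/-! ### The classical Liouville equation for measures -/

section ClassicalMeasures

variable {N : ℕ} {w : Coord N → ℝ} {H : Phase N → ℝ}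

lemma poisson_eq (f g : Phase N → ℝ) (z : Phase N) :
    poisson f g z = ∑ i : Fin N, (pd (Sum.inr i) f z * pd (Sum.inl i) g z
      - pd (Sum.inl i) f z * pd (Sum.inr i) g z) := rfl

lemma pd_comp_sub_left (a : Coord N) {f : Phase N → ℝ} (hf : Differentiable ℝ f)
    (z y : Phase N) : pd a (fun y => f (z - y)) y = -pd a f (z - y) := by
  have h := (hf (z - y)).hasFDerivAt.comp y ((hasFDerivAt_id y).const_sub z)
  have h' : HasFDerivAt (fun y => f (z - y)) _ y := h
  rw [h'.pd_eq]
  simp [pd]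

/-- The Poisson bracket in the Husimi representation of a measure. -/
lemma lamStep_genApply_husimi_smear {ħ : ℝ} (hħ : 0 < ħ) (hw : ∀ a, 0 < w a) (hH : IsModerate H)
    {I : Set ℝ} {Q : ℝ → Phase N → ℝ}
    (hc : NormallyConvergent Mechanics.classical ħ w I (husimi w H) Q) {t : ℝ} (ht : t ∈ I)
    {μ : Measure (Phase N)} [IsFiniteMeasure μ]
    (hQ : Q t = smear μ (fun _ => 1) (husimiKernel w)) (z : Phase N) :
    lamStep (genApply Mechanics.classical ħ w) (husimi w H) (Q t) z z
      = -∫ y, poisson H (fun y => husimiKernel w (z - y)) y ∂μ := by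
  have hκ := isRapid_husimiKernel hw
  have hκd : Differentiable ℝ (husimiKernel w) := hκ.1.differentiable (by simp)
  have h1 : IsTempered μ fun _ => 1 :=
    isTempered_of_bound (C := 1) (d := 0) aestronglyMeasurable_const (by simp)
  have hQs : ContDiff ℝ (⊤ : ℕ∞) (Q t) := hQ ▸ h1.contDiff_smear hκ
  have hh := (IsModerate.husimi hw hH).1
  have hT (a : Coord N) : IsTempered μ (pd a H) := by
    obtain ⟨C, d, -, hb⟩ := (hH.pd a).exists_bound
    exact isTempered_of_bound (hH.pd a).1.continuous.aestronglyMeasurable hb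
  -- The summability required by the product formula for measures comes from normal convergence.
  have hS (a : Coord N) :
      (fun z => genApply Mechanics.classical ħ w (pd a (husimi w H)) (Q t) z z)
        = smear μ (pd a H) (husimiKernel w) := by
    funext z
    have hs := (hc.pd_left a).summable_lamExpGauss hħ ht z z (n := 0) (by simp [lamCoeff])
    rw [hQ, pd_husimi hw hH] at hs ⊢
    exact lamExpGauss_zero_husimi_smear hw (hH.pd a) z hs
  -- The product formula covers the undifferentiated kernel only. The derivative on `Q` is therefore
  -- obtained from the product rule on the diagonal; the extra terms carry mixed second derivatives
  -- of `h` and cancel in `Λ`.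
  have hD (a b : Coord N) :
      genApply Mechanics.classical ħ w (pd a (husimi w H)) (pd b (Q t)) z z
        = smear μ (pd a H) (pd b (husimiKernel w)) z
          - genApply Mechanics.classical ħ w (pd b (pd a (husimi w H))) (Q t) z z := by
    have := (hc.pd_left a).pd_genApply_diag hħ (hh.pd a) ht hQs b z
    rw [hS, (hT a).pd_smear hκ] at this
    rw [this, add_sub_cancel_left]
  have hI (a b : Coord N) := (hT a).integrable_mul (hκ.pd b) z
  have hP (y : Phase N) : -poisson H (fun y => husimiKernel w (z - y)) y
      = ∑ i : Fin N, (pd (Sum.inr i) H y * pd (Sum.inl i) (husimiKernel w) (z - y)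
        - pd (Sum.inl i) H y * pd (Sum.inr i) (husimiKernel w) (z - y)) := by
    rw [poisson_eq, ← Finset.sum_neg_distrib]
    refine Finset.sum_congr rfl fun i _ => ?_
    rw [pd_comp_sub_left _ hκd, pd_comp_sub_left _ hκd]
    ring
  rw [← integral_neg]
  simp only [hP]
  rw [integral_finsetSum]
  · refine Finset.sum_congr rfl fun i _ => ?_
    rw [integral_sub (hI _ _) (hI _ _), hD, hD, pd_comm hh (Sum.inl i) (Sum.inr i)]
    simp only [smear]
    ring
  · exact fun i _ => (hI _ _).sub (hI _ _)

/-- The classical Liouville equation tested with the function `φ`. -/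
def WeakLiouvilleFor (I : Set ℝ) (H : Phase N → ℝ) (μ : ℝ → Measure (Phase N))
    (φ : Phase N → ℝ) : Prop :=
  ∀ t ∈ I, HasDerivWithinAt (fun τ => ∫ y, φ y ∂(μ τ)) (-∫ y, poisson H φ y ∂(μ t)) I t

lemma WeakLiouvilleFor.const_mul {I : Set ℝ} {μ : ℝ → Measure (Phase N)} {φ : Phase N → ℝ}
    (h : WeakLiouvilleFor I H μ φ) (hφ : Differentiable ℝ φ) (c : ℝ) :
    WeakLiouvilleFor I H μ fun y => c * φ y := by
  intro t ht
  have hpd (a : Coord N) (y : Phase N) : pd a (fun y => c * φ y) y = c * pd a φ y := by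
    rw [((hφ y).hasFDerivAt.const_mul c).pd_eq]
    rfl
  have hp (y : Phase N) : poisson H (fun y => c * φ y) y = c * poisson H φ y := by
    simp only [poisson_eq, hpd, Finset.mul_sum]
    exact Finset.sum_congr rfl fun i _ => by ring
  simp only [hp, integral_const_mul, ← mul_neg]
  exact (h t ht).const_mul c

/-- The constants depend on `H` only, not on the test function, as the domination of superpositions
demands. -/
lemma exists_bound_poisson (hH : IsModerate H) : ∃ (C : ℝ) (d : ℕ), 0 ≤ C ∧
    ∀ (φ : Phase N → ℝ) (y : Phase N) (B : ℝ), (∀ a, |pd a φ y| ≤ B) →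
      |poisson H φ y| ≤ C * (1 + ‖y‖) ^ d * B := by
  choose C d hC hb using fun a => (hH.pd a).exists_bound
  have hdD (a : Coord N) : d a ≤ ∑ a, d a :=
    Finset.single_le_sum (f := d) (fun _ _ => Nat.zero_le _) (Finset.mem_univ a)
  refine ⟨∑ i : Fin N, (C (Sum.inr i) + C (Sum.inl i)), ∑ a, d a,
    Finset.sum_nonneg fun i _ => add_nonneg (hC _) (hC _), fun φ y B hB => ?_⟩
  have hterm (a b : Coord N) : |pd a H y * pd b φ y| ≤ C a * (1 + ‖y‖) ^ (∑ a, d a) * B := by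
    rw [abs_mul]
    refine mul_le_mul ((hb a y).trans ?_) (hB b) (abs_nonneg _) (mul_nonneg (hC a) (by positivity))
    exact mul_le_mul_of_nonneg_left
      (pow_le_pow_right₀ (by linarith [norm_nonneg y]) (hdD a)) (hC a)
  rw [poisson_eq, Finset.sum_mul, Finset.sum_mul]
  refine (Finset.abs_sum_le_sum_abs _ _).trans (Finset.sum_le_sum fun i _ => ?_)
  rw [add_mul, add_mul]
  exact (abs_sub _ _).trans (add_le_add (hterm _ _) (hterm _ _))

namespace IsRegularMeasureState

variable {I : Set ℝ} {μ : ℝ → Measure (Phase N)}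

lemma exists_bound_moment (hμ : IsRegularMeasureState I μ) (d : ℕ) : ∃ M : ℝ, ∀ t ∈ I,
    Integrable (fun y => (1 + ‖y‖) ^ d) (μ t) ∧ ∫ y, (1 + ‖y‖) ^ d ∂(μ t) ≤ M := by
  obtain ⟨M, hM⟩ := hμ.moments d
  refine ⟨2 ^ (d - 1) * (1 + M), fun t ht => ?_⟩
  have := hμ.isProbabilityMeasure t ht
  have hle (y : Phase N) : (1 + ‖y‖) ^ d ≤ 2 ^ (d - 1) * (1 + ‖y‖ ^ d) := by
    simpa using add_pow_le zero_le_one (norm_nonneg y) d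
  have hint : Integrable (fun y : Phase N => 2 ^ (d - 1) * (1 + ‖y‖ ^ d)) (μ t) :=
    ((integrable_const 1).add (hM t ht).1).const_mul _
  have h1 : Integrable (fun y : Phase N => (1 + ‖y‖) ^ d) (μ t) := by
    refine hint.mono' (Continuous.aestronglyMeasurable (by fun_prop))
      (Filter.Eventually.of_forall fun y => ?_)
    rw [Real.norm_of_nonneg (by positivity)]
    exact hle y
  refine ⟨h1, (integral_mono h1 hint hle).trans ?_⟩
  rw [integral_const_mul, integral_add (integrable_const 1) (hM t ht).1]
  simp only [integral_const, probReal_univ, smul_eq_mul, mul_one]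
  gcongr
  exact (hM t ht).2

lemma integrable_prod (hμ : IsRegularMeasureState I μ) {t : ℝ} (ht : t ∈ I)
    {G : Phase N → Phase N → ℝ} (hG : Continuous (uncurry G)) {A : Phase N → ℝ}
    (hA : Integrable A) {d : ℕ} (hb : ∀ l y, |G l y| ≤ A l * (1 + ‖y‖) ^ d) :
    Integrable (uncurry G) (volume.prod (μ t)) := by
  have := hμ.isProbabilityMeasure t ht
  obtain ⟨M, hM⟩ := hμ.exists_bound_moment d
  exact (hA.mul_prod (hM t ht).1).mono' hG.aestronglyMeasurable
    (Filter.Eventually.of_forall fun p => hb p.1 p.2)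

end IsRegularMeasureState

lemma pd_integral {Φ : Phase N → Phase N → ℝ} {A : Phase N → ℝ} {d : ℕ}
    (hΦ : Continuous (uncurry Φ)) (hΦd : ∀ l, Differentiable ℝ (Φ l))
    (hΦ' : ∀ a, Continuous (uncurry fun l => pd a (Φ l)))
    (hA : Integrable A) (hb : ∀ l y, |Φ l y| ≤ A l * (1 + ‖y‖) ^ d)
    (hb' : ∀ a l y, |pd a (Φ l) y| ≤ A l * (1 + ‖y‖) ^ d) (a : Coord N) (y : Phase N) :
    pd a (fun y => ∫ l, Φ l y) y = ∫ l, pd a (Φ l) y := by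
  have hA0 (l : Phase N) : 0 ≤ A l := by simpa using (abs_nonneg _).trans (hb l 0)
  have hF (y : Phase N) : Continuous fun l => fderiv ℝ (Φ l) y := by
    have : (fun l => fderiv ℝ (Φ l) y) = fun l => ∑ a, pd a (Φ l) y • coordCLM a := by
      funext l
      ext v
      rw [fderiv_eq_sum_pd]
      simp [sum_apply, mul_comm, -Fintype.sum_sum_type]
    rw [this]
    refine continuous_finsetSum _ fun a _ => ?_
    have h1 : Continuous fun l => pd a (Φ l) y :=
      (hΦ' a).comp (continuous_id.prodMk continuous_const)
    exact h1.smul continuous_const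
  have hbd (l x : Phase N) (hx : x ∈ Metric.ball y 1) :
      ‖fderiv ℝ (Φ l) x‖ ≤ (Fintype.card (Coord N)) * (2 + ‖y‖) ^ d * A l := by
    have hx' : 1 + ‖x‖ ≤ 2 + ‖y‖ := by
      have h1 : ‖x - y‖ < 1 := by simpa [dist_eq_norm] using hx
      have h2 : ‖x‖ ≤ ‖x - y‖ + ‖y‖ := by simpa using norm_add_le (x - y) y
      linarith
    refine (norm_fderiv_le _ _).trans ((Finset.sum_le_sum fun a _ => (hb' a l x).trans
      (mul_le_mul_of_nonneg_left (pow_le_pow_left₀ (by positivity) hx' d) (hA0 l))).trans_eq ?_)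
    rw [Finset.sum_const, nsmul_eq_mul, Finset.card_univ]
    ring
  have hint (y : Phase N) : Integrable fun l => Φ l y :=
    (hA.mul_const ((1 + ‖y‖) ^ d)).mono'
      (hΦ.comp (continuous_id.prodMk continuous_const)).aestronglyMeasurable
      (Filter.Eventually.of_forall fun l => hb l y)
  have key := hasFDerivAt_integral_of_dominated_of_fderiv_le (μ := volume) (𝕜 := ℝ)
    (F := fun y l => Φ l y) (F' := fun y l => fderiv ℝ (Φ l) y) (x₀ := y)
    (bound := fun l => (Fintype.card (Coord N)) * (2 + ‖y‖) ^ d * A l)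
    (Metric.ball_mem_nhds y one_pos)
    (Filter.Eventually.of_forall fun y => (hint y).1) (hint y) (hF y).aestronglyMeasurable
    (Filter.Eventually.of_forall fun l x hx => hbd l x hx) (hA.const_mul _)
    (Filter.Eventually.of_forall fun l x _ => (hΦd l x).hasFDerivAt)
  rw [key.pd_eq, ContinuousLinearMap.integral_apply]
  · rfl
  · exact (hA.const_mul _).mono' (hF y).aestronglyMeasurable
      (Filter.Eventually.of_forall fun l => hbd l y (Metric.mem_ball_self one_pos))

/-- Superpositions of test functions that satisfy the weak Liouville equation satisfy it. -/
lemma IsRegularMeasureState.weakLiouvilleFor_integral {I : Set ℝ} (hI : Convex ℝ I)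
    {μ : ℝ → Measure (Phase N)} (hμ : IsRegularMeasureState I μ) (hH : IsModerate H)
    {Φ : Phase N → Phase N → ℝ} {A : Phase N → ℝ} {d : ℕ}
    (hΦ : Continuous (uncurry Φ)) (hΦd : ∀ l, Differentiable ℝ (Φ l))
    (hΦ' : ∀ a, Continuous (uncurry fun l => pd a (Φ l)))
    (hA : Integrable A) (hb : ∀ l y, |Φ l y| ≤ A l * (1 + ‖y‖) ^ d)
    (hb' : ∀ a l y, |pd a (Φ l) y| ≤ A l * (1 + ‖y‖) ^ d)
    (hW : ∀ l, WeakLiouvilleFor I H μ (Φ l)) : WeakLiouvilleFor I H μ fun y => ∫ l, Φ l y := by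
  intro t ht
  have hA0 (l : Phase N) : 0 ≤ A l := by simpa using (abs_nonneg _).trans (hb l 0)
  obtain ⟨C, e, hC, hpb⟩ := exists_bound_poisson hH
  have hbP (l y : Phase N) : |poisson H (Φ l) y| ≤ C * A l * (1 + ‖y‖) ^ (e + d) := by
    refine (hpb (Φ l) y _ fun a => hb' a l y).trans_eq ?_
    rw [pow_add]; ring
  have hcP : Continuous (uncurry fun l => poisson H (Φ l)) := by
    have h1 (a : Coord N) : Continuous fun p : Phase N × Phase N => pd a H p.2 :=
      (hH.pd a).1.continuous.comp continuous_snd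
    have h2 : (uncurry fun l => poisson H (Φ l)) = fun p : Phase N × Phase N => ∑ i : Fin N,
        (pd (Sum.inr i) H p.2 * pd (Sum.inl i) (Φ p.1) p.2
          - pd (Sum.inl i) H p.2 * pd (Sum.inr i) (Φ p.1) p.2) := rfl
    rw [h2]
    exact continuous_finsetSum _ fun i _ => ((h1 _).mul (hΦ' _)).sub ((h1 _).mul (hΦ' _))
  have hpφ (y : Phase N) : poisson H (fun y => ∫ l, Φ l y) y = ∫ l, poisson H (Φ l) y := by
    have hi (a b : Coord N) : Integrable fun l => pd a H y * pd b (Φ l) y :=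
      ((hA.mul_const ((1 + ‖y‖) ^ d)).mono'
        ((hΦ' b).comp (continuous_id.prodMk continuous_const)).aestronglyMeasurable
        (Filter.Eventually.of_forall fun l => hb' b l y)).const_mul _
    simp only [poisson_eq, pd_integral hΦ hΦd hΦ' hA hb hb']
    rw [integral_finsetSum]
    · refine Finset.sum_congr rfl fun i _ => ?_
      rw [integral_sub (hi _ _) (hi _ _), integral_const_mul, integral_const_mul]
    · exact fun i _ => (hi _ _).sub (hi _ _)
  have := hμ.isProbabilityMeasure t ht
  have hswap (τ : ℝ) (hτ : τ ∈ I) :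
      ∫ y, (∫ l, Φ l y) ∂(μ τ) = ∫ l, ∫ y, Φ l y ∂(μ τ) := by
    have := hμ.isProbabilityMeasure τ hτ
    exact (integral_integral_swap (hμ.integrable_prod hτ hΦ hA hb)).symm
  have hswapP : ∫ y, (∫ l, poisson H (Φ l) y) ∂(μ t) = ∫ l, ∫ y, poisson H (Φ l) y ∂(μ t) :=
    (integral_integral_swap (hμ.integrable_prod ht hcP (hA.const_mul C) hbP)).symm
  simp only [hpφ]
  rw [hswapP, ← integral_neg]
  refine HasDerivWithinAt.congr ?_ hswap (hswap t ht)
  -- Degree `e` comes from the gradient of `H` and `d` from the test functions; moments bounded in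
  -- time give a majorant for the superposed time derivatives.
  obtain ⟨M, hM⟩ := hμ.exists_bound_moment (e + d)
  refine hasDerivWithinAt_integral_of_dominated hI (F := fun τ l => ∫ y, Φ l y ∂(μ τ))
    (F' := fun τ l => -∫ y, poisson H (Φ l) y ∂(μ τ)) (bound := fun l => C * A l * M) ht
    (fun τ hτ => ?_) ?_ (Filter.Eventually.of_forall fun l τ hτ => ?_)
    ((hA.const_mul C).mul_const M) (Filter.Eventually.of_forall fun l τ hτ => hW l τ hτ)
  · have := hμ.isProbabilityMeasure τ hτ
    exact (hμ.integrable_prod hτ hΦ hA hb).integral_prod_left.1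
  · exact (hμ.integrable_prod ht hΦ hA hb).integral_prod_left
  · rw [norm_neg]
    refine (norm_integral_le_of_norm_le ((hM τ hτ).1.const_mul (C * A l))
      (Filter.Eventually.of_forall fun y => hbP l y)).trans ?_
    rw [integral_const_mul]
    exact mul_le_mul_of_nonneg_left (hM τ hτ).2 (mul_nonneg hC (hA0 l))

end ClassicalMeasures

/-! ### Test functions -/

section TestFunctions

variable {N : ℕ} {w : Coord N → ℝ} {H : Phase N → ℝ} {I : Set ℝ} {μ : ℝ → Measure (Phase N)}

lemma isRapid_of_hasCompactSupport {χ : Phase N → ℝ} (hχ : ContDiff ℝ (⊤ : ℕ∞) χ)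
    (hs : HasCompactSupport χ) : IsRapid χ := by
  refine ⟨hχ, fun l d => ?_⟩
  have hs' : HasCompactSupport (pds l χ) := by
    induction l with
    | nil => exact hs
    | cons a l ih => exact ih.fderiv_apply ℝ _
  obtain ⟨C, hC⟩ := Continuous.bounded_above_of_compact_support
    (f := fun y => (1 + ‖y‖) ^ d * pds l χ y)
    (Continuous.mul (by fun_prop) (hχ.pds l).continuous) hs'.mul_left
  refine ⟨C, fun y => (le_of_eq ?_).trans (hC y)⟩
  rw [norm_mul, Real.norm_of_nonneg (by positivity), Real.norm_eq_abs]

/-- The Peetre inequality with the roles exchanged: decay in the superposition parameter `l`, growth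
in `y`. -/
lemma IsRapid.abs_sub_le_right {ψ : Phase N → ℝ} (hψ : IsRapid ψ) (d : ℕ) :
    ∃ C : ℝ, 0 ≤ C ∧ ∀ l y : Phase N,
      |ψ (l - y)| ≤ C * ((1 + ‖l‖) ^ d)⁻¹ * (1 + ‖y‖) ^ d := by
  obtain ⟨C, hC, h⟩ := hψ.exists_bound d
  refine ⟨C, hC, fun l y => ?_⟩
  rw [mul_right_comm, ← div_eq_mul_inv, le_div_iff₀ (by positivity)]
  calc |ψ (l - y)| * (1 + ‖l‖) ^ d
      ≤ |ψ (l - y)| * ((1 + ‖y‖) * (1 + ‖l - y‖)) ^ d := by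
        rw [norm_sub_rev l y]
        gcongr; exact one_add_norm_le_mul l y
    _ = ((1 + ‖l - y‖) ^ d * |ψ (l - y)|) * (1 + ‖y‖) ^ d := by rw [mul_pow]; ring
    _ ≤ _ := by gcongr; exact h _

/-- Plane waves are eigenfunctions of convolutions. The sine part of the eigenvalue vanishes because
the kernel is even. -/
lemma integral_cos_mul_husimiKernel (hw : ∀ a, 0 < w a) (k y : Phase N) (θ : ℝ) :
    ∫ l, Real.cos (inner ℝ k l + θ) * husimiKernel w (l - y)
      = Real.cos (inner ℝ k y + θ) * ∫ u, Real.cos (inner ℝ k u) * husimiKernel w u := by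
  have hint (F : ℝ → ℝ) (hF : Continuous F) (hF1 : ∀ x, |F x| ≤ 1) :
      Integrable fun u : Phase N => F (inner ℝ k u) * husimiKernel w u :=
    integrable_mul_husimiKernel hw (isTempered_volume_of_bound (C := 1) (d := 0)
      (hF.comp (by fun_prop)).aestronglyMeasurable fun u => by simpa using hF1 _)
  have hsin : ∫ u : Phase N, Real.sin (inner ℝ k u) * husimiKernel w u = 0 := by
    have h := integral_neg_eq_self (fun u : Phase N => Real.sin (inner ℝ k u) * husimiKernel w u)
      volume
    simp only [inner_neg_right, Real.sin_neg, husimiKernel_neg, neg_mul, integral_neg] at h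
    linarith
  rw [← integral_add_right_eq_self _ y]
  simp only [add_sub_cancel_right]
  have hexp (u : Phase N) : Real.cos (inner ℝ k (u + y) + θ) * husimiKernel w u
      = Real.cos (inner ℝ k y + θ) * (Real.cos (inner ℝ k u) * husimiKernel w u)
        - Real.sin (inner ℝ k y + θ) * (Real.sin (inner ℝ k u) * husimiKernel w u) := by
    rw [inner_add_right, add_assoc, Real.cos_add]
    ring
  simp only [hexp]
  rw [integral_sub ((hint _ Real.continuous_cos Real.abs_cos_le_one).const_mul _)
    ((hint _ Real.continuous_sin Real.abs_sin_le_one).const_mul _), integral_const_mul,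
    integral_const_mul, hsin, mul_zero, sub_zero]

/-- If the eigenvalue vanished, so would the Husimi transform of the cosine; injectivity would then
make the cosine zero, although it equals 1 at the origin. -/
lemma integral_cos_husimiKernel_ne_zero (hw : ∀ a, 0 < w a) (k : Phase N) :
    ∫ u, Real.cos (inner ℝ k u) * husimiKernel w u ≠ 0 := by
  intro h0
  have hcont : Continuous fun u : Phase N => Real.cos (inner ℝ k u) := by fun_prop
  have hae := ae_eq_zero_of_integral_mul_husimiKernel hw
    (f := fun u => Real.cos (inner ℝ k u)) (fun z =>
      (isTempered_volume_of_bound (C := 1) (d := 0) hcont.aestronglyMeasurable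
        fun u => by simpa using Real.abs_cos_le_one _).integrable_mul (isRapid_husimiKernel hw) z)
    fun z => by
      have := integral_cos_mul_husimiKernel hw k z 0
      simp only [add_zero, h0, mul_zero] at this
      simpa only [husimiKernel_sub_comm w _ z] using this
  have := congrFun ((hcont.ae_eq_iff_eq volume continuous_zero).1 hae) 0
  simp at this

/-- Division by the nonzero eigenvalue represents a cosine as a superposition of translates of the
kernel. -/
lemma weakLiouvilleFor_cos (hI : Convex ℝ I) (hμ : IsRegularMeasureState I μ) (hH : IsModerate H)
    (hw : ∀ a, 0 < w a)
    (hW : ∀ z, WeakLiouvilleFor I H μ fun y => husimiKernel w (z - y)) (k : Phase N) (θ : ℝ) :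
    WeakLiouvilleFor I H μ fun y => Real.cos (inner ℝ k y + θ) := by
  have hκ := isRapid_husimiKernel hw
  have hκd : Differentiable ℝ (husimiKernel w) := hκ.1.differentiable (by simp)
  set c := ∫ u, Real.cos (inner ℝ k u) * husimiKernel w u with hc
  have hc0 : c ≠ 0 := integral_cos_husimiKernel_ne_zero hw k
  have heq : (fun y : Phase N => Real.cos (inner ℝ k y + θ))
      = fun y => ∫ l, c⁻¹ * Real.cos (inner ℝ k l + θ) * husimiKernel w (l - y) := by
    funext y
    simp only [mul_assoc]
    rw [integral_const_mul, integral_cos_mul_husimiKernel hw, ← hc]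
    field_simp
  -- The order `2 N + 1` makes the decay in `l` integrable; the growth in `y` is paid for by the
  -- moments of `μ`.
  obtain ⟨C₀, hC₀, h₀⟩ := hκ.abs_sub_le_right (2 * N + 1)
  choose C hC h using fun a => (hκ.pd a).abs_sub_le_right (2 * N + 1)
  have hshift (l : Phase N) : Differentiable ℝ fun y => husimiKernel w (l - y) :=
    hκd.comp (by fun_prop)
  have hpd (a : Coord N) (l y : Phase N) :
      pd a (fun y => c⁻¹ * Real.cos (inner ℝ k l + θ) * husimiKernel w (l - y)) y
        = c⁻¹ * Real.cos (inner ℝ k l + θ) * -pd a (husimiKernel w) (l - y) := by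
    rw [((hshift l y).hasFDerivAt.const_mul _).pd_eq, ← pd_comp_sub_left a hκd]
    rfl
  have hle (x B K : ℝ) (l y : Phase N) (hx : |x| ≤ B * ((1 + ‖l‖) ^ (2 * N + 1))⁻¹ *
      (1 + ‖y‖) ^ (2 * N + 1)) (hBK : B ≤ K) :
      |c⁻¹ * Real.cos (inner ℝ k l + θ) * x|
        ≤ |c⁻¹| * K * ((1 + ‖l‖) ^ (2 * N + 1))⁻¹ * (1 + ‖y‖) ^ (2 * N + 1) := by
    rw [abs_mul, abs_mul, mul_assoc, mul_assoc, mul_assoc]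
    refine mul_le_mul_of_nonneg_left ?_ (abs_nonneg _)
    refine (mul_le_of_le_one_left (abs_nonneg _) (Real.abs_cos_le_one _)).trans (hx.trans ?_)
    rw [← mul_assoc]
    gcongr
  have hK (a : Coord N) : C a ≤ C₀ + ∑ a, C a := by
    have := Finset.single_le_sum (f := C) (fun a _ => hC a) (Finset.mem_univ a)
    linarith
  have hK0 : C₀ ≤ C₀ + ∑ a, C a := by
    have := Finset.sum_nonneg (f := C) (s := Finset.univ) fun a _ => hC a
    linarith
  rw [heq]
  refine hμ.weakLiouvilleFor_integral hI hH
    (A := fun l => |c⁻¹| * (C₀ + ∑ a, C a) * ((1 + ‖l‖) ^ (2 * N + 1))⁻¹) (d := 2 * N + 1)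
    ?_ (fun l => (hshift l).const_mul _) (fun a => ?_)
    ((integrable_one_add_norm_pow N).const_mul _) (fun l y => ?_) (fun a l y => ?_)
    fun l => (hW l).const_mul (hshift l) _
  · exact Continuous.mul (by fun_prop) (hκ.1.continuous.comp (by fun_prop))
  · have : (uncurry fun l => pd a fun y => c⁻¹ * Real.cos (inner ℝ k l + θ) *
        husimiKernel w (l - y)) = fun p : Phase N × Phase N =>
        c⁻¹ * Real.cos (inner ℝ k p.1 + θ) * -pd a (husimiKernel w) (p.1 - p.2) :=
      funext fun p => hpd a p.1 p.2
    rw [this]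
    exact Continuous.mul (by fun_prop) ((hκ.pd a).1.continuous.comp (by fun_prop)).neg
  · exact hle _ C₀ _ l y (h₀ l y) hK0
  · rw [hpd]
    exact hle _ (C a) _ l y (by rw [abs_neg]; exact h a l y) (hK a)

-- The real part of the Fourier inversion formula writes a test function as a superposition of
-- cosines whose amplitudes decrease rapidly.
open FourierTransform in
lemma weakLiouvilleFor_of_forall_cos (hI : Convex ℝ I) (hμ : IsRegularMeasureState I μ)
    (hH : IsModerate H)
    (hW : ∀ (k : Phase N) (θ : ℝ), WeakLiouvilleFor I H μ fun y => Real.cos (inner ℝ k y + θ))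
    {φ : Phase N → ℝ} (hφ : ContDiff ℝ (⊤ : ℕ∞) φ) (hs : HasCompactSupport φ) :
    WeakLiouvilleFor I H μ φ := by
  have hsc : HasCompactSupport fun y => (φ y : ℂ) := hs.comp_left (g := Complex.ofReal) rfl
  have hφc : ContDiff ℝ (⊤ : ℕ∞) fun y => (φ y : ℂ) := Complex.ofRealCLM.contDiff.comp hφ
  set f : SchwartzMap (Phase N) ℂ := hsc.toSchwartzMap hφc with hf
  set g : SchwartzMap (Phase N) ℂ := 𝓕 f with hg
  set Φ : Phase N → Phase N → ℝ := fun k y =>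
    (g k).re * Real.cos (2 * Real.pi * inner ℝ k y)
      - (g k).im * Real.sin (2 * Real.pi * inner ℝ k y)
    with hΦ
  have hexp (k y : Phase N) : (Complex.exp (((2 * Real.pi * inner ℝ k y : ℝ) : ℂ) * Complex.I)
      • g k).re = Φ k y := by
    simp only [hΦ]
    generalize 2 * Real.pi * inner ℝ k y = x
    rw [Complex.exp_mul_I, ← Complex.ofReal_cos, ← Complex.ofReal_sin]
    simp [-Complex.ofReal_cos, -Complex.ofReal_sin]
    ring
  have heq : φ = fun y => ∫ k, Φ k y := by
    funext y
    have h1 : 𝓕⁻ (g : Phase N → ℂ) y = (φ y : ℂ) := by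
      have := congrFun (f.continuous.fourierInv_fourier_eq f.integrable
        (by simpa [hg, SchwartzMap.fourier_coe] using g.integrable)) y
      rw [hg, SchwartzMap.fourier_coe]
      exact this
    rw [Real.fourierInv_eq'] at h1
    have hint : Integrable fun k : Phase N =>
        Complex.exp (((2 * Real.pi * inner ℝ k y : ℝ) : ℂ) * Complex.I) • g k := by
      refine g.integrable.norm.mono' (Continuous.aestronglyMeasurable ?_)
        (Filter.Eventually.of_forall fun k => ?_)
      · have := g.continuous
        fun_prop
      · rw [norm_smul, Complex.norm_exp_ofReal_mul_I, one_mul]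
    have h2 := Complex.reCLM.integral_comp_comm hint
    rw [h1] at h2
    simp only [Complex.reCLM_apply, hexp, Complex.ofReal_re] at h2
    exact h2.symm
  have hdir (k y : Phase N) : HasFDerivAt (fun y => 2 * Real.pi * inner ℝ k y)
      ((2 * Real.pi) • innerSL ℝ k) y := ((innerSL ℝ k).hasFDerivAt (x := y)).const_mul _
  have hΦd (k y : Phase N) : HasFDerivAt (Φ k)
      ((g k).re • (-Real.sin (2 * Real.pi * inner ℝ k y)) • (2 * Real.pi) • innerSL ℝ k
        - (g k).im • (Real.cos (2 * Real.pi * inner ℝ k y)) • (2 * Real.pi) • innerSL ℝ k) y :=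
    ((hdir k y).cos.const_mul _).sub ((hdir k y).sin.const_mul _)
  have hpd (a : Coord N) (k y : Phase N) : pd a (Φ k) y = 2 * Real.pi * k a *
      (-((g k).re * Real.sin (2 * Real.pi * inner ℝ k y))
        - (g k).im * Real.cos (2 * Real.pi * inner ℝ k y)) := by
    rw [(hΦd k y).pd_eq]
    simp [EuclideanSpace.inner_single_right]
    ring
  have htrig (z : ℂ) (θ : ℝ) : |z.re * Real.cos θ - z.im * Real.sin θ| ≤ ‖z‖ ∧
      |-(z.re * Real.sin θ) - z.im * Real.cos θ| ≤ ‖z‖ := by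
    have hn : ‖z‖ ^ 2 = z.re ^ 2 + z.im ^ 2 := by rw [Complex.sq_norm, Complex.normSq_apply]; ring
    have hcs := Real.sin_sq_add_cos_sq θ
    constructor
    · refine abs_le_of_sq_le_sq ?_ (norm_nonneg z)
      rw [hn]
      nlinarith [sq_nonneg (z.re * Real.sin θ + z.im * Real.cos θ)]
    · refine abs_le_of_sq_le_sq ?_ (norm_nonneg z)
      rw [hn]
      nlinarith [sq_nonneg (z.re * Real.cos θ - z.im * Real.sin θ)]
  -- The first summand dominates the modes and the second their derivatives, which bring down a
  -- factor `2π k`.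
  have hA : Integrable fun k : Phase N => ‖g k‖ + 2 * Real.pi * (‖k‖ ^ 1 * ‖g k‖) :=
    g.integrable.norm.add ((g.integrable_pow_mul volume 1).const_mul _)
  have hgc := g.continuous
  rw [heq]
  refine hμ.weakLiouvilleFor_integral hI hH (d := 0) ?_
    (fun k y => (hΦd k y).differentiableAt) (fun a => ?_) hA (fun k y => ?_) (fun a k y => ?_)
    fun k => ?_
  · have : uncurry Φ = fun p : Phase N × Phase N =>
      (g p.1).re * Real.cos (2 * Real.pi * inner ℝ p.1 p.2)
        - (g p.1).im * Real.sin (2 * Real.pi * inner ℝ p.1 p.2) := rfl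
    rw [this]
    fun_prop
  · rw [show (uncurry fun k => pd a (Φ k)) = _ from funext fun p => hpd a p.1 p.2]
    fun_prop
  · rw [pow_zero, mul_one]
    refine (htrig (g k) _).1.trans (le_add_of_nonneg_right ?_)
    have := Real.pi_pos
    positivity
  · rw [pow_zero, mul_one, hpd, abs_mul, abs_mul, abs_of_pos (by have := Real.pi_pos; positivity)]
    refine le_trans ?_ (le_add_of_nonneg_left (norm_nonneg _))
    rw [mul_assoc, pow_one]
    have := Real.pi_pos
    gcongr
    · exact norm_coord_le k a
    · exact (htrig (g k) _).2
  -- The polar form of the Fourier coefficient merges cosine and sine into one cosine with a phase;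
  -- this is why arbitrary phases are carried along.
  · have hpolar : Φ k = fun y => ‖g k‖ * Real.cos (inner ℝ ((2 * Real.pi) • k) y + (g k).arg) := by
      funext y
      rw [Real.cos_add, mul_sub, inner_smul_left]
      simp only [hΦ, conj_trivial]
      rw [mul_left_comm, Complex.norm_mul_cos_arg, mul_left_comm, Complex.norm_mul_sin_arg]
      ring
    rw [hpolar]
    exact (hW _ _).const_mul (((innerSL ℝ _).differentiable.add_const _).cos) _

/-- The translates of a normalized bump integrate to 1. Inserting this continuous partition of unity
cuts the kernel into compactly supported smooth pieces, whose superposition is controlled by the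
moments. -/
lemma weakLiouvilleFor_husimiKernel (hI : Convex ℝ I) (hμ : IsRegularMeasureState I μ)
    (hH : IsModerate H) (hw : ∀ a, 0 < w a)
    (hW : ∀ φ : Phase N → ℝ, ContDiff ℝ (⊤ : ℕ∞) φ → HasCompactSupport φ →
      WeakLiouvilleFor I H μ φ) (z : Phase N) :
    WeakLiouvilleFor I H μ fun y => husimiKernel w (z - y) := by
  let b : ContDiffBump (0 : Phase N) := ⟨1, 2, one_pos, one_lt_two⟩
  set χ : Phase N → ℝ := b.normed volume with hχdef
  have hχ : IsRapid χ := isRapid_of_hasCompactSupport b.contDiff_normed b.hasCompactSupport_normed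
  have hχd : Differentiable ℝ χ := hχ.1.differentiable (by simp)
  have hκ := isRapid_husimiKernel hw
  have hκd : Differentiable ℝ (husimiKernel w) := hκ.1.differentiable (by simp)
  have hshift : Differentiable ℝ fun y => husimiKernel w (z - y) := hκd.comp (by fun_prop)
  have hχshift (l : Phase N) : Differentiable ℝ fun y => χ (y - l) := hχd.comp (by fun_prop)
  have heq : (fun y => husimiKernel w (z - y)) =
      fun y => ∫ l, χ (y - l) * husimiKernel w (z - y) := by
    funext y
    rw [integral_mul_const, integral_sub_left_eq_self χ volume y, hχdef, b.integral_normed, one_mul]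
  have hpd (a : Coord N) (l y : Phase N) : pd a (fun y => χ (y - l) * husimiKernel w (z - y)) y
      = χ (y - l) * -pd a (husimiKernel w) (z - y) + pd a χ (y - l) * husimiKernel w (z - y) := by
    rw [pd_mul a (hχshift l y) (hshift y), pd_comp_sub_left a hκd, pd_comp_sub]
  obtain ⟨C₀, hC₀, h₀⟩ := hχ.abs_sub_le (2 * N + 1)
  choose C hC h using fun a => (hχ.pd a).abs_sub_le (2 * N + 1)
  obtain ⟨K₀, hK₀, k₀⟩ := hκ.exists_bound 0
  choose K hK k using fun a => (hκ.pd a).exists_bound 0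
  simp only [pow_zero, one_mul] at k₀ k
  have hsC : 0 ≤ ∑ a, C a := Finset.sum_nonneg fun a _ => hC a
  have hsK : 0 ≤ ∑ a, K a := Finset.sum_nonneg fun a _ => hK a
  set B := C₀ * (K₀ + ∑ a, K a) + (∑ a, C a) * K₀ with hB
  have hprod (x x' c k s : ℝ) (hx : |x| ≤ c * s) (hx' : |x'| ≤ k) (hs : 0 ≤ s) (hc : 0 ≤ c) :
      |x * x'| ≤ c * k * s := by
    rw [abs_mul, mul_right_comm]
    exact mul_le_mul hx hx' (abs_nonneg _) (mul_nonneg hc hs)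
  have hs (l y : Phase N) : 0 ≤ (1 + ‖y‖) ^ (2 * N + 1) * ((1 + ‖l‖) ^ (2 * N + 1))⁻¹ := by
    positivity
  simp only [mul_assoc] at h₀ h
  rw [heq]
  refine hμ.weakLiouvilleFor_integral hI hH
    (A := fun l => B * ((1 + ‖l‖) ^ (2 * N + 1))⁻¹) (d := 2 * N + 1)
    ?_ (fun l => (hχshift l).mul hshift) (fun a => ?_)
    ((integrable_one_add_norm_pow N).const_mul _) (fun l y => ?_) (fun a l y => ?_)
    fun l => hW _ ?_ ?_
  · exact (hχ.1.continuous.comp (by fun_prop)).mul (hκ.1.continuous.comp (by fun_prop))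
  · rw [show (uncurry fun l => pd a fun y => χ (y - l) * husimiKernel w (z - y)) = _ from
      funext fun p => hpd a p.1 p.2]
    exact ((hχ.1.continuous.comp (by fun_prop)).mul
      ((hκ.pd a).1.continuous.comp (by fun_prop)).neg).add
      (((hχ.pd a).1.continuous.comp (by fun_prop)).mul (hκ.1.continuous.comp (by fun_prop)))
  · refine (hprod _ _ C₀ K₀ _ (h₀ y l) (k₀ _) (hs l y) hC₀).trans ?_
    rw [mul_assoc B, mul_comm ((1 + ‖l‖) ^ (2 * N + 1))⁻¹ ((1 + ‖y‖) ^ (2 * N + 1))]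
    refine mul_le_mul_of_nonneg_right ?_ (hs l y)
    nlinarith [mul_nonneg hC₀ hsK, mul_nonneg hsC hK₀]
  · rw [hpd]
    have e1 := hprod _ (-pd a (husimiKernel w) (z - y)) C₀ (K a) _ (h₀ y l)
      (by rw [abs_neg]; exact k a _) (hs l y) hC₀
    have e2 := hprod _ _ (C a) K₀ _ (h a y l) (k₀ (z - y)) (hs l y) (hC a)
    refine (abs_add_le _ _).trans ((add_le_add e1 e2).trans ?_)
    rw [← add_mul, mul_right_comm B, mul_assoc B]
    refine mul_le_mul_of_nonneg_right ?_ (hs l y)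
    have l1 := Finset.single_le_sum (f := C) (fun a _ => hC a) (Finset.mem_univ a)
    have l2 := Finset.single_le_sum (f := K) (fun a _ => hK a) (Finset.mem_univ a)
    nlinarith [mul_le_mul_of_nonneg_left l2 hC₀, mul_le_mul_of_nonneg_right l1 hK₀,
      mul_nonneg hC₀ hK₀]
  · exact (hχ.1.comp (by fun_prop)).mul (hκ.1.comp (by fun_prop))
  · exact HasCompactSupport.mul_right (b.hasCompactSupport_normed.comp_homeomorph
      (Homeomorph.subRight l))

/-- The Husimi form of the classical Liouville equation is the weak Liouville equation. -/
theorem husimiLiouville_iff_weakLiouville {ħ : ℝ} (hħ : 0 < ħ) (hI : Convex ℝ I)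
    (hμ : IsRegularMeasureState I μ) (hH : IsModerate H) (hw : ∀ a, 0 < w a)
    {Q : ℝ → Phase N → ℝ} (hc : NormallyConvergent Mechanics.classical ħ w I (husimi w H) Q)
    (hQ : ∀ t ∈ I, ∀ z, Q t z = ∫ y, husimiKernel w (z - y) ∂(μ t)) :
    HusimiLiouville Mechanics.classical ħ w I (husimi w H) Q ↔ WeakLiouville I H μ := by
  have hiff : HusimiLiouville Mechanics.classical ħ w I (husimi w H) Q ↔
      ∀ z, WeakLiouvilleFor I H μ fun y => husimiKernel w (z - y) := by
    rw [husimiLiouville_iff hc hħ]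
    simp only [WeakLiouvilleFor]
    refine ⟨fun h z t ht => ?_, fun h t ht z => ?_⟩
    all_goals
      have := hμ.isProbabilityMeasure t ht
      have hQt : Q t = smear (μ t) (fun _ => 1) (husimiKernel w) := funext fun z => by
        simp only [hQ t ht, smear, one_mul]
    · have := h t ht z
      rw [lamStep_genApply_husimi_smear hħ hw hH hc ht hQt] at this
      exact this.congr (fun τ hτ => (hQ τ hτ z).symm) (hQ t ht z).symm
    · rw [lamStep_genApply_husimi_smear hħ hw hH hc ht hQt]
      exact (h z t ht).congr (fun τ hτ => hQ τ hτ z) (hQ t ht z)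
  rw [hiff]
  -- From kernel translates through cosines to test functions in one direction, from test functions
  -- to the kernel in the other.
  exact ⟨fun h φ hφ hs => weakLiouvilleFor_of_forall_cos hI hμ hH
    (weakLiouvilleFor_cos hI hμ hH hw h) hφ hs,
    fun h z => weakLiouvilleFor_husimiKernel hI hμ hH hw h z⟩

end TestFunctions

end

/-! ### The joint Hamilton variation principle -/

theorem theorem1 {N : ℕ} {E : Type*} [NormedAddCommGroup E] [NormedSpace ℝ E]
    [FiniteDimensional ℝ E] [Nontrivial E]
    (m : Mechanics) (ħ : ℝ) (hħ : 0 < ħ)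
    (w : Fin N ⊕ Fin N → ℝ) (hw : ∀ a, 0 < w a)
    (hwħ : ∀ i : Fin N, w (Sum.inl i) * w (Sum.inr i) = ħ / 2)
    (ti tf : ℝ) (htt : ti < tf)
    (H : Phase N → ℝ) (hH : Function.HasTemperateGrowth H)
    (Q : ℝ → Phase N → ℝ)
    (hQ : IsRegularState m ħ w (Set.Icc ti tf) (husimi w H) Q) :
    -- the variation principle, the generalized Hamilton equations and the Liouville equation
    (∀ v : ℝ → Phase N → Phase N, IsFluidVelocity (Set.Icc ti tf) Q v →
      (HamiltonEquations m ħ w (Set.Icc ti tf) (husimi w H) Q v →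
        VariationPrinciple E m ħ w ti tf (husimi w H) Q v) ∧
      (∀ (D : Set (Phase N)) (Φ A : ℝ → Phase N → Phase N), IsParcelFlow ti tf Q v D Φ A →
        VariationPrinciple E m ħ w ti tf (husimi w H) Q v →
          HamiltonEquations m ħ w (Set.Icc ti tf) (husimi w H) Q v) ∧
      (HamiltonEquations m ħ w (Set.Icc ti tf) (husimi w H) Q v →
        HusimiLiouville m ħ w (Set.Icc ti tf) (husimi w H) Q)) ∧
    -- every evolving state is a fluid that moves by the generalized Hamilton equations
    -- and obeys the variation principle
    (HusimiLiouville m ħ w (Set.Icc ti tf) (husimi w H) Q →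
      ∃ v : ℝ → Phase N → Phase N, IsFluidVelocity (Set.Icc ti tf) Q v ∧
        HamiltonEquations m ħ w (Set.Icc ti tf) (husimi w H) Q v ∧
        VariationPrinciple E m ħ w ti tf (husimi w H) Q v) ∧
    -- the inverse Husimi transform
    (∀ P : ℝ → Phase N → ℝ, IsRegularDistribution m ħ (Set.Icc ti tf) H P →
      (∀ t ∈ Set.Icc ti tf, Q t = husimi w (P t)) →
      (HusimiLiouville m ħ w (Set.Icc ti tf) (husimi w H) Q ↔
        LiouvilleEq m ħ (Set.Icc ti tf) H P)) ∧
    (m = Mechanics.classical →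
      ∀ μ : ℝ → MeasureTheory.Measure (Phase N), IsRegularMeasureState (Set.Icc ti tf) μ →
      (∀ t ∈ Set.Icc ti tf, ∀ z, Q t z = ∫ y, husimiKernel w (z - y) ∂(μ t)) →
      (HusimiLiouville m ħ w (Set.Icc ti tf) (husimi w H) Q ↔
        WeakLiouville (Set.Icc ti tf) H μ)) := by
  have : CompleteSpace E := FiniteDimensional.complete ℝ E
  have hHm : IsModerate H := hH.isModerate
  have hh : ContDiff ℝ (⊤ : ℕ∞) (husimi w H) := (IsModerate.husimi hw hHm).1
  refine ⟨fun v hv => ⟨fun hE => ?_, fun D Φ A hΦ hV => ?_, fun hE => ?_⟩, fun hL => ?_,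
    fun P hP hQP => ?_, ?_⟩
  · exact hQ.variationPrinciple_of_hamiltonEquations htt hħ hh hv hE
  · exact hΦ.hamiltonEquations_of_variationPrinciple htt hQ hħ hh hv hV
  · exact hQ.husimiLiouville_of_hamiltonEquations htt hħ hh hv hE
  · have hv := hQ.isFluidVelocity_hamiltonVelocity hħ hh hL
    exact ⟨_, hv, hamiltonEquations_hamiltonVelocity,
      hQ.variationPrinciple_of_hamiltonEquations htt hħ hh hv hamiltonEquations_hamiltonVelocity⟩
  · exact hP.husimiLiouville_iff_liouvilleEq htt hħ hw hHm hQ.convergent hQP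
  · rintro rfl μ hμ hQμ
    exact husimiLiouville_iff_weakLiouville hħ (convex_Icc ti tf) hμ hHm hw hQ.convergent hQμ
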